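/- **Model.** Time is discrete ($\mathbb T=\mathbb N$) or continuous ($\mathbb T=[0,\infty)$). Packets $1,2,\dots$ arrive at times $a_1\le a_2\le\cdots$ ($a_1\geq 0$) at a single-server queue that is empty at time $0$. Their service times $S_1,S_2,\dots$ are i.i.d. with the law of $S$ and mean $\mathbb E[S]=1/\mu$, $0<\mu<\infty$; in discrete time $S$ takes values in $\{1,2,\dots\}$, in continuous time $S\ge 0$ has a density. At each arrival and each departure a service discipline chooses, as a (measurable) function of the past arrivals and departures and their times, which of the packets present is served next; the server never idles while a packet is present, and an interrupted service is later resumed (FIFO and preemptive LCFS are examples). A service that is completed at the instant of an arrival counts as completed before that arrival. Let $d_1\le d_2\le\dots\le d_n$ be the departure times, in chronological order, when $n$ packets are fed to the queue, and let $A_i=a_i-a_{i-1}$, $D_i=d_i-d_{i-1}$ ($a_0=d_0=0$). **Codes.** An $(n,M,T,\epsilon)$-code ($M\ge1$) assigns to each message $u\in\{1,\dots,M\}$ arrival times $a_1\le\dots\le a_n$ and has a decoder $\hat u(d^n)$ such that, over equiprobable messages and the service times, $\mathbb E[d_n]\le T$ and $\mathbb P(\hat u\ne u)\le\epsilon$.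 In a feedback code $a_i$ may also depend causally on the departures: whether $a_i=t$ depends only on $u$ and on $\{d_k: d_k<t\}$. The capacity $C(\lambda)$ (with feedback: $C_F(\lambda)$) at output rate $\lambda$ is the largest $R$ such that for every $\gamma>0$ there is a sequence, $n\to\infty$, of $(n,M_n,n/\lambda,\epsilon_n)$-codes (feedback codes) with $\lambda\,\frac{\log M_n}{n}>R-\gamma$ and $\epsilon_n\to0$ (it is $+\infty$ if all real $R$ qualify). Logarithms are to the base $2$. **Theorem.** *Discrete time.* For $0<\lambda\le1$ let $g_\lambda$ be the geometric law on $\{1,2,\dots\}$ with mean $1/\lambda$ and $H(g_\lambda)=\frac{-\lambda\log\lambda-(1-\lambda)\log(1-\lambda)}{\lambda}$ its entropy. Suppose that for every $0<\lambda<\mu$ $$H(g_\lambda)\le\liminf_{n\to\infty}\frac{H(D^n)}{n},$$ where $D^n=(D_1,\dots,D_n)$ are the interdepartures when the interarrivals $A_1,\dots,A_n$ are i.i.d. with law $g_\lambda$ and independent of the service times, and $H$ is Shannon entropy. Then for every $0<\lambda<\mu$ $$C_F(\lambda)=C(\lambda)=\lambda\,\bigl(H(g_\lambda)-H(S)\bigr),$$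 so that feedback does not increase the capacity at output rate $\lambda$. If the discipline is FIFO, this also holds for $\lambda=\mu$. *Continuous time.* The same holds with $g_\lambda$ replaced by the exponential law of mean $1/\lambda$ and with $H$ the differential entropy. (The value $H=-\infty$ is allowed; a law without density has $H=-\infty$.) -/

import Mathlib

open MeasureTheory ProbabilityTheory Filter Topology
open scoped ENNReal

namespace TimingChannel

/-! ### The single-server queue

Packets are numbered `0, 1, 2, …` in order of arrival; the queue is empty at time `0`.  Time is a
linearly ordered set `T`; it is `ℕ` in the discrete-time model and `ℝ` in the continuous-time one.
-/

/-- What an observer of the queue sees: the next packet arrives, or packet `i` departs. -/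
inductive Event : Type
  | arrival : Event
  | departure (i : ℕ) : Event

/-- A service discipline: at every arrival and at every departure it chooses which of the packets
present is served until the next arrival or departure.  The choice may depend, measurably in the
times, on all past arrivals and departures (listed with the most recent first) and on their times,
but not on future arrivals nor on the unfinished service times.  The choice is always made among
the packets present, so the server never idles while a packet is present; a packet whose service is
interrupted keeps the service that it has already received. -/
structure Discipline (T : Type) [MeasurableSpace T] where
  select : (h : List Event) → (Fin h.length → T) → Finset ℕ → ℕ
  select_mem : ∀ (h : List Event) (τ : Fin h.length → T) (P : Finset ℕ),
    P.Nonempty → select h τ P ∈ P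
  measurable_select : ∀ (h : List Event) (P : Finset ℕ), Measurable fun τ => select h τ P

/-- First In First Out: serve the packet present that arrived first. -/
def fifo (T : Type) [MeasurableSpace T] : Discipline T where
  select _ _ P := if h : P.Nonempty then P.min' h else 0
  select_mem _ _ P hP := by
    simp only [hP, dite_true]
    exact P.min'_mem hP
  measurable_select _ _ := measurable_const

/-- The state of the queue right after an event. -/
structure QState (T : Type) where
  /-- past events, most recent first -/
  hist : List Event
  /-- the times of the past events -/
  times : Fin hist.length → T
  /-- the time of the last event (`0` initially) -/
  clock : T
  /-- the number of packets that have arrived -/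
  arrived : ℕ
  /-- the packets present in the system -/
  present : Finset ℕ
  /-- the service that each packet present still needs -/
  residual : ℕ → T
  /-- the departure times so far, in chronological order -/
  out : List T

section Queue

variable {T : Type} [LinearOrder T] [AddCommMonoid T] [Sub T] [MeasurableSpace T]

/-- The empty queue at time `0`. -/
def QState.init : QState T where
  hist := []
  times := fun _ => 0
  clock := 0
  arrived := 0
  present := ∅
  residual := fun _ => 0
  out := []

/-- The next packet arrives at time `t` and requires the service time `x`; `r` is what the
other packets present still need at that time. -/
def QState.arrive (st : QState T) (t x : T) (r : ℕ → T) : QState T where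
  hist := Event.arrival :: st.hist
  times := Fin.cons t st.times
  clock := t
  arrived := st.arrived + 1
  present := insert st.arrived st.present
  residual := Function.update r st.arrived x
  out := st.out

/-- Packet `j` departs at time `t`. -/
def QState.depart (st : QState T) (t : T) (j : ℕ) : QState T where
  hist := Event.departure j :: st.hist
  times := Fin.cons t st.times
  clock := t
  arrived := st.arrived
  present := st.present.erase j
  residual := st.residual
  out := st.out ++ [t]

/-- The next event in a queue that is fed `n` packets with arrival times `a` and service times `s`.
If a packet `j` is in service it leaves when its residual service is exhausted, unless a packet
arrives strictly before that. -/
def Discipline.step (Q : Discipline T) (n : ℕ) (a s : ℕ → T) (st : QState T) : QState T :=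
  if st.present.Nonempty then
    let j := Q.select st.hist st.times st.present
    let t := st.clock + st.residual j
    if st.arrived < n ∧ a st.arrived < t then
      st.arrive (a st.arrived) (s st.arrived)
        (Function.update st.residual j (st.residual j - (a st.arrived - st.clock)))
    else st.depart t j
  else if st.arrived < n then st.arrive (a st.arrived) (s st.arrived) st.residual
  else st

/-- Extension of a finite sequence by `0`. -/
def extendZero {n : ℕ} (x : Fin n → T) (i : ℕ) : T := if h : i < n then x ⟨i, h⟩ else 0

/-- The times of the `n` departures, in chronological order, when `n` packets with (nondecreasing)
arrival times `a` and service times `s` are fed to the queue: there are `2n` events in all. -/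
def Discipline.departures (Q : Discipline T) {n : ℕ} (a s : Fin n → T) : Fin n → T :=
  fun k => (((Q.step n (extendZero a) (extendZero s))^[2 * n] QState.init).out).getD k 0

/-- Arrival times from interarrival times: `a_i = A_0 + ⋯ + A_i`. -/
def arrivalTimes {n : ℕ} (A : Fin n → T) : Fin n → T := fun i => ∑ j ∈ Finset.Iic i, A j

/-- Interdeparture times `D_i = d_i - d_{i-1}`, with the convention that the time
preceding the first departure is `0`. -/
def interdepartures {n : ℕ} (d : Fin n → T) : Fin n → T := fun i =>
  d i - (if 0 < (i : ℕ) then d ⟨i - 1, by omega⟩ else 0)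

/-- The time of the last of the `n` departures (`0` if `n = 0`). -/
def lastTime {n : ℕ} (d : Fin n → T) : T := if h : 0 < n then d ⟨n - 1, by omega⟩ else 0

/-- The law of the interdepartures `D^n` when the interarrivals `A^n` are i.i.d. with law `α`, and
independent of the service times, which are i.i.d. with law `ν`. -/
noncomputable def Discipline.interdepartureLaw (Q : Discipline T) (ν α : Measure T) (n : ℕ) :
    Measure (Fin n → T) :=
  ((Measure.pi fun _ : Fin n => α).prod (Measure.pi fun _ : Fin n => ν)).map
    fun p => interdepartures (Q.departures (arrivalTimes p.1) p.2)

/-! ### Codes and capacities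

Below `ν` is the law of the service times and `ι` reads a time as a real number.
-/

/-- There is an `(n, M, τ, ε)`-code for the channel without feedback: message `u` is sent as the
arrival times `enc u`; the mean time of the `n`-th departure, averaged over equiprobable messages,
is at most `τ`, and the average probability of a decoding error is at most `ε`. -/
def Discipline.HasCode (Q : Discipline T) (ν : Measure T) (ι : T → ℝ) (n M : ℕ) (τ ε : ℝ) : Prop :=
  0 < M ∧ ∃ (enc : Fin M → Fin n → T) (dec : (Fin n → T) → Fin M),
    (∀ u, Monotone (enc u)) ∧ (∀ u i, 0 ≤ enc u i) ∧ Measurable dec ∧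
    (∑ u, ∫⁻ s, ENNReal.ofReal (ι (lastTime (Q.departures (enc u) s)))
        ∂(Measure.pi fun _ : Fin n => ν)) / M ≤ ENNReal.ofReal τ ∧
    (∑ u, (Measure.pi fun _ : Fin n => ν).real {s | dec (Q.departures (enc u) s) ≠ u}) / M ≤ ε

/-- There is an `(n, M, τ, ε)`-code for the channel with feedback.  Here `enc u d` are the arrival
times when the message is `u` and the departure times are `d`; whether the `i`-th arrival takes
place at time `t` depends only on the departures strictly before `t` (two vectors `d`, `d'` have the
same coordinates below `t` exactly when `min (d k) t = min (d' k) t` for all `k`).  The vector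
`dep u s` of departure times for the message `u` and the service times `s` closes the loop: it is
what the queue produces from the arrival times `enc u (dep u s)`. -/
def Discipline.HasFeedbackCode (Q : Discipline T) (ν : Measure T) (ι : T → ℝ) (n M : ℕ)
    (τ ε : ℝ) : Prop :=
  0 < M ∧ ∃ (enc dep : Fin M → (Fin n → T) → (Fin n → T)) (dec : (Fin n → T) → Fin M),
    (∀ u, Measurable (enc u)) ∧ (∀ u, Measurable (dep u)) ∧ Measurable dec ∧
    (∀ u i d d', (∀ k, min (d k) (enc u d i) = min (d' k) (enc u d i)) →
      enc u d' i = enc u d i) ∧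
    (∀ u, ∀ᵐ s ∂(Measure.pi fun _ : Fin n => ν),
      Monotone (enc u (dep u s)) ∧ (∀ i, 0 ≤ enc u (dep u s) i) ∧
        dep u s = Q.departures (enc u (dep u s)) s) ∧
    (∑ u, ∫⁻ s, ENNReal.ofReal (ι (lastTime (dep u s)))
        ∂(Measure.pi fun _ : Fin n => ν)) / M ≤ ENNReal.ofReal τ ∧
    (∑ u, (Measure.pi fun _ : Fin n => ν).real {s | dec (dep u s) ≠ u}) / M ≤ ε

/-- `R` is achievable at output rate `lam`: for every `γ > 0` there is a sequence of
`(n, M, n / lam, ε)`-codes with `lam * log₂ M / n > R - γ` and `ε → 0`. -/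
def Achievable (Code : ℕ → ℕ → ℝ → ℝ → Prop) (lam R : ℝ) : Prop :=
  ∀ γ : ℝ, 0 < γ → ∃ (M : ℕ → ℕ) (ε : ℕ → ℝ), Tendsto ε atTop (𝓝 0) ∧
    ∀ᶠ n : ℕ in atTop, Code n (M n) (n / lam) (ε n) ∧ R - γ < lam * (Real.logb 2 (M n) / n)

/-- The largest achievable `R` at output rate `lam`, in bits per unit of time (`⊤` if all real `R`
are achievable). -/
noncomputable def capacityOf (Code : ℕ → ℕ → ℝ → ℝ → Prop) (lam : ℝ) : EReal :=
  sSup ((fun R : ℝ => (R : EReal)) '' {R : ℝ | Achievable Code lam R})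

/-- `C(lam)`: capacity without feedback at output rate `lam`. -/
noncomputable def Discipline.capacity (Q : Discipline T) (ν : Measure T) (ι : T → ℝ) (lam : ℝ) :
    EReal :=
  capacityOf (Q.HasCode ν ι) lam

/-- `C_F(lam)`: capacity with feedback at output rate `lam`. -/
noncomputable def Discipline.feedbackCapacity (Q : Discipline T) (ν : Measure T) (ι : T → ℝ)
    (lam : ℝ) : EReal :=
  capacityOf (Q.HasFeedbackCode ν ι) lam

end Queue

/-! ### Entropies, in bits -/

/-- Shannon entropy `-∑ p(x) log₂ p(x)` of a probability measure on a countable set. -/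
noncomputable def shannonEntropy {X : Type} [MeasurableSpace X] (P : Measure X) : EReal :=
  ((∑' x, ENNReal.ofReal (-(P.real {x} * Real.logb 2 (P.real {x}))) : ℝ≥0∞) : EReal)

/-- Differential entropy `-∫ f log₂ f` of a probability measure with density `f`, as the difference
of the integrals of the positive and the negative part of `-f log₂ f`; `⊥` if there is
no density. -/
noncomputable def diffEntropy {X : Type} [MeasureSpace X] (P : Measure X) : EReal :=
  open Classical in
  if P ≪ (volume : Measure X) then
    ((∫⁻ x, ENNReal.ofReal
        (-((P.rnDeriv volume x).toReal * Real.logb 2 (P.rnDeriv volume x).toReal)) : ℝ≥0∞) : EReal)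
      - ((∫⁻ x, ENNReal.ofReal
        ((P.rnDeriv volume x).toReal * Real.logb 2 (P.rnDeriv volume x).toReal) : ℝ≥0∞) : EReal)
  else ⊥

/-- The geometric law `k ↦ lam (1 - lam)^(k-1)` on `{1, 2, …}`, of mean `1 / lam`,
for `0 < lam ≤ 1`. -/
noncomputable def geomLaw (lam : ℝ) : Measure ℕ :=
  (geometricMeasure (Set.projIcc (0 : ℝ) 1 zero_le_one lam)).map (· + 1)

/-- `H(g_lam)`: the entropy of the geometric law of mean `1 / lam`. -/
noncomputable def geomEntropy (lam : ℝ) : ℝ :=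
  (-lam * Real.logb 2 lam - (1 - lam) * Real.logb 2 (1 - lam)) / lam

end TimingChannel

/-!
The proof treats discrete and continuous time together.  The time axis carries a reference measure
`m` (the counting measure on `ℕ`, the Lebesgue measure on `ℝ`), and entropies are means of
`-log` of densities with respect to `m`.

The basic fact is that a service discipline does not create or destroy volume.  An observer of the
arrivals and departures can simulate the queue and recover the service times
(`Discipline.recover_departures`), even if the arrivals depend causally on the departures.  For the
counting measure this injectivity suffices (`isReference_count`).  In continuous time the departure
times split into countably many pieces, according to the order of the events, and on each piece the
service times arise from them by a triangular shear and a permutation, which preserve Lebesgue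
measure (`measurePreserving_wordMap`, `wordMap_word`, `isReference_volume`).  So, for a fixed
message, the likelihood of the output is the product of the service densities `f` at the recovered
service times.

*Converse* (`log_card_le_of_hasFeedbackCode`).  The output is compared with i.i.d. interdepartures
of geometric or exponential density `g`.  The logarithm of `g` is affine in time, so the mean
log-likelihood ratio only depends on the entropy of `S` and on the mean of the last departure time,
which the code constrains.  Feedback plays no role in this bound.

*Achievability* (`achievable_of_lt`).  Codewords with i.i.d. interarrivals of density `g`, at a rate
slightly above the output rate, are drawn at random (`exists_codebook`), and the decoder looks for a
codeword whose likelihood exceeds the i.i.d. output density by a given factor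
(`measure_typicalSet_le`, `measure_not_typicalSet_le`).  This needs that the true output density is
not much larger than the i.i.d. one, which is what the hypothesis on the entropy of the
interdepartures gives (`eventually_measure_ratio_le`), and that a stable queue delays the last
departure by `o(n)` in the mean (`eventually_lintegral_completion_le`).  A service law of entropy
`-∞` is handled by truncating `log f` (`exists_integrable_le_log`).

*FIFO at the critical rate* (`entropy_le_of_fifo`).  As the arrival rate tends to `μ`, packets
rarely find the queue idle, and the other interdepartures are service times.  Gibbs' inequality with a
mixture of `f` and `g` turns the hypothesis into the bound that the entropy of `S` is at least that
of `g_μ`.  The converse bound is then at most `0`, the rate `0` is achievable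
(`achievable_zero`), and hence both sides of the formula vanish.
-/

set_option linter.unusedSectionVars false

namespace TimingChannel

/-! ### Dynamics of the queue -/

section Dynamics

variable {T : Type} [LinearOrder T] [AddCommMonoid T] [Sub T] [MeasurableSpace T]

/-- The state of the queue after `m` events. -/
def Discipline.run (Q : Discipline T) (n : ℕ) (a s : ℕ → T) (m : ℕ) : QState T :=
  (Q.step n a s)^[m] QState.init

/-- The packet in service in a given state (relevant only if a packet is present). -/
def Discipline.served (Q : Discipline T) (st : QState T) : ℕ :=
  Q.select st.hist st.times st.present

/-- The time at which the first `i` packets have all left a work-conserving server, if no other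
packet arrives; it does not depend on the discipline. -/
def completion (a s : ℕ → T) : ℕ → T
  | 0 => 0
  | i + 1 => max (completion a s i) (a i) + s i

theorem Discipline.run_succ (Q : Discipline T) (n : ℕ) (a s : ℕ → T) (m : ℕ) :
    Q.run n a s (m + 1) = Q.step n a s (Q.run n a s m) :=
  Function.iterate_succ_apply' _ _ _

/-- The four kinds of steps: an arrival at an idle server, no event at all because everyone has
left, an arrival that interrupts a service, and a departure. -/
theorem Discipline.step_cases (Q : Discipline T) (n : ℕ) (a s : ℕ → T) (st : QState T) :
    (st.present = ∅ ∧ st.arrived < n ∧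
      Q.step n a s st = st.arrive (a st.arrived) (s st.arrived) st.residual) ∨
    (st.present = ∅ ∧ ¬ st.arrived < n ∧ Q.step n a s st = st) ∨
    (Q.served st ∈ st.present ∧ st.arrived < n ∧
      a st.arrived < st.clock + st.residual (Q.served st) ∧
      Q.step n a s st = st.arrive (a st.arrived) (s st.arrived)
        (Function.update st.residual (Q.served st)
          (st.residual (Q.served st) - (a st.arrived - st.clock)))) ∨
    (Q.served st ∈ st.present ∧
      (st.arrived < n → st.clock + st.residual (Q.served st) ≤ a st.arrived) ∧
      Q.step n a s st = st.depart (st.clock + st.residual (Q.served st)) (Q.served st)) := by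
  by_cases hp : st.present.Nonempty
  · have hmem : Q.served st ∈ st.present := Q.select_mem _ _ _ hp
    by_cases h : st.arrived < n ∧ a st.arrived < st.clock + st.residual (Q.served st)
    · refine Or.inr (Or.inr (Or.inl ⟨hmem, h.1, h.2, ?_⟩))
      have h' := h
      unfold Discipline.served at h'
      simp only [Discipline.step, hp, if_true, h', and_self, Discipline.served]
    · refine Or.inr (Or.inr (Or.inr ⟨hmem, fun h1 => ?_, ?_⟩))
      · by_contra h2
        exact h ⟨h1, not_le.1 h2⟩
      · have h' := h
        unfold Discipline.served at h'
        simp only [Discipline.step, hp, if_true, h', if_false, Discipline.served]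
  · have he : st.present = ∅ := Finset.not_nonempty_iff_eq_empty.1 hp
    by_cases h : st.arrived < n
    · exact Or.inl ⟨he, h, by simp [Discipline.step, he, h]⟩
    · exact Or.inr (Or.inl ⟨he, h, by simp [Discipline.step, he, h]⟩)

/-- Admissible inputs: nondecreasing nonnegative arrival times and positive service times. -/
structure IsInput (n : ℕ) (a s : ℕ → T) : Prop where
  mono : ∀ i, i + 1 < n → a i ≤ a (i + 1)
  nonneg : ∀ i, i < n → 0 ≤ a i
  pos : ∀ i, i < n → 0 < s i

/-- The invariants of the dynamics.  The field `load` says that the server is work-conserving. -/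
structure QState.Inv (n : ℕ) (a s : ℕ → T) (st : QState T) : Prop where
  arrived_le : st.arrived ≤ n
  present_lt : ∀ j ∈ st.present, j < st.arrived
  card : st.out.length + st.present.card = st.arrived
  pos : ∀ j ∈ st.present, 0 < st.residual j
  clock_le : st.arrived < n → st.clock ≤ a st.arrived
  clock_nonneg : 0 ≤ st.clock
  load : st.clock + ∑ j ∈ st.present, st.residual j = completion a s st.arrived
  out_le : ∀ t ∈ st.out, t ≤ st.clock
  out_sorted : st.out.Pairwise (· < ·)
  out_pos : ∀ t ∈ st.out, 0 < t
  last : st.present = ∅ → st.out.getLastD 0 = st.clock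

theorem QState.inv_init (n : ℕ) (a s : ℕ → T) (h : IsInput n a s) :
    (QState.init : QState T).Inv n a s where
  arrived_le := Nat.zero_le _
  present_lt := by simp [QState.init]
  card := by simp [QState.init]
  pos := by simp [QState.init]
  clock_le := fun h0 => h.nonneg _ h0
  clock_nonneg := le_rfl
  load := by simp [QState.init, completion]
  out_le := by simp [QState.init]
  out_sorted := by simp [QState.init]
  out_pos := by simp [QState.init]
  last := by simp [QState.init]

variable [IsOrderedCancelAddMonoid T] [OrderedSub T] [ExistsAddOfLE T]

theorem QState.Inv.step {n : ℕ} {a s : ℕ → T} (hin : IsInput n a s) (Q : Discipline T)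
    {st : QState T} (h : st.Inv n a s) : (Q.step n a s st).Inv n a s := by
  have hnot : st.arrived ∉ st.present := fun hm => lt_irrefl _ (h.present_lt _ hm)
  rcases Q.step_cases n a s st with ⟨he, hlt, hs⟩ | ⟨he, hlt, hs⟩ | ⟨hj, hlt, ht, hs⟩ |
    ⟨hj, hle, hs⟩
  · rw [hs]
    have hc := h.clock_le hlt
    have hl := h.load
    rw [he] at hl
    simp only [Finset.sum_empty, add_zero] at hl
    refine ⟨hlt, ?_, ?_, ?_, ?_, h.clock_nonneg.trans hc, ?_, ?_, h.out_sorted, h.out_pos, ?_⟩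
    · simp [QState.arrive, he]
    · have := h.card
      simp only [QState.arrive, he] at this ⊢
      simpa using this
    · simp [QState.arrive, he, hin.pos _ hlt]
    · exact fun h1 => hin.mono _ h1
    · simp only [QState.arrive, he, completion]
      simp [← hl, max_eq_right hc]
    · exact fun t ht => (h.out_le t ht).trans hc
    · simp [QState.arrive]
  · rw [hs]; exact h
  · rw [hs]
    set j := Q.served st with hjdef
    have hc := h.clock_le hlt
    have hja : j ≠ st.arrived := fun e => hnot (e ▸ hj)
    have hlt' : a st.arrived - st.clock < st.residual j := by
      rw [← add_lt_add_iff_left st.clock, add_tsub_cancel_of_le hc]; exact ht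
    have hsum : a st.arrived + (st.residual j - (a st.arrived - st.clock)) =
        st.clock + st.residual j := by
      conv_lhs => rw [← add_tsub_cancel_of_le hc, add_assoc, add_tsub_cancel_left]
      rw [add_tsub_cancel_of_le hlt'.le]
    refine ⟨hlt, ?_, ?_, ?_, ?_, h.clock_nonneg.trans hc, ?_, ?_, h.out_sorted, h.out_pos, ?_⟩
    · intro i hi
      simp only [QState.arrive, Finset.mem_insert] at hi ⊢
      rcases hi with rfl | hi
      · exact Nat.lt_succ_self _
      · exact (h.present_lt i hi).trans (Nat.lt_succ_self _)
    · have := h.card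
      simp only [QState.arrive]
      rw [Finset.card_insert_of_notMem hnot]; omega
    · intro i hi
      simp only [QState.arrive, Finset.mem_insert] at hi ⊢
      by_cases hia : i = st.arrived
      · subst hia; simp [hin.pos _ hlt]
      · rw [Function.update_of_ne hia]
        by_cases hij : i = j
        · subst hij
          rw [Function.update_self, ← add_lt_add_iff_left (a st.arrived - st.clock), add_zero,
            add_tsub_cancel_of_le hlt'.le]
          exact hlt'
        · rw [Function.update_of_ne hij]
          exact h.pos i (hi.resolve_left hia)
    · exact fun h1 => hin.mono _ h1
    · simp only [QState.arrive, completion]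
      rw [← h.load, Finset.sum_insert hnot, Function.update_self, max_eq_left]
      · rw [← Finset.add_sum_erase _ _ hj, ← Finset.add_sum_erase _ st.residual hj,
          Function.update_of_ne hja, Function.update_self]
        have : ∑ x ∈ st.present.erase j, Function.update (Function.update st.residual j
            (st.residual j - (a st.arrived - st.clock))) st.arrived (s st.arrived) x =
            ∑ x ∈ st.present.erase j, st.residual x := by
          refine Finset.sum_congr rfl fun x hx => ?_
          rw [Finset.mem_erase] at hx
          rw [Function.update_of_ne (fun e : x = st.arrived => hnot (by rw [← e]; exact hx.2)),
            Function.update_of_ne hx.1]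
        have key : ∀ A B C X Y : T, A + B = C → A + (Y + (B + X)) = C + X + Y := by
          rintro A B C X Y rfl
          abel
        rw [this, ← add_assoc st.clock]
        exact key _ _ _ _ _ hsum
      · refine ht.le.trans ?_
        gcongr
        exact Finset.single_le_sum (f := st.residual) (fun i hi => (h.pos i hi).le) hj
    · exact fun t ht => (h.out_le t ht).trans hc
    · simp [QState.arrive]
  · rw [hs]
    set j := Q.served st with hjdef
    have hpos := h.pos j hj
    have hclk : st.clock < st.clock + st.residual j := lt_add_of_pos_right _ hpos
    refine ⟨h.arrived_le, ?_, ?_, ?_, hle, h.clock_nonneg.trans hclk.le, ?_, ?_, ?_, ?_, ?_⟩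
    · exact fun i hi => h.present_lt i (Finset.mem_of_mem_erase hi)
    · have := h.card
      simp only [QState.depart, List.length_append, List.length_singleton]
      rw [Finset.card_erase_of_mem hj]
      have : 0 < st.present.card := Finset.card_pos.2 ⟨j, hj⟩
      omega
    · exact fun i hi => h.pos i (Finset.mem_of_mem_erase hi)
    · simp only [QState.depart]
      rw [← h.load, ← Finset.add_sum_erase _ st.residual hj, add_assoc]
    · intro t ht
      simp only [QState.depart, List.mem_append, List.mem_singleton] at ht ⊢
      rcases ht with ht | rfl
      · exact (h.out_le t ht).trans hclk.le
      · exact le_rfl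
    · simp only [QState.depart, List.pairwise_append, List.mem_singleton, List.pairwise_singleton,
        true_and]
      refine ⟨h.out_sorted, fun t ht u hu => ?_⟩
      rw [hu]; exact (h.out_le t ht).trans_lt hclk
    · intro t ht
      simp only [QState.depart, List.mem_append, List.mem_singleton] at ht ⊢
      rcases ht with ht | rfl
      · exact h.out_pos t ht
      · exact h.clock_nonneg.trans_lt hclk
    · intro _
      simp [QState.depart]

theorem Discipline.inv_run {n : ℕ} {a s : ℕ → T} (hin : IsInput n a s) (Q : Discipline T)
    (m : ℕ) : (Q.run n a s m).Inv n a s := by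
  induction m with
  | zero => exact QState.inv_init n a s hin
  | succ m ih => rw [Q.run_succ]; exact ih.step hin Q

/-- Departures that are still to come take place strictly after the last event. -/
theorem Discipline.exists_out_iterate {n : ℕ} {a s : ℕ → T} (hin : IsInput n a s)
    (Q : Discipline T) (k : ℕ) :
    ∀ st : QState T, st.Inv n a s →
      ∃ l : List T, ((Q.step n a s)^[k] st).out = st.out ++ l ∧ ∀ x ∈ l, st.clock < x := by
  induction k with
  | zero => exact fun st _ => ⟨[], by simp⟩
  | succ k ih =>
    intro st h
    obtain ⟨l, hl, hx⟩ := ih (Q.step n a s st) (h.step hin Q)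
    rw [Function.iterate_succ_apply, hl]
    rcases Q.step_cases n a s st with ⟨he, hlt, hs⟩ | ⟨he, hlt, hs⟩ | ⟨hj, hlt, ht, hs⟩ |
      ⟨hj, hle, hs⟩
    · rw [hs] at hx ⊢
      exact ⟨l, rfl, fun x hxl => (h.clock_le hlt).trans_lt (hx x hxl)⟩
    · rw [hs] at hx ⊢
      exact ⟨l, rfl, hx⟩
    · rw [hs] at hx ⊢
      exact ⟨l, rfl, fun x hxl => (h.clock_le hlt).trans_lt (hx x hxl)⟩
    · rw [hs] at hx ⊢
      have hclk : st.clock < st.clock + st.residual (Q.served st) :=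
        lt_add_of_pos_right _ (h.pos _ hj)
      refine ⟨(st.clock + st.residual (Q.served st)) :: l, by simp [QState.depart], ?_⟩
      intro x hxl
      rcases List.mem_cons.1 hxl with rfl | hxl
      · exact hclk
      · exact hclk.trans (hx x hxl)

theorem Discipline.run_add (Q : Discipline T) (n : ℕ) (a s : ℕ → T) (k m : ℕ) :
    Q.run n a s (k + m) = (Q.step n a s)^[k] (Q.run n a s m) :=
  Function.iterate_add_apply _ _ _ _

/-- Later states only append departures, and these take place strictly after the last event. -/
theorem Discipline.exists_out_run {n : ℕ} {a s : ℕ → T} (hin : IsInput n a s)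
    (Q : Discipline T) {m m' : ℕ} (hm : m ≤ m') :
    ∃ l : List T, (Q.run n a s m').out = (Q.run n a s m).out ++ l ∧
      ∀ x ∈ l, (Q.run n a s m).clock < x := by
  obtain ⟨k, rfl⟩ := Nat.exists_eq_add_of_le' hm
  rw [Q.run_add]
  exact Q.exists_out_iterate hin k _ (Q.inv_run hin m)

/-- Each of the first `2 n` events is an arrival or a departure. -/
theorem Discipline.count_run {n : ℕ} {a s : ℕ → T} (hin : IsInput n a s) (Q : Discipline T)
    {m : ℕ} (hm : m ≤ 2 * n) :
    (Q.run n a s m).arrived + (Q.run n a s m).out.length = m := by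
  induction m with
  | zero => rfl
  | succ m ih =>
    have ih := ih (by omega)
    have h := Q.inv_run hin m
    rw [Q.run_succ]
    rcases Q.step_cases n a s (Q.run n a s m) with ⟨he, hlt, hs⟩ | ⟨he, hlt, hs⟩ |
      ⟨hj, hlt, ht, hs⟩ | ⟨hj, hle, hs⟩
    · rw [hs]; simp only [QState.arrive]; omega
    · have h1 := h.card
      have h2 := h.arrived_le
      rw [he] at h1
      simp only [Finset.card_empty] at h1
      omega
    · rw [hs]; simp only [QState.arrive]; omega
    · rw [hs]; simp only [QState.depart, List.length_append, List.length_singleton]; omega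

/-- After `2 n` events all packets have arrived and left. -/
theorem Discipline.run_end {n : ℕ} {a s : ℕ → T} (hin : IsInput n a s) (Q : Discipline T) :
    (Q.run n a s (2 * n)).arrived = n ∧ (Q.run n a s (2 * n)).out.length = n ∧
      (Q.run n a s (2 * n)).present = ∅ := by
  have h := Q.inv_run hin (2 * n)
  have h1 := Q.count_run hin le_rfl
  have h2 := h.card
  have h3 := h.arrived_le
  refine ⟨by omega, by omega, ?_⟩
  rw [← Finset.card_eq_zero]; omega

end Dynamics

/-! ### Departure times -/

section Departures

variable {T : Type} [LinearOrder T] [AddCommMonoid T] [Sub T] [MeasurableSpace T]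

theorem extendZero_apply {n : ℕ} (x : Fin n → T) {i : ℕ} (h : i < n) :
    extendZero x i = x ⟨i, h⟩ := by simp [extendZero, h]

@[simp] theorem extendZero_fin {n : ℕ} (x : Fin n → T) (i : Fin n) : extendZero x i = x i := by
  simp [extendZero]

theorem isInput_extendZero {n : ℕ} {a s : Fin n → T} (ha : Monotone a) (h0 : ∀ i, 0 ≤ a i)
    (hs : ∀ i, 0 < s i) : IsInput n (extendZero a) (extendZero s) where
  mono i hi := by
    rw [extendZero_apply a hi, extendZero_apply a (by omega)]
    exact ha (by simp)
  nonneg i hi := by rw [extendZero_apply a hi]; exact h0 _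
  pos i hi := by rw [extendZero_apply s hi]; exact hs _

/-- The departure times as a sequence. -/
theorem Discipline.extendZero_departures (Q : Discipline T) {n : ℕ} (a s : Fin n → T) {k : ℕ}
    (hk : k < n) : extendZero (Q.departures a s) k =
      (Q.run n (extendZero a) (extendZero s) (2 * n)).out.getD k 0 := by
  rw [extendZero_apply _ hk]; rfl

variable [IsOrderedCancelAddMonoid T] [OrderedSub T] [ExistsAddOfLE T]

theorem Discipline.departures_mem (Q : Discipline T) {n : ℕ} {a s : Fin n → T}
    (hin : IsInput n (extendZero a) (extendZero s)) (k : Fin n) :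
    Q.departures a s k ∈ (Q.run n (extendZero a) (extendZero s) (2 * n)).out := by
  have hl := (Q.run_end hin).2.1
  have : Q.departures a s k = (Q.run n (extendZero a) (extendZero s) (2 * n)).out.getD k 0 := rfl
  rw [this, List.getD_eq_getElem _ _ (by omega)]
  exact List.getElem_mem _

theorem Discipline.departures_strictMono (Q : Discipline T) {n : ℕ} {a s : Fin n → T}
    (hin : IsInput n (extendZero a) (extendZero s)) : StrictMono (Q.departures a s) := by
  have hl := (Q.run_end hin).2.1
  have hsort := (Q.inv_run hin (2 * n)).out_sorted
  intro k l hkl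
  have hd : ∀ k, Q.departures a s k =
    (Q.run n (extendZero a) (extendZero s) (2 * n)).out.getD k 0 := fun k => rfl
  rw [hd, hd, List.getD_eq_getElem _ _ (by omega), List.getD_eq_getElem _ _ (by omega)]
  exact List.pairwise_iff_getElem.1 hsort _ _ _ _ hkl

theorem Discipline.departures_pos (Q : Discipline T) {n : ℕ} {a s : Fin n → T}
    (hin : IsInput n (extendZero a) (extendZero s)) (k : Fin n) : 0 < Q.departures a s k :=
  (Q.inv_run hin (2 * n)).out_pos _ (Q.departures_mem hin k)

/-- The last departure time does not depend on the discipline. -/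
theorem Discipline.lastTime_departures (Q : Discipline T) {n : ℕ} {a s : Fin n → T}
    (hin : IsInput n (extendZero a) (extendZero s)) :
    lastTime (Q.departures a s) = completion (extendZero a) (extendZero s) n := by
  obtain ⟨h1, h2, h3⟩ := Q.run_end hin
  have h := Q.inv_run hin (2 * n)
  have hload := h.load
  rw [h3, h1] at hload
  simp only [Finset.sum_empty, add_zero] at hload
  rw [← hload, ← h.last h3]
  rcases Nat.eq_zero_or_pos n with h0 | hn
  · subst h0
    simp [lastTime, Discipline.run, QState.init]
  · rw [lastTime, dif_pos hn]
    change (Q.run n (extendZero a) (extendZero s) (2 * n)).out.getD (n - 1) 0 = _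
    have hne : (Q.run n (extendZero a) (extendZero s) (2 * n)).out ≠ [] := by
      intro e; rw [e] at h2; simp at h2; omega
    rw [List.getD_eq_getElem _ _ (by omega), List.getLastD_eq_getLast?,
      List.getLast?_eq_some_getLast hne, Option.getD_some, List.getLast_eq_getElem]
    simp [h2]

theorem arrivalTimes_eq_pred_add {n : ℕ} (y : Fin n → T) (i : Fin n) (hi : 0 < (i : ℕ)) :
    arrivalTimes y i = arrivalTimes y ⟨i - 1, by omega⟩ + y i := by
  have : Finset.Iic i = insert i (Finset.Iic (⟨i - 1, by omega⟩ : Fin n)) := by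
    ext j
    simp only [Finset.mem_Iic, Finset.mem_insert, Fin.le_def, Fin.ext_iff]
    omega
  rw [arrivalTimes, this, Finset.sum_insert, add_comm]
  · rfl
  · simp only [Finset.mem_Iic, Fin.le_def]; omega

theorem arrivalTimes_zero_index {n : ℕ} (y : Fin n → T) (i : Fin n) (hi : (i : ℕ) = 0) :
    arrivalTimes y i = y i := by
  have : Finset.Iic i = {i} := by
    ext j
    simp only [Finset.mem_Iic, Finset.mem_singleton, Fin.le_def, Fin.ext_iff]
    omega
  rw [arrivalTimes, this, Finset.sum_singleton]

theorem arrivalTimes_interdepartures {n : ℕ} {d : Fin n → T} (hd : Monotone d) :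
    arrivalTimes (interdepartures d) = d := by
  suffices h : ∀ k (hk : k < n), arrivalTimes (interdepartures d) ⟨k, hk⟩ = d ⟨k, hk⟩ from
    funext fun i => h i i.2
  intro k
  induction k with
  | zero =>
    intro hk
    rw [arrivalTimes_zero_index _ _ rfl]
    simp [interdepartures]
  | succ k ih =>
    intro hk
    rw [arrivalTimes_eq_pred_add _ _ (by simp)]
    simp only [Nat.add_sub_cancel]
    rw [ih (by omega), interdepartures]
    simp only [Nat.zero_lt_succ, if_true, Nat.add_sub_cancel]
    exact add_tsub_cancel_of_le (hd (by simp))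

theorem lastTime_eq_sum_interdepartures {n : ℕ} {d : Fin n → T} (hd : Monotone d) :
    lastTime d = ∑ i, interdepartures d i := by
  rw [lastTime]
  split_ifs with h
  · conv_lhs => rw [← arrivalTimes_interdepartures hd]
    rw [arrivalTimes]
    congr 1
    ext j
    simp only [Finset.mem_Iic, Finset.mem_univ, iff_true, Fin.le_def]
    omega
  · have : n = 0 := by omega
    subst this
    simp

theorem monotone_arrivalTimes {n : ℕ} {y : Fin n → T} (hy : ∀ i, 0 ≤ y i) :
    Monotone (arrivalTimes y) := by
  intro i j hij
  exact Finset.sum_le_sum_of_subset_of_nonneg (Finset.Iic_subset_Iic.2 hij) fun k _ _ => hy k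

theorem arrivalTimes_nonneg {n : ℕ} {y : Fin n → T} (hy : ∀ i, 0 ≤ y i) (i : Fin n) :
    0 ≤ arrivalTimes y i := Finset.sum_nonneg fun k _ => hy k

theorem Discipline.interdepartures_pos (Q : Discipline T) {n : ℕ} {a s : Fin n → T}
    (hin : IsInput n (extendZero a) (extendZero s)) (k : Fin n) :
    0 < interdepartures (Q.departures a s) k := by
  rw [interdepartures]
  split_ifs with h
  · have hlt : Q.departures a s ⟨k - 1, by omega⟩ < Q.departures a s k :=
      Q.departures_strictMono hin (by simp only [Fin.lt_def]; omega)
    have h2 := add_tsub_cancel_of_le hlt.le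
    by_contra hc
    have h3 : Q.departures a s ⟨k - 1, by omega⟩ +
      (Q.departures a s k - Q.departures a s ⟨k - 1, by omega⟩) ≤
        Q.departures a s ⟨k - 1, by omega⟩ + 0 := by gcongr; exact not_lt.1 hc
    rw [h2, add_zero] at h3
    exact absurd hlt (not_lt.2 h3)
  · have h2 := add_tsub_cancel_of_le (Q.departures_pos hin k).le
    rw [zero_add] at h2
    rw [h2]
    exact Q.departures_pos hin k

/-! ### First in, first out -/

/-- Under FIFO the packets present are the last ones to have arrived, and only the first of them
has received any service. -/
structure QState.FifoInv (a s : ℕ → T) (st : QState T) : Prop where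
  present_eq : st.present = Finset.Ico st.out.length st.arrived
  out_eq : st.out = (List.range st.out.length).map fun i => completion a s (i + 1)
  head : st.out.length < st.arrived →
    st.clock + st.residual st.out.length = completion a s (st.out.length + 1)
  tail : ∀ j, st.out.length < j → j < st.arrived → st.residual j = s j
  arrival_le : ∀ j, j < st.arrived → a j ≤ st.clock

theorem fifo_inv_step {n : ℕ} {a s : ℕ → T} {st : QState T}
    (h : st.Inv n a s) (hf : st.FifoInv a s) :
    ((fifo T).step n a s st).FifoInv a s := by
  have hcard := h.card
  have hserv : st.present.Nonempty →
      (fifo T).served st = st.out.length ∧ st.out.length < st.arrived := by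
    intro hne
    have h2 : st.out.length < st.arrived := by
      have := Finset.card_pos.2 hne; omega
    refine ⟨?_, h2⟩
    simp only [Discipline.served, fifo, hne, dite_true]
    apply le_antisymm
    · apply Finset.min'_le
      rw [hf.present_eq]; simp [h2]
    · apply Finset.le_min'
      rw [hf.present_eq]; simp; omega
  rcases (fifo T).step_cases n a s st with ⟨he, hlt, hs⟩ | ⟨he, hlt, hs⟩ | ⟨hj, hlt, ht, hs⟩ |
    ⟨hj, hle, hs⟩
  · rw [hs]
    rw [he, Finset.card_empty, add_zero] at hcard
    have hl := h.load
    rw [he] at hl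
    simp only [Finset.sum_empty, add_zero] at hl
    refine ⟨?_, hf.out_eq, ?_, ?_, ?_⟩
    · simp [QState.arrive, he, hcard]
    · intro _
      simp only [QState.arrive, hcard, Function.update_self, completion]
      rw [← hl, max_eq_right (h.clock_le hlt)]
    · intro j h1 h2
      simp only [QState.arrive] at h1 h2; omega
    · intro j hj
      simp only [QState.arrive] at hj ⊢
      rcases Nat.lt_succ_iff_lt_or_eq.1 hj with hj | rfl
      · exact (hf.arrival_le j hj).trans (h.clock_le hlt)
      · exact le_rfl
  · rw [hs]; exact hf
  · obtain ⟨hsv, hol⟩ := hserv ⟨_, hj⟩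
    rw [hs, hsv]
    rw [hsv] at ht
    have hc := h.clock_le hlt
    have hlt' : a st.arrived - st.clock < st.residual st.out.length := by
      rw [← add_lt_add_iff_left st.clock, add_tsub_cancel_of_le hc]; exact ht
    refine ⟨?_, hf.out_eq, ?_, ?_, ?_⟩
    · simp only [QState.arrive, hf.present_eq]
      rw [← Finset.insert_Ico_right_eq_Ico_add_one hol.le]
    · intro _
      simp only [QState.arrive]
      rw [← hf.head hol, Function.update_of_ne hol.ne, Function.update_self]
      conv_lhs => rw [← add_tsub_cancel_of_le hc, add_assoc, add_tsub_cancel_left]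
      rw [add_tsub_cancel_of_le hlt'.le]
    · intro j h1 h2
      simp only [QState.arrive] at h1 h2 ⊢
      rcases Nat.lt_succ_iff_lt_or_eq.1 h2 with h2 | rfl
      · rw [Function.update_of_ne h2.ne, Function.update_of_ne h1.ne', hf.tail j h1 h2]
      · rw [Function.update_self]
    · intro j hj
      simp only [QState.arrive] at hj ⊢
      rcases Nat.lt_succ_iff_lt_or_eq.1 hj with hj | rfl
      · exact (hf.arrival_le j hj).trans hc
      · exact le_rfl
  · obtain ⟨hsv, hol⟩ := hserv ⟨_, hj⟩
    rw [hsv] at hj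
    rw [hs, hsv, hf.head hol]
    have hclk : st.clock ≤ completion a s (st.out.length + 1) := by
      rw [← hf.head hol]
      exact le_add_of_nonneg_right (h.pos _ hj).le
    refine ⟨?_, ?_, ?_, ?_, ?_⟩
    · ext j
      simp only [QState.depart, hf.present_eq, Finset.mem_erase, Finset.mem_Ico,
        List.length_append, List.length_singleton]
      omega
    · simp only [QState.depart, List.length_append, List.length_singleton, List.range_succ,
        List.map_append, List.map_singleton]
      rw [← hf.out_eq]
    · intro h1
      simp only [QState.depart, List.length_append, List.length_singleton] at h1 ⊢
      rw [hf.tail _ (Nat.lt_succ_self _) h1]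
      change _ = max (completion a s (st.out.length + 1)) (a (st.out.length + 1)) + _
      rw [max_eq_left ((hf.arrival_le _ h1).trans hclk)]
    · intro j h1 h2
      simp only [QState.depart, List.length_append, List.length_singleton] at h1 h2 ⊢
      exact hf.tail j (by omega) h2
    · intro j hj
      exact (hf.arrival_le j hj).trans hclk

/-- Under FIFO the departure times satisfy Lindley's recursion. -/
theorem fifo_departures {n : ℕ} {a s : Fin n → T}
    (hin : IsInput n (extendZero a) (extendZero s)) (k : Fin n) :
    (fifo T).departures a s k = completion (extendZero a) (extendZero s) (k + 1) := by
  have hf : ∀ m, ((fifo T).run n (extendZero a) (extendZero s) m).FifoInv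
      (extendZero a) (extendZero s) := by
    intro m
    induction m with
    | zero =>
      refine ⟨?_, ?_, ?_, ?_, ?_⟩ <;> simp [Discipline.run, QState.init]
    | succ m ih =>
      rw [Discipline.run_succ]
      exact fifo_inv_step ((fifo T).inv_run hin m) ih
  have hl := ((fifo T).run_end hin).2.1
  change ((fifo T).run n (extendZero a) (extendZero s) (2 * n)).out.getD k 0 = _
  rw [(hf (2 * n)).out_eq, hl, List.getD_eq_getElem _ _ (by simp)]
  simp

end Departures

/-! ### Recovering the service times from arrivals and departures -/

section Observer

variable {T : Type} [LinearOrder T] [AddCommMonoid T] [Sub T] [MeasurableSpace T]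

/-- One step of an observer who sees the arrival times `a` and the departure times `d`, but not the
service times.  The field `residual` of the state now records the service that each packet has
received so far; the next event is an arrival if it comes strictly before the next departure. -/
def Discipline.obsStep (Q : Discipline T) (n : ℕ) (a d : ℕ → T) (st : QState T) : QState T :=
  if st.present.Nonempty then
    if st.arrived < n ∧ a st.arrived < d st.out.length then
      st.arrive (a st.arrived) 0 (Function.update st.residual (Q.served st)
        (st.residual (Q.served st) + (a st.arrived - st.clock)))
    else
      { st with
        residual := Function.update st.residual (Q.served st)
          (st.residual (Q.served st) + (d st.out.length - st.clock)) }.depart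
        (d st.out.length) (Q.served st)
  else if st.arrived < n then st.arrive (a st.arrived) 0 st.residual
  else st

/-- The state of the observer after `m` events. -/
def Discipline.obs (Q : Discipline T) (n : ℕ) (a d : ℕ → T) (m : ℕ) : QState T :=
  (Q.obsStep n a d)^[m] QState.init

theorem Discipline.obs_succ (Q : Discipline T) (n : ℕ) (a d : ℕ → T) (m : ℕ) :
    Q.obs n a d (m + 1) = Q.obsStep n a d (Q.obs n a d m) :=
  Function.iterate_succ_apply' _ _ _

/-- The service times computed by the observer. -/
def Discipline.recover (Q : Discipline T) {n : ℕ} (a d : Fin n → T) : Fin n → T :=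
  fun j => (Q.obs n (extendZero a) (extendZero d) (2 * n)).residual j

/-- Two observers take the same step if their inputs agree as far as they matter for it. -/
theorem Discipline.obsStep_congr (Q : Discipline T) {n : ℕ} {a d a' d' : ℕ → T} {st : QState T}
    (hidle : st.present = ∅ → st.arrived < n → a st.arrived < d st.out.length)
    (hiff : st.arrived < n → (a st.arrived < d st.out.length ↔ a' st.arrived < d' st.out.length))
    (ha : st.arrived < n → a st.arrived < d st.out.length → a' st.arrived = a st.arrived)
    (hd : st.present.Nonempty → ¬ (st.arrived < n ∧ a st.arrived < d st.out.length) →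
      d' st.out.length = d st.out.length) :
    Q.obsStep n a' d' st = Q.obsStep n a d st := by
  unfold Discipline.obsStep
  by_cases hp : st.present.Nonempty
  · by_cases hc : st.arrived < n ∧ a st.arrived < d st.out.length
    · have hc' : st.arrived < n ∧ a' st.arrived < d' st.out.length := ⟨hc.1, (hiff hc.1).1 hc.2⟩
      simp only [hp, if_true]
      rw [if_pos hc', if_pos hc, ha hc.1 hc.2]
    · have hc' : ¬ (st.arrived < n ∧ a' st.arrived < d' st.out.length) :=
        fun h => hc ⟨h.1, (hiff h.1).2 h.2⟩
      simp only [hp, if_true]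
      rw [if_neg hc, if_neg hc', hd hp hc]
  · have he := Finset.not_nonempty_iff_eq_empty.1 hp
    by_cases hlt : st.arrived < n
    · simp only [hp, hlt, if_true, if_false, ha hlt (hidle he hlt)]
    · simp only [hp, hlt, if_false]

variable [IsOrderedCancelAddMonoid T] [OrderedSub T] [ExistsAddOfLE T]

/-- After a step that is not a departure, the next departure lies strictly in the future. -/
theorem Discipline.clock_lt_of_out_eq (Q : Discipline T) {n : ℕ} {a s d : ℕ → T}
    (hin : IsInput n a s) (hd : ∀ k < n, d k = (Q.run n a s (2 * n)).out.getD k 0) {m : ℕ}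
    (hm : m + 1 ≤ 2 * n) (hout : (Q.run n a s (m + 1)).out = (Q.run n a s m).out)
    (hlen : (Q.run n a s m).out.length < n) :
    (Q.run n a s (m + 1)).clock < d (Q.run n a s m).out.length := by
  obtain ⟨l, hl, hx⟩ := Q.exists_out_run hin hm
  have h2 := (Q.run_end hin).2.1
  rw [hd _ hlen, hl, hout]
  have hlen2 : 0 < l.length := by
    have := congrArg List.length hl
    rw [List.length_append, hout, h2] at this
    omega
  rw [List.getD_append_right _ _ _ _ le_rfl, Nat.sub_self, List.getD_eq_getElem _ _ hlen2]
  exact hx _ (List.getElem_mem _)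

/-- The observer's criterion for an arrival is met when the next event is one. -/
theorem Discipline.arrival_lt (Q : Discipline T) {n : ℕ} {a s d : ℕ → T}
    (hin : IsInput n a s) (hd : ∀ k < n, d k = (Q.run n a s (2 * n)).out.getD k 0) {m : ℕ}
    (hm : m < 2 * n) {x : T} {r : ℕ → T}
    (hs : Q.run n a s (m + 1) =
      (Q.run n a s m).arrive (a (Q.run n a s m).arrived) x r)
    (hlt : (Q.run n a s m).arrived < n) :
    a (Q.run n a s m).arrived < d (Q.run n a s m).out.length := by
  have h := (Q.inv_run hin m).card
  have := Q.clock_lt_of_out_eq hin hd (m := m) hm (by rw [hs]; rfl) (by omega)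
  rwa [hs] at this

/-- When the next event is a departure, it takes place at the next departure time. -/
theorem Discipline.departure_eq (Q : Discipline T) {n : ℕ} {a s d : ℕ → T}
    (hin : IsInput n a s) (hd : ∀ k < n, d k = (Q.run n a s (2 * n)).out.getD k 0) {m : ℕ}
    (hm : m < 2 * n) {t : T} {j : ℕ} (hj : j ∈ (Q.run n a s m).present)
    (hs : Q.run n a s (m + 1) = (Q.run n a s m).depart t j) :
    d (Q.run n a s m).out.length = t := by
  obtain ⟨l, hl, hx⟩ := Q.exists_out_run hin (Nat.succ_le_of_lt hm)
  have h := Q.inv_run hin m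
  have h1 := h.card
  have h2 := h.arrived_le
  have h3 : 0 < (Q.run n a s m).present.card := Finset.card_pos.2 ⟨j, hj⟩
  rw [hd _ (by omega), hl, Nat.succ_eq_add_one, hs]
  simp [QState.depart]

/-- The observer follows the queue: received and residual service add up to the service times. -/
theorem Discipline.obs_eq (Q : Discipline T) {n : ℕ} {a s d : ℕ → T}
    (hin : IsInput n a s) (hd : ∀ k < n, d k = (Q.run n a s (2 * n)).out.getD k 0) {m : ℕ}
    (hm : m ≤ 2 * n) :
    ∃ v : ℕ → T, Q.obs n a d m = { Q.run n a s m with residual := v } ∧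
      (∀ j ∈ (Q.run n a s m).present, v j + (Q.run n a s m).residual j = s j) ∧
      ∀ j < (Q.run n a s m).arrived, j ∉ (Q.run n a s m).present → v j = s j := by
  induction m with
  | zero => exact ⟨fun _ => 0, rfl, by simp [Discipline.run, QState.init],
      by simp [Discipline.run, QState.init]⟩
  | succ m ih =>
    obtain ⟨v, hv, hv1, hv2⟩ := ih (by omega)
    have hinv := Q.inv_run hin m
    have hnot : (Q.run n a s m).arrived ∉ (Q.run n a s m).present :=
      fun hm => lt_irrefl _ (hinv.present_lt _ hm)
    have hsucc := Q.run_succ n a s m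
    have hcount := Q.count_run hin (m := m) (by omega)
    have hlt := fun x r => Q.arrival_lt hin hd (m := m) (by omega) (x := x) (r := r)
    have heq := fun t j hj => Q.departure_eq hin hd (m := m) (by omega) (t := t) (j := j) hj
    rw [Q.obs_succ, hv]
    generalize Q.run n a s (m + 1) = st' at *
    generalize Q.run n a s m = st at *
    have hserv : Q.served { st with residual := v } = Q.served st := rfl
    rcases Q.step_cases n a s st with ⟨he, ha, hs⟩ | ⟨he, ha, hs⟩ |
      ⟨hj, ha, ht, hs⟩ | ⟨hj, hle, hs⟩
    · rw [hs] at hsucc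
      subst hsucc
      refine ⟨Function.update v st.arrived 0, ?_, ?_, ?_⟩
      · simp [Discipline.obsStep, he, ha, QState.arrive]
      · intro j hj
        simp only [QState.arrive, he, insert_empty_eq, Finset.mem_singleton] at hj
        subst hj
        simp [QState.arrive]
      · intro j hj hj2
        simp only [QState.arrive, he, insert_empty_eq, Finset.mem_singleton] at hj hj2
        rw [Function.update_of_ne hj2]
        exact hv2 j (by omega) (by simp [he])
    · have h1 := hinv.card
      have h2 := hinv.arrived_le
      rw [he, Finset.card_empty] at h1
      omega
    · rw [hs] at hsucc
      have hlt' := hlt _ _ hsucc ha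
      subst hsucc
      have hja : Q.served st ≠ st.arrived := fun e => hnot (by rw [← e]; exact hj)
      have hc := hinv.clock_le ha
      have hle : a st.arrived - st.clock ≤ st.residual (Q.served st) := by
        rw [← add_le_add_iff_left st.clock, add_tsub_cancel_of_le hc]; exact ht.le
      refine ⟨Function.update (Function.update v (Q.served st)
        (v (Q.served st) + (a st.arrived - st.clock))) st.arrived 0, ?_, ?_, ?_⟩
      · have hne : st.present.Nonempty := ⟨_, hj⟩
        simp only [Discipline.obsStep, hne, ha, hlt', hserv]
        rfl
      · intro j hj'
        simp only [QState.arrive, Finset.mem_insert] at hj' ⊢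
        by_cases h1 : j = st.arrived
        · subst h1; simp
        · rw [Function.update_of_ne h1, Function.update_of_ne h1]
          by_cases h2 : j = Q.served st
          · subst h2
            rw [Function.update_self, Function.update_self, add_assoc, add_tsub_cancel_of_le hle]
            exact hv1 _ hj
          · rw [Function.update_of_ne h2, Function.update_of_ne h2]
            exact hv1 _ (hj'.resolve_left h1)
      · intro j hj1 hj2
        simp only [QState.arrive, Finset.mem_insert, not_or] at hj1 hj2
        rw [Function.update_of_ne hj2.1, Function.update_of_ne (fun e => hj2.2 (by rw [e]; exact hj))]
        exact hv2 j (by omega) hj2.2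
    · rw [hs] at hsucc
      have hdep := heq _ _ hj hsucc
      subst hsucc
      have hne : st.present.Nonempty := ⟨_, hj⟩
      have hcond : ¬ (st.arrived < n ∧ a st.arrived < d st.out.length) := by
        rw [hdep]
        exact fun h => absurd h.2 (not_lt.2 (hle h.1))
      refine ⟨Function.update v (Q.served st)
        (v (Q.served st) + (d st.out.length - st.clock)), ?_, ?_, ?_⟩
      · simp only [Discipline.obsStep, hne, if_true, hserv]
        rw [if_neg hcond, hdep]
        rfl
      · intro j hj'
        simp only [QState.depart, Finset.mem_erase] at hj' ⊢
        rw [Function.update_of_ne hj'.1]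
        exact hv1 j hj'.2
      · intro j hj1 hj2
        simp only [QState.depart, Finset.mem_erase, not_and] at hj1 hj2
        by_cases h2 : j = Q.served st
        · subst h2
          rw [Function.update_self, hdep, add_tsub_cancel_left]
          exact hv1 _ hj
        · rw [Function.update_of_ne h2]
          exact hv2 j hj1 (hj2 h2)

/-- The service times are a function of the arrival times and the departure times. -/
theorem Discipline.recover_departures (Q : Discipline T) {n : ℕ} {a s : Fin n → T}
    (hin : IsInput n (extendZero a) (extendZero s)) :
    Q.recover a (Q.departures a s) = s := by
  obtain ⟨v, hv, -, hv2⟩ := Q.obs_eq hin (fun k hk => Q.extendZero_departures a s hk) le_rfl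
  obtain ⟨h1, h2, h3⟩ := Q.run_end hin
  ext j
  rw [Discipline.recover, hv]
  have := hv2 j (by rw [h1]; exact j.2) (by rw [h3]; simp)
  simpa using this

end Observer

/-! ### Measurability -/

/-- A function that is measurable on each piece of a countable measurable partition. -/
theorem measurable_of_countable_pieces {Ω D β : Type*} [MeasurableSpace Ω] [MeasurableSpace β]
    [Countable D] {g : Ω → D} (hg : ∀ d, MeasurableSet {ω | g ω = d}) {F : Ω → β} (G : D → Ω → β)
    (hG : ∀ d, Measurable (G d)) (h : ∀ ω, F ω = G (g ω) ω) : Measurable F := by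
  intro B hB
  have : F ⁻¹' B = ⋃ d, {ω | g ω = d} ∩ G d ⁻¹' B := by
    ext ω
    simp [h ω]
  rw [this]
  exact MeasurableSet.iUnion fun d => (hg d).inter (hG d hB)

instance : Countable Event := by
  have : Function.Injective (fun e : Event => match e with
    | .arrival => none
    | .departure i => some i) := by
    intro a b h
    cases a <;> cases b <;> simp_all
  exact this.countable

section

variable {T : Type} [LinearOrder T] [AddCommMonoid T] [Sub T] [MeasurableSpace T]

/-- The time of the `k`-th most recent event. -/
def QState.time (st : QState T) (k : ℕ) : T :=
  if h : k < st.hist.length then st.times ⟨k, h⟩ else 0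

/-- A random state is measurable if all its discrete and all its real data are. -/
structure MeasurableState {Ω : Type} [MeasurableSpace Ω] (st : Ω → QState T) : Prop where
  hist : ∀ h, MeasurableSet {ω | (st ω).hist = h}
  arrived : ∀ k, MeasurableSet {ω | (st ω).arrived = k}
  present : ∀ P, MeasurableSet {ω | (st ω).present = P}
  length : ∀ k, MeasurableSet {ω | (st ω).out.length = k}
  time : ∀ k, Measurable fun ω => (st ω).time k
  clock : Measurable fun ω => (st ω).clock
  residual : ∀ j, Measurable fun ω => (st ω).residual j
  out : ∀ k, Measurable fun ω => (st ω).out.getD k 0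

variable {Ω : Type} [MeasurableSpace Ω]

theorem measurableState_const (st : QState T) : MeasurableState fun _ : Ω => st where
  hist _ := MeasurableSet.const _
  arrived _ := MeasurableSet.const _
  present _ := MeasurableSet.const _
  length _ := MeasurableSet.const _
  time _ := measurable_const
  clock := measurable_const
  residual _ := measurable_const
  out _ := measurable_const

theorem measurableSet_ite_eq {β : Type*} {p : Ω → Prop} [DecidablePred p]
    (hp : MeasurableSet {ω | p ω}) {f g : Ω → β} {b : β} (hf : MeasurableSet {ω | f ω = b})
    (hg : MeasurableSet {ω | g ω = b}) : MeasurableSet {ω | (if p ω then f ω else g ω) = b} := by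
  have : {ω | (if p ω then f ω else g ω) = b} =
      ({ω | p ω} ∩ {ω | f ω = b}) ∪ ({ω | p ω}ᶜ ∩ {ω | g ω = b}) := by
    ext ω
    by_cases h : p ω <;> simp [h]
  rw [this]
  exact (hp.inter hf).union (hp.compl.inter hg)

theorem MeasurableState.ite {p : Ω → Prop} [DecidablePred p] (hp : MeasurableSet {ω | p ω})
    {st st' : Ω → QState T} (h : MeasurableState st) (h' : MeasurableState st') :
    MeasurableState fun ω => if p ω then st ω else st' ω where
  hist b := by simpa only [apply_ite QState.hist] using measurableSet_ite_eq hp (h.hist b) (h'.hist b)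
  arrived b := by
    simpa only [apply_ite QState.arrived] using measurableSet_ite_eq hp (h.arrived b) (h'.arrived b)
  present b := by
    simpa only [apply_ite QState.present] using measurableSet_ite_eq hp (h.present b) (h'.present b)
  length b := by
    simpa only [apply_ite (fun st : QState T => st.out.length)] using
      measurableSet_ite_eq hp (h.length b) (h'.length b)
  time k := by
    simpa only [apply_ite (fun st : QState T => st.time k)] using
      Measurable.ite hp (h.time k) (h'.time k)
  clock := by
    simpa only [apply_ite (fun st : QState T => st.clock)] using Measurable.ite hp h.clock h'.clock
  residual j := by
    simpa only [apply_ite (fun st : QState T => st.residual j)] using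
      Measurable.ite hp (h.residual j) (h'.residual j)
  out k := by
    simpa only [apply_ite (fun st : QState T => st.out.getD k 0)] using
      Measurable.ite hp (h.out k) (h'.out k)

theorem measurable_at {D : Type*} [Countable D] {g : Ω → D}
    (hg : ∀ d, MeasurableSet {ω | g ω = d}) {f : Ω → D → T} (hf : ∀ d, Measurable fun ω => f ω d) :
    Measurable fun ω => f ω (g ω) :=
  measurable_of_countable_pieces hg (fun d ω => f ω d) hf fun _ => rfl

theorem measurableSet_comp {D E : Type*} [Countable D] {g : Ω → D}
    (hg : ∀ d, MeasurableSet {ω | g ω = d}) (F : D → E) (e : E) :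
    MeasurableSet {ω | F (g ω) = e} := by
  have : {ω | F (g ω) = e} = ⋃ d ∈ {d | F d = e}, {ω | g ω = d} := by
    ext ω; simp
  rw [this]
  exact MeasurableSet.biUnion (Set.to_countable _) fun d _ => hg d

theorem measurableSet_comp₂ {D D' E : Type*} [Countable D] [Countable D'] {g : Ω → D} {g' : Ω → D'}
    (hg : ∀ d, MeasurableSet {ω | g ω = d}) (hg' : ∀ d, MeasurableSet {ω | g' ω = d})
    (F : D → D' → E) (e : E) : MeasurableSet {ω | F (g ω) (g' ω) = e} := by
  refine measurableSet_comp (g := fun ω => (g ω, g' ω)) (fun d => ?_) (fun p => F p.1 p.2) e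
  have : {ω | (g ω, g' ω) = d} = {ω | g ω = d.1} ∩ {ω | g' ω = d.2} := by
    ext ω; simp [Prod.ext_iff]
  rw [this]
  exact (hg _).inter (hg' _)

theorem measurable_update {j : Ω → ℕ} (hj : ∀ d, MeasurableSet {ω | j ω = d}) {r : Ω → ℕ → T}
    (hr : ∀ d, Measurable fun ω => r ω d) {x : Ω → T} (hx : Measurable x) (i : ℕ) :
    Measurable fun ω => Function.update (r ω) (j ω) (x ω) i := by
  simp only [Function.update_apply]
  refine Measurable.ite ?_ hx (hr i)
  simpa only [eq_comm] using hj i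

theorem QState.time_cons (st : QState T) (t : T) (e : Event) (k : ℕ) (c : T) (a : ℕ)
    (P : Finset ℕ) (r : ℕ → T) (o : List T) :
    QState.time (⟨e :: st.hist, Fin.cons t st.times, c, a, P, r, o⟩ : QState T) k =
      if k = 0 then t else st.time (k - 1) := by
  unfold QState.time
  cases k with
  | zero => simp
  | succ k =>
    by_cases h : k < st.hist.length
    · simp only [List.length_cons, Nat.add_lt_add_iff_right, h, dite_true, Nat.add_eq_zero_iff,
        one_ne_zero, and_false, if_false, Nat.add_sub_cancel]
      rfl
    · simp [h]

theorem MeasurableState.arrive {st : Ω → QState T} (h : MeasurableState st) {t x : Ω → T}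
    (ht : Measurable t) (hx : Measurable x) {r : Ω → ℕ → T}
    (hr : ∀ j, Measurable fun ω => r ω j) :
    MeasurableState fun ω => (st ω).arrive (t ω) (x ω) (r ω) where
  hist b := measurableSet_comp h.hist (fun l => Event.arrival :: l) b
  arrived b := measurableSet_comp h.arrived (fun l => l + 1) b
  present b := measurableSet_comp₂ h.arrived h.present (fun j P => insert j P) b
  length b := h.length b
  time k := by
    simp only [QState.arrive, QState.time_cons]
    split_ifs
    · exact ht
    · exact h.time _
  clock := ht
  residual j := measurable_update h.arrived hr hx j
  out k := h.out k

theorem MeasurableState.depart {st : Ω → QState T} (h : MeasurableState st) {t : Ω → T}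
    (ht : Measurable t) {j : Ω → ℕ} (hj : ∀ d, MeasurableSet {ω | j ω = d}) :
    MeasurableState fun ω => (st ω).depart (t ω) (j ω) where
  hist b := measurableSet_comp₂ h.hist hj (fun l j => Event.departure j :: l) b
  arrived b := h.arrived b
  present b := measurableSet_comp₂ h.present hj (fun P j => P.erase j) b
  length b := by
    simpa only [QState.depart, List.length_append, List.length_singleton] using
      measurableSet_comp h.length (fun l => l + 1) b
  time k := by
    simp only [QState.depart, QState.time_cons]
    split_ifs
    · exact ht
    · exact h.time _
  clock := ht
  residual j := h.residual j
  out k := by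
    refine measurable_of_countable_pieces h.length
      (fun l ω => if k < l then (st ω).out.getD k 0 else if k = l then t ω else 0) ?_ ?_
    · intro l
      split_ifs
      · exact h.out k
      · exact ht
      · exact measurable_const
    · intro ω
      simp only [QState.depart]
      split_ifs with h1 h2
      · rw [List.getD_append _ _ _ _ h1]
      · rw [List.getD_append_right _ _ _ _ (by omega)]; simp [h2]
      · rw [List.getD_append_right _ _ _ _ (by omega),
          List.getD_eq_default _ _ (by simp; omega)]

theorem MeasurableState.setResidual {st : Ω → QState T} (h : MeasurableState st) {r : Ω → ℕ → T}
    (hr : ∀ j, Measurable fun ω => r ω j) :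
    MeasurableState fun ω => { st ω with residual := r ω } where
  hist := h.hist
  arrived := h.arrived
  present := h.present
  length := h.length
  time := h.time
  clock := h.clock
  residual := hr
  out := h.out

theorem MeasurableState.served (Q : Discipline T) {st : Ω → QState T} (h : MeasurableState st)
    (j : ℕ) : MeasurableSet {ω | Q.served (st ω) = j} := by
  have : Measurable fun ω => Q.served (st ω) := by
    refine measurable_of_countable_pieces (g := fun ω => ((st ω).hist, (st ω).present))
      (fun d => ?_) (fun d ω => Q.select d.1 (fun i => (st ω).time i) d.2) ?_ ?_
    · have : {ω | ((st ω).hist, (st ω).present) = d} =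
        {ω | (st ω).hist = d.1} ∩ {ω | (st ω).present = d.2} := by
        ext ω; simp [Prod.ext_iff]
      rw [this]
      exact (h.hist _).inter (h.present _)
    · exact fun d => (Q.measurable_select d.1 d.2).comp (measurable_pi_lambda _ fun i => h.time i)
    · intro ω
      simp only [Discipline.served]
      congr 1
      ext i
      simp [QState.time]
  exact this (measurableSet_singleton j)

variable [TopologicalSpace T] [OrderClosedTopology T] [SecondCountableTopology T] [BorelSpace T]
  [MeasurableAdd₂ T] [MeasurableSub₂ T]

theorem MeasurableState.step (Q : Discipline T) (n : ℕ) {a s : Ω → ℕ → T}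
    (ha : ∀ i, Measurable fun ω => a ω i) (hs : ∀ i, Measurable fun ω => s ω i)
    {st : Ω → QState T} (h : MeasurableState st) :
    MeasurableState fun ω => Q.step n (a ω) (s ω) (st ω) := by
  have hserv := h.served Q
  have hra : Measurable fun ω => (st ω).residual (Q.served (st ω)) := measurable_at hserv h.residual
  have haa : Measurable fun ω => a ω (st ω).arrived := measurable_at h.arrived ha
  have hsa : Measurable fun ω => s ω (st ω).arrived := measurable_at h.arrived hs
  have hlt : MeasurableSet {ω | (st ω).arrived < n} := by
    simpa using measurableSet_comp h.arrived (fun k => decide (k < n)) true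
  refine MeasurableState.ite ?_ ?_ ?_
  · simpa using measurableSet_comp h.present (fun P => decide P.Nonempty) true
  · refine MeasurableState.ite ?_ ?_ ?_
    · exact hlt.inter (measurableSet_lt haa (h.clock.add hra))
    · exact h.arrive haa hsa fun i => measurable_update hserv h.residual
        (hra.sub (haa.sub h.clock)) i
    · exact h.depart (h.clock.add hra) hserv
  · exact MeasurableState.ite hlt (h.arrive haa hsa h.residual) h

theorem MeasurableState.obsStep (Q : Discipline T) (n : ℕ) {a d : Ω → ℕ → T}
    (ha : ∀ i, Measurable fun ω => a ω i) (hd : ∀ i, Measurable fun ω => d ω i)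
    {st : Ω → QState T} (h : MeasurableState st) :
    MeasurableState fun ω => Q.obsStep n (a ω) (d ω) (st ω) := by
  have hserv := h.served Q
  have hra : Measurable fun ω => (st ω).residual (Q.served (st ω)) := measurable_at hserv h.residual
  have haa : Measurable fun ω => a ω (st ω).arrived := measurable_at h.arrived ha
  have hdl : Measurable fun ω => d ω (st ω).out.length := measurable_at h.length hd
  have hlt : MeasurableSet {ω | (st ω).arrived < n} := by
    simpa using measurableSet_comp h.arrived (fun k => decide (k < n)) true
  refine MeasurableState.ite ?_ ?_ ?_
  · simpa using measurableSet_comp h.present (fun P => decide P.Nonempty) true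
  · refine MeasurableState.ite ?_ ?_ ?_
    · exact hlt.inter (measurableSet_lt haa hdl)
    · exact h.arrive haa measurable_const fun i => measurable_update hserv h.residual
        (hra.add (haa.sub h.clock)) i
    · exact (h.setResidual fun i => measurable_update hserv h.residual
        (hra.add (hdl.sub h.clock)) i).depart hdl hserv
  · exact MeasurableState.ite hlt (h.arrive haa measurable_const h.residual) h

theorem measurableState_run (Q : Discipline T) (n : ℕ) {a s : Ω → ℕ → T}
    (ha : ∀ i, Measurable fun ω => a ω i) (hs : ∀ i, Measurable fun ω => s ω i) (m : ℕ) :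
    MeasurableState fun ω => Q.run n (a ω) (s ω) m := by
  induction m with
  | zero => exact measurableState_const _
  | succ m ih => simp only [Q.run_succ]; exact ih.step Q n ha hs

theorem measurableState_obs (Q : Discipline T) (n : ℕ) {a d : Ω → ℕ → T}
    (ha : ∀ i, Measurable fun ω => a ω i) (hd : ∀ i, Measurable fun ω => d ω i) (m : ℕ) :
    MeasurableState fun ω => Q.obs n (a ω) (d ω) m := by
  induction m with
  | zero => exact measurableState_const _
  | succ m ih => simp only [Q.obs_succ]; exact ih.obsStep Q n ha hd

theorem measurable_extendZero {n : ℕ} {x : Ω → Fin n → T} (hx : Measurable x) (i : ℕ) :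
    Measurable fun ω => extendZero (x ω) i := by
  unfold extendZero
  split_ifs with h
  · exact (measurable_pi_apply _).comp hx
  · exact measurable_const

theorem Discipline.measurable_departures (Q : Discipline T) {n : ℕ} {a s : Ω → Fin n → T}
    (ha : Measurable a) (hs : Measurable s) : Measurable fun ω => Q.departures (a ω) (s ω) :=
  measurable_pi_lambda _ fun k =>
    (measurableState_run Q n (measurable_extendZero ha) (measurable_extendZero hs) (2 * n)).out k

theorem Discipline.measurable_recover (Q : Discipline T) {n : ℕ} {a d : Ω → Fin n → T}
    (ha : Measurable a) (hd : Measurable d) : Measurable fun ω => Q.recover (a ω) (d ω) :=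
  measurable_pi_lambda _ fun k =>
    (measurableState_obs Q n (measurable_extendZero ha) (measurable_extendZero hd)
      (2 * n)).residual k

theorem measurable_arrivalTimes (n : ℕ) : Measurable (arrivalTimes : (Fin n → T) → Fin n → T) :=
  measurable_pi_lambda _ fun _ => Finset.measurable_sum _ fun j _ => measurable_pi_apply j

theorem measurable_interdepartures (n : ℕ) :
    Measurable (interdepartures : (Fin n → T) → Fin n → T) := by
  refine measurable_pi_lambda _ fun i => ?_
  unfold interdepartures
  split_ifs
  · exact (measurable_pi_apply _).sub (measurable_pi_apply _)
  · exact (measurable_pi_apply _).sub measurable_const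

theorem measurable_lastTime (n : ℕ) : Measurable (lastTime : (Fin n → T) → T) := by
  unfold lastTime
  split_ifs
  · exact measurable_pi_apply _
  · exact measurable_const

end

/-! ### Volume in continuous time -/

theorem injective_shear {n : ℕ} {c : Fin n → (Fin n → ℝ) → ℝ}
    (hdep : ∀ k d d', (∀ l < k, d l = d' l) → c k d = c k d') :
    Function.Injective fun (d : Fin n → ℝ) k => d k - c k d := by
  intro d d' h
  have : ∀ m (hm : m < n), d ⟨m, hm⟩ = d' ⟨m, hm⟩ := by
    intro m
    induction m using Nat.strong_induction_on with
    | _ m ih =>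
      intro hm
      have h1 := congrFun h ⟨m, hm⟩
      have h2 := hdep ⟨m, hm⟩ d d' fun l hl => ih l hl l.2
      simp only [h2] at h1
      linarith
  exact funext fun k => this k k.2

/-- A triangular map that translates each coordinate by a function of the preceding ones
preserves Lebesgue measure. -/
theorem measurePreserving_shear {n : ℕ} {c : Fin n → (Fin n → ℝ) → ℝ}
    (hc : ∀ k, Measurable (c k))
    (hdep : ∀ k d d', (∀ l < k, d l = d' l) → c k d = c k d') :
    MeasurePreserving fun (d : Fin n → ℝ) k => d k - c k d := by
  induction n with
  | zero =>
    have : (fun (d : Fin 0 → ℝ) k => d k - c k d) = id := by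
      ext d k; exact k.elim0
    rw [this]
    exact MeasurePreserving.id _
  | succ n ih =>
    have hsnoc : ∀ x : ℝ, Measurable fun y : Fin n → ℝ => (Fin.snoc y x : Fin (n + 1) → ℝ) := by
      intro x
      refine measurable_pi_lambda _ fun k => ?_
      refine Fin.lastCases ?_ (fun k => ?_) k
      · simp
      · simpa using measurable_pi_apply k
    have ih' := ih (c := fun k y => c k.castSucc (Fin.snoc y 0 : Fin (n + 1) → ℝ))
      (fun k => (hc _).comp (hsnoc 0)) (fun k d d' h => hdep _ _ _ fun l hl => by
        have hln : l.val < n := lt_of_lt_of_le hl (by simp)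
        obtain ⟨l, rfl⟩ : ∃ l' : Fin n, l'.castSucc = l := ⟨⟨l, hln⟩, rfl⟩
        simp only [Fin.snoc_castSucc]
        exact h _ hl)
    have hlast : Measurable fun y : Fin n → ℝ => c (Fin.last n) (Fin.snoc y 0 : Fin (n + 1) → ℝ) :=
      (hc _).comp (hsnoc 0)
    have hskew := MeasurePreserving.skew_product (μc := (volume : Measure ℝ))
      (μd := (volume : Measure ℝ)) (g := fun (y : Fin n → ℝ) (x : ℝ) =>
        x - c (Fin.last n) (Fin.snoc y 0 : Fin (n + 1) → ℝ)) ih'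
      (measurable_snd.sub (hlast.comp measurable_fst))
      (Eventually.of_forall fun y => map_sub_right_eq_self volume _)
    have he := volume_preserving_piFinSuccAbove (fun _ : Fin (n + 1) => ℝ) (Fin.last n)
    have hswap := Measure.measurePreserving_swap (μ := (volume : Measure ℝ))
      (ν := (volume : Measure (Fin n → ℝ)))
    have hswap' := Measure.measurePreserving_swap (ν := (volume : Measure ℝ))
      (μ := (volume : Measure (Fin n → ℝ)))
    have hall := he.symm.comp (hswap'.comp (hskew.comp (hswap.comp he)))
    convert hall using 1
    ext d k
    have key : ∀ k : Fin (n + 1), c k d = c k (Fin.snoc (fun j : Fin n => d j.castSucc) 0) := by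
      intro k
      refine hdep _ _ _ fun l hl => ?_
      have hln : l.val < n := lt_of_lt_of_le hl (by omega)
      obtain ⟨l, rfl⟩ : ∃ l' : Fin n, l'.castSucc = l := ⟨⟨l, hln⟩, rfl⟩
      simp
    simp only [Function.comp_apply, MeasurableEquiv.piFinSuccAbove_symm_apply,
      MeasurableEquiv.piFinSuccAbove_apply, Prod.swap, Fin.insertNthEquiv_symm_apply,
      Fin.insertNthEquiv_apply]
    rw [key k]
    refine Fin.lastCases ?_ (fun k => ?_) k
    · simp [Fin.removeNth, Fin.init_def]
    · simp [Fin.removeNth, Fin.init_def]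

/-- The departure times before the `k`-th one, followed by a constant. -/
def maskFrom {n : ℕ} (k : Fin n) (N : ℝ) (d : Fin n → ℝ) : Fin n → ℝ :=
  fun l => if l < k then d l else N

theorem measurable_maskFrom {n : ℕ} (k : Fin n) (N : ℝ) : Measurable (maskFrom k N) := by
  refine measurable_pi_lambda _ fun l => ?_
  unfold maskFrom
  split_ifs
  · exact measurable_pi_apply _
  · exact measurable_const

/-- Causality of a feedback encoder: whether the `i`-th arrival takes place at time `t` depends
only on the departures before `t`. -/
def Causal {T : Type} [LinearOrder T] {n : ℕ} (enc : (Fin n → T) → Fin n → T) : Prop :=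
  ∀ i d d', (∀ k, min (d k) (enc d i) = min (d' k) (enc d i)) → enc d' i = enc d i

section Word

variable (Q : Discipline ℝ) {n : ℕ} (enc : (Fin n → ℝ) → Fin n → ℝ)

/-- The number of events before the `k`-th departure. -/
noncomputable def departureIndex (d : Fin n → ℝ) (k : Fin n) : ℕ :=
  Nat.findGreatest (fun m => (Q.obs n (extendZero (enc d)) (extendZero d) m).out.length ≤ k) (2 * n)

/-- The discrete data of the departure times `d`: an upper bound, and for each departure the number
of preceding events and the name of the packet that departs. -/
noncomputable def word (d : Fin n → ℝ) : ℕ × (Fin n → ℕ) × (Fin n → ℕ) :=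
  (⌈lastTime d⌉₊, departureIndex Q enc d,
    fun k => Q.served (Q.obs n (extendZero (enc d)) (extendZero d) (departureIndex Q enc d k)))

/-- For departure times with word `w`, the difference between the `k`-th departure time and the
service time of the packet that departs.  It is computed from the preceding departures only. -/
noncomputable def offset (w : ℕ × (Fin n → ℕ) × (Fin n → ℕ)) (k : Fin n) (d : Fin n → ℝ) : ℝ :=
  (Q.obs n (extendZero (enc (maskFrom k w.1 d))) (extendZero (maskFrom k w.1 d)) (w.2.1 k)).clock -
    (Q.obs n (extendZero (enc (maskFrom k w.1 d))) (extendZero (maskFrom k w.1 d))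
      (w.2.1 k)).residual (w.2.2 k)

open Classical in
/-- The permutation that lists the packets in the order of departure (the identity if there is
none). -/
noncomputable def wordPerm (w : ℕ × (Fin n → ℕ) × (Fin n → ℕ)) : Equiv.Perm (Fin n) :=
  if h : ∃ e : Equiv.Perm (Fin n), ∀ k, ((e k : Fin n) : ℕ) = w.2.2 k then h.choose else 1

/-- The measure-preserving map that recovers the service times from the departure times with
word `w`. -/
noncomputable def wordMap (w : ℕ × (Fin n → ℕ) × (Fin n → ℕ)) (d : Fin n → ℝ) : Fin n → ℝ :=
  fun j => d ((wordPerm w).symm j) - offset Q enc w ((wordPerm w).symm j) d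

variable {enc}

theorem offset_congr (w : ℕ × (Fin n → ℕ) × (Fin n → ℕ)) (k : Fin n) (d d' : Fin n → ℝ)
    (h : ∀ l < k, d l = d' l) : offset Q enc w k d = offset Q enc w k d' := by
  have : maskFrom k w.1 d = maskFrom k w.1 d' := by
    ext l
    unfold maskFrom
    split_ifs with hl
    · exact h l hl
    · rfl
  unfold offset
  rw [this]

theorem measurable_offset (henc : Measurable enc) (w : ℕ × (Fin n → ℕ) × (Fin n → ℕ))
    (k : Fin n) : Measurable (offset Q enc w k) := by
  have h := measurableState_obs Q n
    (measurable_extendZero (henc.comp (measurable_maskFrom k (w.1 : ℝ))))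
    (measurable_extendZero (measurable_maskFrom k (w.1 : ℝ))) (w.2.1 k)
  exact h.clock.sub (h.residual _)

/-- Up to a permutation of the coordinates `wordMap` is a triangular shear. -/
theorem injective_wordMap (w : ℕ × (Fin n → ℕ) × (Fin n → ℕ)) :
    Function.Injective (wordMap Q enc w) := by
  intro d d' h
  refine injective_shear (c := offset Q enc w) (offset_congr Q w) ?_
  ext k
  have := congrFun h (wordPerm w k)
  simpa [wordMap] using this

theorem measurePreserving_wordMap (henc : Measurable enc)
    (w : ℕ × (Fin n → ℕ) × (Fin n → ℕ)) : MeasurePreserving (wordMap Q enc w) := by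
  have h := measurePreserving_shear (measurable_offset Q henc w) (offset_congr Q w)
  have h2 := volume_measurePreserving_piCongrLeft (fun _ : Fin n => ℝ) (wordPerm w)
  have heq : wordMap Q enc w = MeasurableEquiv.piCongrLeft (fun _ : Fin n => ℝ) (wordPerm w) ∘
      fun d k => d k - offset Q enc w k d := by
    funext d j
    obtain ⟨k, rfl⟩ := (wordPerm w).surjective j
    rw [Function.comp_apply, MeasurableEquiv.coe_piCongrLeft, Equiv.piCongrLeft_apply_apply]
    simp [wordMap]
  rw [heq]
  exact h2.comp h

theorem measurable_departureIndex (henc : Measurable enc) (k : Fin n) :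
    Measurable fun d => departureIndex Q enc d k := by
  refine measurable_findGreatest fun m _ => ?_
  have h := measurableState_obs Q n (measurable_extendZero henc)
    (measurable_extendZero (measurable_id (α := Fin n → ℝ))) m
  simpa using measurableSet_comp h.length (fun l => decide (l ≤ k)) true

theorem measurableSet_word (henc : Measurable enc) (w : ℕ × (Fin n → ℕ) × (Fin n → ℕ)) :
    MeasurableSet {d | word Q enc d = w} := by
  have h : ∀ m, MeasurableState fun d : Fin n → ℝ =>
      Q.obs n (extendZero (enc d)) (extendZero d) m :=
    measurableState_obs Q n (measurable_extendZero henc)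
      (measurable_extendZero (measurable_id (α := Fin n → ℝ)))
  have h1 : Measurable fun d : Fin n → ℝ => ⌈lastTime d⌉₊ :=
    Nat.measurable_ceil.comp (measurable_lastTime n)
  have h2 := measurable_departureIndex Q henc
  have h3 : ∀ k, Measurable fun d => Q.served (Q.obs n (extendZero (enc d)) (extendZero d)
      (departureIndex Q enc d k)) := by
    intro k
    refine measurable_of_countable_pieces (g := fun d => departureIndex Q enc d k)
      (fun m => h2 k (measurableSet_singleton m))
      (fun m d => Q.served (Q.obs n (extendZero (enc d)) (extendZero d) m)) (fun m => ?_)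
      fun _ => rfl
    exact measurable_to_countable' fun j => (h m).served Q j
  have : Measurable fun d => word Q enc d :=
    h1.prodMk ((measurable_pi_lambda _ h2).prodMk (measurable_pi_lambda _ h3))
  exact this (measurableSet_singleton w)

end Word

theorem Discipline.length_run_mono {T : Type} [LinearOrder T] [AddCommMonoid T] [Sub T]
    [MeasurableSpace T] [IsOrderedCancelAddMonoid T] [OrderedSub T] [ExistsAddOfLE T]
    (Q : Discipline T) {n : ℕ} {a s : ℕ → T} (hin : IsInput n a s) {m m' : ℕ} (h : m ≤ m') :
    (Q.run n a s m).out.length ≤ (Q.run n a s m').out.length := by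
  obtain ⟨l, hl, -⟩ := Q.exists_out_run hin h
  rw [hl, List.length_append]
  omega

/-- A packet that has left does not come back. -/
theorem Discipline.notMem_present_of_le {T : Type} [LinearOrder T] [AddCommMonoid T] [Sub T]
    [MeasurableSpace T] (Q : Discipline T) {n : ℕ} {a s : ℕ → T} {m m' : ℕ} (h : m ≤ m') {j : ℕ}
    (hj : j < (Q.run n a s m).arrived) (hj' : j ∉ (Q.run n a s m).present) :
    j ∉ (Q.run n a s m').present := by
  suffices h2 : j < (Q.run n a s m').arrived ∧ j ∉ (Q.run n a s m').present from h2.2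
  induction m', h using Nat.le_induction with
  | base => exact ⟨hj, hj'⟩
  | succ k hk ih =>
    rw [Q.run_succ]
    rcases Q.step_cases n a s (Q.run n a s k) with ⟨he, ha, hs⟩ | ⟨he, ha, hs⟩ |
      ⟨hj, ha, ht, hs⟩ | ⟨hj, hle, hs⟩ <;> rw [hs]
    · simp only [QState.arrive, Finset.mem_insert, not_or]
      exact ⟨by omega, by omega, ih.2⟩
    · exact ih
    · simp only [QState.arrive, Finset.mem_insert, not_or]
      exact ⟨by omega, by omega, ih.2⟩
    · simp only [QState.depart, Finset.mem_erase, not_and]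
      exact ⟨ih.1, fun _ => ih.2⟩

section

variable (Q : Discipline ℝ) {n : ℕ} {enc : (Fin n → ℝ) → Fin n → ℝ}

/-- What happens at the `k`-th departure. -/
theorem departureIndex_spec {d s : Fin n → ℝ} (hin : IsInput n (extendZero (enc d)) (extendZero s))
    (hd : d = Q.departures (enc d) s) (k : Fin n) {m : ℕ} (hm : m = departureIndex Q enc d k)
    {st : QState ℝ} (hst : st = Q.run n (extendZero (enc d)) (extendZero s) m) :
    m < 2 * n ∧ st.out.length = k ∧ Q.served st ∈ st.present ∧
      Q.run n (extendZero (enc d)) (extendZero s) (m + 1) = st.depart (d k) (Q.served st) ∧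
      d k = st.clock + st.residual (Q.served st) ∧
      Q.served (Q.obs n (extendZero (enc d)) (extendZero d) m) = Q.served st ∧
      extendZero s (Q.served st) =
        d k - ((Q.obs n (extendZero (enc d)) (extendZero d) m).clock -
          (Q.obs n (extendZero (enc d)) (extendZero d) m).residual (Q.served st)) := by
  have hd' : ∀ k < n, extendZero d k =
      (Q.run n (extendZero (enc d)) (extendZero s) (2 * n)).out.getD k 0 := by
    intro k hk
    conv_lhs => rw [hd]
    exact Q.extendZero_departures _ _ hk
  have hlen : ∀ m ≤ 2 * n, (Q.obs n (extendZero (enc d)) (extendZero d) m).out.length =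
      (Q.run n (extendZero (enc d)) (extendZero s) m).out.length := by
    intro m hm
    obtain ⟨v, hv, -⟩ := Q.obs_eq hin hd' hm
    rw [hv]
  have hend := (Q.run_end hin).2.1
  have hk := k.2
  have hle : m ≤ 2 * n := by rw [hm]; exact Nat.findGreatest_le _
  have hspec : (Q.obs n (extendZero (enc d)) (extendZero d) m).out.length ≤ k := by
    rw [hm]
    exact Nat.findGreatest_spec (P := fun m =>
      (Q.obs n (extendZero (enc d)) (extendZero d) m).out.length ≤ k) (Nat.zero_le _)
      (by simp [Discipline.obs, QState.init])
  rw [hlen m hle] at hspec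
  have hlt : m < 2 * n := by
    rcases hle.lt_or_eq with h | h
    · exact h
    · rw [h, hend] at hspec; omega
  have hgt : (k : ℕ) < (Q.run n (extendZero (enc d)) (extendZero s) (m + 1)).out.length := by
    rw [← hlen _ hlt, ← not_le]
    exact Nat.findGreatest_is_greatest (P := fun m =>
      (Q.obs n (extendZero (enc d)) (extendZero d) m).out.length ≤ k)
      (by rw [hm]; exact Nat.lt_succ_self _) hlt
  have hsucc := Q.run_succ n (extendZero (enc d)) (extendZero s) m
  obtain ⟨v, hv, hv1, -⟩ := Q.obs_eq hin hd' hle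
  have hdep := fun t j hj => Q.departure_eq hin hd' (m := m) hlt (t := t) (j := j) hj
  rw [← hst] at hspec hsucc hv hv1 hdep
  rw [hv]
  rcases Q.step_cases n (extendZero (enc d)) (extendZero s) st with ⟨he, ha, hs⟩ |
    ⟨he, ha, hs⟩ | ⟨hj, ha, ht, hs⟩ | ⟨hj, hle, hs⟩
  · rw [hsucc, hs] at hgt; simp only [QState.arrive] at hgt; omega
  · rw [hsucc, hs] at hgt; omega
  · rw [hsucc, hs] at hgt; simp only [QState.arrive] at hgt; omega
  · rw [hs] at hsucc
    have hdk := hdep _ _ hj hsucc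
    have hl : st.out.length = k := by
      rw [hsucc] at hgt
      simp only [QState.depart, List.length_append, List.length_singleton] at hgt
      omega
    rw [hl, extendZero_fin] at hdk
    refine ⟨hlt, hl, hj, by rw [hsucc, hdk], hdk, rfl, ?_⟩
    have h1 := hv1 _ hj
    simp only
    rw [← h1, hdk]
    ring

theorem le_lastTime {d : Fin n → ℝ} (hd : Monotone d) (k : Fin n) : d k ≤ lastTime d := by
  have hk := k.2
  rw [lastTime, dif_pos (by omega)]
  exact hd (by simp only [Fin.le_def]; omega)

/-- Up to the `k`-th departure the observer needs to know the preceding departures only. -/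
theorem obs_maskFrom (hc : Causal enc) {d s : Fin n → ℝ}
    (hin : IsInput n (extendZero (enc d)) (extendZero s))
    (hd : d = Q.departures (enc d) s) (k : Fin n) {N : ℝ} (hN : lastTime d ≤ N) {m : ℕ}
    (hm : m ≤ departureIndex Q enc d k) :
    Q.obs n (extendZero (enc (maskFrom k N d))) (extendZero (maskFrom k N d)) m =
      Q.obs n (extendZero (enc d)) (extendZero d) m := by
  have hmono : Monotone d := by
    rw [hd]; exact (Q.departures_strictMono hin).monotone
  have hd' : ∀ k < n, extendZero d k =
      (Q.run n (extendZero (enc d)) (extendZero s) (2 * n)).out.getD k 0 := by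
    intro k hk
    conv_lhs => rw [hd]
    exact Q.extendZero_departures _ _ hk
  obtain ⟨hK, hKlen, -, -⟩ := departureIndex_spec Q hin hd k rfl rfl
  have hdN : ∀ l, d l ≤ N := fun l => (le_lastTime hmono l).trans hN
  -- the two inputs cannot be told apart by an encoder before the `k`-th departure
  have hcaus : ∀ i l : Fin n, l ≤ k → enc d i < d l → enc (maskFrom k N d) i = enc d i := by
    intro i l hl hlt
    refine hc i d (maskFrom k N d) fun q => ?_
    unfold maskFrom
    split_ifs with hq
    · rfl
    · have h1 : enc d i ≤ d q := hlt.le.trans (hmono (hl.trans (not_lt.1 hq)))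
      rw [min_eq_right h1, min_eq_right (h1.trans (hdN q))]
  have hcaus' : ∀ i l : Fin n, l < k → enc (maskFrom k N d) i < d l →
      enc d i = enc (maskFrom k N d) i := by
    intro i l hl hlt
    refine hc i (maskFrom k N d) d fun q => ?_
    unfold maskFrom at hlt ⊢
    split_ifs with hq
    · rfl
    · have h1 : enc (maskFrom k N d) i ≤ d q := hlt.le.trans (hmono (hl.le.trans (not_lt.1 hq)))
      unfold maskFrom at h1
      rw [min_eq_right h1, min_eq_right (h1.trans (hdN q))]
  induction m with
  | zero => rfl
  | succ m ih =>
    have ih := ih (by omega)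
    rw [Q.obs_succ, Q.obs_succ, ih]
    obtain ⟨v, hv, -, -⟩ := Q.obs_eq hin hd' (m := m) (by omega)
    have hinv := Q.inv_run hin m
    have hlen1 := Q.length_run_mono hin (m := m + 1) (m' := departureIndex Q enc d k) hm
    rw [hKlen] at hlen1
    have hsucc := Q.run_succ n (extendZero (enc d)) (extendZero s) m
    have hlt := fun x r => Q.arrival_lt hin hd' (m := m) (by omega) (x := x) (r := r)
    rw [hv]
    generalize Q.run n (extendZero (enc d)) (extendZero s) m = st at *
    have hk := k.2
    -- either a departure before the `k`-th one comes next, or an arrival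
    have hcase : st.out.length < k ∨ (st.out.length = k ∧ st.arrived < n ∧
        extendZero (enc d) st.arrived < extendZero d st.out.length) := by
      rcases Q.step_cases n (extendZero (enc d)) (extendZero s) st with ⟨he, ha, hs⟩ |
        ⟨he, ha, hs⟩ | ⟨hj, ha, ht, hs⟩ | ⟨hj, hle, hs⟩
      · have h1 := hlt _ _ (hsucc.trans hs) ha
        rw [hsucc, hs] at hlen1
        rcases hlen1.lt_or_eq with h | h
        · exact Or.inl h
        · exact Or.inr ⟨h, ha, h1⟩
      · have h1 := hinv.card
        have h2 := hinv.arrived_le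
        rw [he, Finset.card_empty] at h1
        rw [hsucc, hs] at hlen1
        omega
      · have h1 := hlt _ _ (hsucc.trans hs) ha
        rw [hsucc, hs] at hlen1
        rcases hlen1.lt_or_eq with h | h
        · exact Or.inl h
        · exact Or.inr ⟨h, ha, h1⟩
      · rw [hsucc, hs] at hlen1
        simp only [QState.depart, List.length_append, List.length_singleton] at hlen1
        exact Or.inl (by omega)
    have hln : st.out.length < n := by omega
    refine Q.obsStep_congr (st := { st with residual := v }) ?_ ?_ ?_ ?_
    · intro he ha
      rcases Q.step_cases n (extendZero (enc d)) (extendZero s) st with ⟨he', ha', hs⟩ |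
        ⟨he', ha', hs⟩ | ⟨hj, ha', ht, hs⟩ | ⟨hj, hle, hs⟩
      · exact hlt _ _ (hsucc.trans hs) ha
      · exact absurd ha ha'
      · simp only at he
        rw [he] at hj; simp at hj
      · simp only at he
        rw [he] at hj; simp at hj
    · intro ha
      simp only at ha ⊢
      rw [extendZero_apply _ ha, extendZero_apply _ ha, extendZero_apply _ hln,
        extendZero_apply _ hln]
      constructor
      · intro h
        rw [hcaus _ _ (by simp only [Fin.le_def]; omega) h]
        unfold maskFrom
        split_ifs
        · exact h
        · exact h.trans_le (hdN _)
      · intro h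
        rcases hcase with h1 | ⟨h1, h2, h3⟩
        · have hlk : (⟨st.out.length, hln⟩ : Fin n) < k := h1
          have h' : enc (maskFrom k N d) ⟨st.arrived, ha⟩ < d ⟨st.out.length, hln⟩ := by
            refine h.trans_eq ?_
            unfold maskFrom
            rw [if_pos hlk]
          rw [hcaus' _ _ hlk h']
          exact h'
        · rwa [extendZero_apply _ ha, extendZero_apply _ hln] at h3
    · intro ha h
      simp only at ha h ⊢
      rw [extendZero_apply _ ha, extendZero_apply _ hln] at h
      rw [extendZero_apply _ ha, extendZero_apply _ ha]
      exact hcaus _ _ (by simp only [Fin.le_def]; omega) h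
    · intro _ hnot
      simp only at hnot ⊢
      rcases hcase with h1 | ⟨h1, h2, h3⟩
      · rw [extendZero_apply _ hln, extendZero_apply _ hln]
        unfold maskFrom
        rw [if_pos]
        exact h1
      · exact absurd ⟨h2, h3⟩ hnot

/-- On departure times with word `w` the map `wordMap w` recovers the service times.  Each departing
packet has been served in full, so its departure time is the time of the preceding event, plus its
service time, minus the service it had received by then; causality of the encoder makes the last
two quantities depend on the preceding departures only. -/
theorem wordMap_word (hc : Causal enc) {d s : Fin n → ℝ}
    (hin : IsInput n (extendZero (enc d)) (extendZero s))
    (hd : d = Q.departures (enc d) s) : wordMap Q enc (word Q enc d) d = s := by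
  have hspec := fun k => departureIndex_spec Q hin hd k rfl rfl
  set K := departureIndex Q enc d with hK
  set R := Q.run n (extendZero (enc d)) (extendZero s) with hR
  have hlt : ∀ k, Q.served (R (K k)) < n := fun k =>
    ((Q.inv_run hin (K k)).present_lt _ (hspec k).2.2.1).trans_le (Q.inv_run hin (K k)).arrived_le
  have hinj : Function.Injective fun k : Fin n => (⟨Q.served (R (K k)), hlt k⟩ : Fin n) := by
    have key : ∀ k l : Fin n, k < l → Q.served (R (K k)) ≠ Q.served (R (K l)) := by
      intro k l hkl he
      obtain ⟨h1, h2, h3, h4, -⟩ := hspec k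
      obtain ⟨h1', h2', h3', -⟩ := hspec l
      have hKl : K k + 1 ≤ K l := by
        by_contra hcon
        have := Q.length_run_mono hin (m := K l) (m' := K k) (by omega)
        change (R (K l)).out.length ≤ (R (K k)).out.length at this
        rw [h2, h2'] at this
        exact absurd hkl (not_lt.2 this)
      refine Q.notMem_present_of_le (n := n) (a := extendZero (enc d)) (s := extendZero s)
        hKl (j := Q.served (R (K k))) ?_ ?_ (by rw [he]; exact h3')
      · change _ < (R (K k + 1)).arrived
        rw [h4]
        exact (Q.inv_run hin (K k)).present_lt _ h3
      · change _ ∉ (R (K k + 1)).present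
        rw [h4]
        simp [QState.depart]
    intro k l h
    by_contra hne
    rcases lt_or_gt_of_ne hne with h1 | h1
    · exact key k l h1 (congrArg Fin.val h)
    · exact key l k h1 (congrArg Fin.val h).symm
  have hex : ∃ e : Equiv.Perm (Fin n), ∀ k, ((e k : Fin n) : ℕ) = (word Q enc d).2.2 k := by
    refine ⟨Equiv.ofBijective _ (Finite.injective_iff_bijective.1 hinj), fun k => ?_⟩
    exact (hspec k).2.2.2.2.2.1.symm
  have hperm : ∀ k, ((wordPerm (word Q enc d) k : Fin n) : ℕ) = (word Q enc d).2.2 k := by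
    intro k
    rw [wordPerm, dif_pos hex]
    exact hex.choose_spec k
  funext j
  obtain ⟨k, rfl⟩ := (wordPerm (word Q enc d)).surjective j
  have h2 := (hspec k).2.2.2.2.2.1
  have h3 := (hspec k).2.2.2.2.2.2
  have h4 : (word Q enc d).2.2 k = Q.served (R (K k)) := h2
  have h5 : s (wordPerm (word Q enc d) k) = extendZero s (Q.served (R (K k))) := by
    rw [← h4, ← hperm, extendZero_fin]
  have h6 := obs_maskFrom Q hc hin hd k (N := ((word Q enc d).1 : ℝ)) (Nat.le_ceil _) le_rfl
  rw [h5, h3]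
  simp only [wordMap, Equiv.symm_apply_apply, offset]
  rw [h4]
  change d k - ((Q.obs n _ _ (K k)).clock - (Q.obs n _ _ (K k)).residual _) = _
  rw [h6]

theorem volume_image_eq {f : (Fin n → ℝ) → Fin n → ℝ} (hf : MeasurePreserving f)
    (hinj : Function.Injective f) {A : Set (Fin n → ℝ)} (hA : MeasurableSet A) :
    MeasurableSet (f '' A) ∧ volume (f '' A) = volume A := by
  have h1 : MeasurableSet (f '' A) :=
    (hf.measurable.measurableEmbedding hinj).measurableSet_image.2 hA
  refine ⟨h1, ?_⟩
  rw [← hf.measure_preimage h1.nullMeasurableSet, Set.preimage_image_eq _ hinj]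

/-- For a fixed message, with or without feedback, the map from service times to departure times
does not increase volumes of preimages. -/
theorem volume_preimage_departures_le (henc : Measurable enc) (hc : Causal enc)
    {E : Set (Fin n → ℝ)} {dep : (Fin n → ℝ) → Fin n → ℝ}
    (hE : ∀ s ∈ E, IsInput n (extendZero (enc (dep s))) (extendZero s) ∧
      dep s = Q.departures (enc (dep s)) s)
    {B : Set (Fin n → ℝ)} (hB : MeasurableSet B) : volume (E ∩ dep ⁻¹' B) ≤ volume B := by
  have hsub : E ∩ dep ⁻¹' B ⊆ ⋃ w, wordMap Q enc w '' (B ∩ {d | word Q enc d = w}) := by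
    rintro s ⟨hs, hsB⟩
    obtain ⟨h1, h2⟩ := hE s hs
    exact Set.mem_iUnion.2 ⟨word Q enc (dep s), dep s, ⟨hsB, rfl⟩, wordMap_word Q hc h1 h2⟩
  calc volume (E ∩ dep ⁻¹' B)
      ≤ volume (⋃ w, wordMap Q enc w '' (B ∩ {d | word Q enc d = w})) := measure_mono hsub
    _ ≤ ∑' w, volume (wordMap Q enc w '' (B ∩ {d | word Q enc d = w})) := measure_iUnion_le _
    _ = ∑' w, volume (B ∩ {d | word Q enc d = w}) := by
        congr 1
        ext w
        exact (volume_image_eq (measurePreserving_wordMap Q henc w)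
          (injective_wordMap Q w) (hB.inter (measurableSet_word Q henc w))).2
    _ = volume (⋃ w, B ∩ {d | word Q enc d = w}) := by
        refine (measure_iUnion ?_ fun w => hB.inter (measurableSet_word Q henc w)).symm
        intro w w' hne
        refine Set.disjoint_left.2 fun d h1 h2 => hne ?_
        exact h1.2.symm.trans h2.2
    _ ≤ volume B := measure_mono (Set.iUnion_subset fun w => Set.inter_subset_left)

theorem causal_const (a : Fin n → ℝ) : Causal fun _ => a := fun _ _ _ _ => rfl

/-- For fixed arrival times, the map from departure times back to service times does not increase
volumes of preimages either. -/
theorem volume_preimage_recover_le {a : Fin n → ℝ} (ha : Monotone a) (h0 : ∀ i, 0 ≤ a i)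
    {B : Set (Fin n → ℝ)} (hB : MeasurableSet B) :
    volume {d | Q.departures a (Q.recover a d) = d ∧ (∀ i, 0 < Q.recover a d i) ∧
      Q.recover a d ∈ B} ≤ volume B := by
  set enc : (Fin n → ℝ) → Fin n → ℝ := fun _ => a
  have henc : Measurable enc := measurable_const
  set G : Set (Fin n → ℝ) := {d | Q.departures a (Q.recover a d) = d ∧ ∀ i, 0 < Q.recover a d i}
  have hrec : Measurable fun d => Q.recover a d := Q.measurable_recover measurable_const measurable_id
  have hG : MeasurableSet G := by
    have h1 : MeasurableSet {d | Q.departures a (Q.recover a d) = d} :=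
      measurableSet_eq_fun (Q.measurable_departures measurable_const hrec) measurable_id
    have h2 : MeasurableSet {d | ∀ i, 0 < Q.recover a d i} := by
      rw [Set.ofPred_forall]
      exact MeasurableSet.iInter fun i =>
        measurableSet_lt measurable_const ((measurable_pi_apply i).comp hrec)
    exact h1.inter h2
  have hmap : ∀ d ∈ G, wordMap Q enc (word Q enc d) d = Q.recover a d := fun d hd =>
    wordMap_word Q (causal_const a) (isInput_extendZero ha h0 hd.2) hd.1.symm
  set Z := fun w => G ∩ {d | word Q enc d = w}
  have hZ : ∀ w, MeasurableSet (Z w) := fun w => hG.inter (measurableSet_word Q henc w)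
  have hsub : {d | Q.departures a (Q.recover a d) = d ∧ (∀ i, 0 < Q.recover a d i) ∧
      Q.recover a d ∈ B} ⊆ ⋃ w, Z w ∩ wordMap Q enc w ⁻¹' B := by
    rintro d ⟨h1, h2, h3⟩
    refine Set.mem_iUnion.2 ⟨word Q enc d, ⟨⟨h1, h2⟩, rfl⟩, ?_⟩
    rw [Set.mem_preimage, hmap d ⟨h1, h2⟩]
    exact h3
  have himg := fun w => volume_image_eq (measurePreserving_wordMap Q henc w)
    (injective_wordMap Q w) ((hZ w).inter ((measurePreserving_wordMap Q henc w).measurable hB))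
  refine (measure_mono hsub).trans ((measure_iUnion_le _).trans ?_)
  calc ∑' w, volume (Z w ∩ wordMap Q enc w ⁻¹' B)
      = ∑' w, volume (wordMap Q enc w '' (Z w ∩ wordMap Q enc w ⁻¹' B)) := by
        congr 1; ext w; exact (himg w).2.symm
    _ = volume (⋃ w, wordMap Q enc w '' (Z w ∩ wordMap Q enc w ⁻¹' B)) := by
        refine (measure_iUnion ?_ fun w => (himg w).1).symm
        intro w w' hne
        refine Set.disjoint_left.2 ?_
        rintro s ⟨d, ⟨⟨hd, hdw⟩, -⟩, hds⟩ ⟨d', ⟨⟨hd', hdw'⟩, -⟩, hds'⟩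
        simp only [Set.mem_ofPred_eq] at hdw hdw'
        rw [← hdw, hmap d hd] at hds
        rw [← hdw', hmap d' hd'] at hds'
        have : d = d' := by rw [← hd.1, ← hd'.1, hds, hds']
        exact hne (by rw [← hdw, ← hdw', this])
    _ ≤ volume B := by
        refine measure_mono (Set.iUnion_subset fun w => ?_)
        rintro _ ⟨d, hd, rfl⟩
        exact hd.2

end

/-! ### The channel from interarrivals to interdepartures -/

section Channel

variable {T : Type} [LinearOrder T] [AddCommMonoid T] [Sub T] [MeasurableSpace T]

/-- The interdepartures for given interarrivals and service times. -/
noncomputable def Discipline.channel (Q : Discipline T) {n : ℕ} (A s : Fin n → T) : Fin n → T :=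
  interdepartures (Q.departures (arrivalTimes A) s)

/-- The service times recovered from interarrivals and interdepartures. -/
noncomputable def Discipline.unchannel (Q : Discipline T) {n : ℕ} (A y : Fin n → T) : Fin n → T :=
  Q.recover (arrivalTimes A) (arrivalTimes y)

/-- The reference measure `m` on the time axis is not expanded by the maps between service times
and interdepartures, for all disciplines.  This holds for the counting measure on `ℕ` and for the
Lebesgue measure on `ℝ`, and replaces a change of variables in the computation of densities. -/
structure IsReference (m : Measure T) : Prop where
  departures_le : ∀ (Q : Discipline T) (n : ℕ) (enc dep : (Fin n → T) → Fin n → T)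
    (E B : Set (Fin n → T)), Measurable enc → Causal enc →
    (∀ s ∈ E, IsInput n (extendZero (enc (dep s))) (extendZero s) ∧
      dep s = Q.departures (enc (dep s)) s) → MeasurableSet B →
    Measure.pi (fun _ => m) (E ∩ {s | interdepartures (dep s) ∈ B}) ≤ Measure.pi (fun _ => m) B
  recover_le : ∀ (Q : Discipline T) (n : ℕ) (A : Fin n → T) (B : Set (Fin n → T)),
    (∀ i, 0 ≤ A i) → MeasurableSet B →
    Measure.pi (fun _ => m) {y | Q.channel A (Q.unchannel A y) = y ∧
      (∀ i, 0 < Q.unchannel A y i) ∧ Q.unchannel A y ∈ B} ≤ Measure.pi (fun _ => m) B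

variable [IsOrderedCancelAddMonoid T] [OrderedSub T] [ExistsAddOfLE T]

theorem isInput_arrivalTimes {n : ℕ} {A s : Fin n → T} (hA : ∀ i, 0 ≤ A i) (hs : ∀ i, 0 < s i) :
    IsInput n (extendZero (arrivalTimes A)) (extendZero s) :=
  isInput_extendZero (monotone_arrivalTimes hA) (arrivalTimes_nonneg hA) hs

theorem Discipline.arrivalTimes_channel (Q : Discipline T) {n : ℕ} {A s : Fin n → T}
    (hA : ∀ i, 0 ≤ A i) (hs : ∀ i, 0 < s i) :
    arrivalTimes (Q.channel A s) = Q.departures (arrivalTimes A) s :=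
  arrivalTimes_interdepartures (Q.departures_strictMono (isInput_arrivalTimes hA hs)).monotone

theorem Discipline.unchannel_channel (Q : Discipline T) {n : ℕ} {A s : Fin n → T}
    (hA : ∀ i, 0 ≤ A i) (hs : ∀ i, 0 < s i) : Q.unchannel A (Q.channel A s) = s := by
  rw [Discipline.unchannel, Q.arrivalTimes_channel hA hs]
  exact Q.recover_departures (isInput_arrivalTimes hA hs)

theorem Discipline.channel_pos (Q : Discipline T) {n : ℕ} {A s : Fin n → T}
    (hA : ∀ i, 0 ≤ A i) (hs : ∀ i, 0 < s i) (i : Fin n) : 0 < Q.channel A s i :=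
  Q.interdepartures_pos (isInput_arrivalTimes hA hs) i

theorem Discipline.sum_channel (Q : Discipline T) {n : ℕ} {A s : Fin n → T}
    (hA : ∀ i, 0 ≤ A i) (hs : ∀ i, 0 < s i) :
    ∑ i, Q.channel A s i = completion (extendZero (arrivalTimes A)) (extendZero s) n := by
  have hin := isInput_arrivalTimes hA hs
  rw [← Q.lastTime_departures hin,
    lastTime_eq_sum_interdepartures (Q.departures_strictMono hin).monotone]
  rfl

variable [TopologicalSpace T] [OrderClosedTopology T] [SecondCountableTopology T] [BorelSpace T]
  [MeasurableAdd₂ T] [MeasurableSub₂ T]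

theorem Discipline.measurable_channel (Q : Discipline T) {n : ℕ} {Ω : Type} [MeasurableSpace Ω]
    {A s : Ω → Fin n → T} (hA : Measurable A) (hs : Measurable s) :
    Measurable fun ω => Q.channel (A ω) (s ω) :=
  (measurable_interdepartures n).comp
    (Q.measurable_departures ((measurable_arrivalTimes n).comp hA) hs)

theorem Discipline.measurable_unchannel (Q : Discipline T) {n : ℕ} {Ω : Type} [MeasurableSpace Ω]
    {A y : Ω → Fin n → T} (hA : Measurable A) (hy : Measurable y) :
    Measurable fun ω => Q.unchannel (A ω) (y ω) :=
  Q.measurable_recover ((measurable_arrivalTimes n).comp hA) ((measurable_arrivalTimes n).comp hy)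

end Channel

theorem arrivalTimes_interdepartures_real {n : ℕ} (d : Fin n → ℝ) :
    arrivalTimes (interdepartures d) = d := by
  suffices h : ∀ k (hk : k < n), arrivalTimes (interdepartures d) ⟨k, hk⟩ = d ⟨k, hk⟩ from
    funext fun i => h i i.2
  intro k
  induction k with
  | zero =>
    intro hk
    rw [arrivalTimes_zero_index _ _ rfl]
    simp [interdepartures]
  | succ k ih =>
    intro hk
    rw [arrivalTimes_eq_pred_add _ _ (by simp)]
    simp only [Nat.add_sub_cancel]
    rw [ih (by omega), interdepartures]
    simp

theorem measurePreserving_interdepartures (n : ℕ) :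
    MeasurePreserving (interdepartures : (Fin n → ℝ) → Fin n → ℝ) := by
  refine measurePreserving_shear
    (c := fun k d => if 0 < (k : ℕ) then d ⟨k - 1, by omega⟩ else 0) (fun k => ?_) ?_
  · split_ifs
    · exact measurable_pi_apply _
    · exact measurable_const
  · intro k d d' h
    split_ifs with hk
    · exact h _ (by simp only [Fin.lt_def]; omega)
    · rfl

/-- Passing from departure times to interdepartures is a shear, hence harmless. -/
theorem volume_preimage_interdepartures_le (Q : Discipline ℝ) {n : ℕ}
    {enc dep : (Fin n → ℝ) → Fin n → ℝ} {E B : Set (Fin n → ℝ)} (henc : Measurable enc)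
    (hc : Causal enc)
    (hE : ∀ s ∈ E, IsInput n (extendZero (enc (dep s))) (extendZero s) ∧
      dep s = Q.departures (enc (dep s)) s) (hB : MeasurableSet B) :
    volume (E ∩ {s | interdepartures (dep s) ∈ B}) ≤ volume B := by
  have hi := measurePreserving_interdepartures n
  have h := volume_preimage_departures_le Q henc hc hE (hi.measurable hB)
  rwa [hi.measure_preimage hB.nullMeasurableSet] at h

theorem volume_preimage_unchannel_le (Q : Discipline ℝ) {n : ℕ} {A : Fin n → ℝ}
    {B : Set (Fin n → ℝ)} (hA : ∀ i, 0 ≤ A i) (hB : MeasurableSet B) :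
    volume {y | Q.channel A (Q.unchannel A y) = y ∧
      (∀ i, 0 < Q.unchannel A y i) ∧ Q.unchannel A y ∈ B} ≤ volume B := by
  have hi := measurePreserving_interdepartures n
  have h := volume_preimage_recover_le Q (monotone_arrivalTimes hA) (arrivalTimes_nonneg hA) hB
  have hu : Measurable fun y : Fin n → ℝ => Q.unchannel A y :=
    Q.measurable_unchannel measurable_const measurable_id
  have hY : MeasurableSet {y | Q.channel A (Q.unchannel A y) = y ∧
      (∀ i, 0 < Q.unchannel A y i) ∧ Q.unchannel A y ∈ B} := by
    have h1 : MeasurableSet {y | Q.channel A (Q.unchannel A y) = y} :=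
      measurableSet_eq_fun (Q.measurable_channel measurable_const hu) measurable_id
    have h2 : MeasurableSet {y | ∀ i, 0 < Q.unchannel A y i} := by
      rw [Set.ofPred_forall]
      exact MeasurableSet.iInter fun i =>
        measurableSet_lt measurable_const ((measurable_pi_apply i).comp hu)
    exact h1.inter (h2.inter (hu hB))
  rw [← hi.measure_preimage hY.nullMeasurableSet]
  refine (measure_mono ?_).trans h
  rintro d ⟨h1, h2, h3⟩
  simp only [Discipline.unchannel, arrivalTimes_interdepartures_real] at h1 h2 h3
  refine ⟨?_, h2, h3⟩
  have := congrArg arrivalTimes h1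
  rwa [Discipline.channel, arrivalTimes_interdepartures_real,
    arrivalTimes_interdepartures_real] at this

/-- Lebesgue measure is a reference measure. -/
theorem isReference_volume : IsReference (volume : Measure ℝ) where
  departures_le Q _ _ _ _ _ henc hc hE hB :=
    volume_preimage_interdepartures_le Q henc hc hE hB
  recover_le Q _ _ _ hA hB := volume_preimage_unchannel_le Q hA hB

theorem pi_count (n : ℕ) : Measure.pi (fun _ : Fin n => (Measure.count : Measure ℕ)) =
    Measure.count := by
  refine Measure.ext_of_singleton fun x => ?_
  rw [Measure.pi_singleton]
  simp

theorem count_inter_preimage_le {X : Type*} [MeasurableSpace X] [Countable X]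
    [MeasurableSingletonClass X] {F : X → X} {E B : Set X} (hF : Set.InjOn F E) :
    Measure.count (E ∩ F ⁻¹' B) ≤ Measure.count B := by
  rw [Measure.count_apply (Set.to_countable _).measurableSet,
    Measure.count_apply (Set.to_countable _).measurableSet]
  exact_mod_cast Set.encard_le_encard_of_injOn (f := F)
    (fun x (hx : x ∈ E ∩ F ⁻¹' B) => hx.2) (hF.mono Set.inter_subset_left)

/-- For the counting measure both bounds say that a map is injective, which holds because the
service times can be recovered. -/
theorem isReference_count : IsReference (Measure.count : Measure ℕ) where
  departures_le Q n enc dep E B henc hc hE hB := by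
    rw [pi_count]
    refine count_inter_preimage_le (F := fun s => interdepartures (dep s)) ?_
    intro s hs s' hs' h
    obtain ⟨h1, h2⟩ := hE s hs
    obtain ⟨h1', h2'⟩ := hE s' hs'
    have hm : Monotone (dep s) := by rw [h2]; exact (Q.departures_strictMono h1).monotone
    have hm' : Monotone (dep s') := by rw [h2']; exact (Q.departures_strictMono h1').monotone
    have hd : dep s = dep s' := by
      rw [← arrivalTimes_interdepartures hm, ← arrivalTimes_interdepartures hm']
      exact congrArg arrivalTimes h
    have hr := Q.recover_departures h1
    have hr' := Q.recover_departures h1'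
    rw [← h2] at hr
    rw [← h2'] at hr'
    rw [← hr, ← hr', hd]
  recover_le Q n A B hA hB := by
    rw [pi_count]
    have : {y | Q.channel A (Q.unchannel A y) = y ∧ (∀ i, 0 < Q.unchannel A y i) ∧
        Q.unchannel A y ∈ B} = {y | Q.channel A (Q.unchannel A y) = y ∧
        ∀ i, 0 < Q.unchannel A y i} ∩ Q.unchannel A ⁻¹' B := by
      ext y
      simp [and_assoc]
    rw [this]
    refine count_inter_preimage_le ?_
    intro y hy y' hy' h
    rw [← hy.1, ← hy'.1, h]

/-! ### Densities -/

theorem lintegral_pi_prod {X : Type*} [MeasurableSpace X] (m : Measure X) [SigmaFinite m] {n : ℕ}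
    {f : Fin n → X → ℝ≥0∞} (hf : ∀ i, Measurable (f i)) :
    ∫⁻ x, ∏ i, f i (x i) ∂(Measure.pi fun _ : Fin n => m) = ∏ i, ∫⁻ x, f i x ∂m := by
  induction n with
  | zero => simp
  | succ n ih =>
    have he := (measurePreserving_piFinSuccAbove (fun _ : Fin (n + 1) => m) 0).symm
    rw [← he.lintegral_comp_emb (MeasurableEquiv.measurableEmbedding _)]
    simp only [MeasurableEquiv.piFinSuccAbove_symm_apply, Fin.insertNthEquiv_apply,
      Fin.insertNth_zero', Fin.prod_univ_succ, Fin.cons_zero, Fin.cons_succ]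
    rw [lintegral_prod_mul (f := f 0) (g := fun y : Fin n → X => ∏ i : Fin n, f i.succ (y i))
      (hf 0).aemeasurable (Finset.measurable_prod _ fun i _ =>
        (hf i.succ).comp (measurable_pi_apply i)).aemeasurable]
    rw [ih fun i => hf i.succ]

/-- `P` has the (real-valued) density `f` with respect to `m`. -/
structure IsDensity {X : Type*} [MeasurableSpace X] (m : Measure X) (f : X → ℝ)
    (P : Measure X) : Prop where
  measurable : Measurable f
  nonneg : ∀ x, 0 ≤ f x
  eq : P = m.withDensity fun x => ENNReal.ofReal (f x)

namespace IsDensity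

variable {X : Type*} [MeasurableSpace X] {m : Measure X} {f : X → ℝ} {P : Measure X}

theorem lintegral_eq (h : IsDensity m f P) {φ : X → ℝ≥0∞} (hφ : Measurable φ) :
    ∫⁻ x, φ x ∂P = ∫⁻ x, ENNReal.ofReal (f x) * φ x ∂m := by
  rw [h.eq, lintegral_withDensity_eq_lintegral_mul _ h.measurable.ennreal_ofReal hφ]
  rfl

theorem ae_pos (h : IsDensity m f P) : ∀ᵐ x ∂P, 0 < f x := by
  rw [h.eq, ae_withDensity_iff h.measurable.ennreal_ofReal]
  exact ae_of_all _ fun x hx => ENNReal.ofReal_pos.1 (pos_iff_ne_zero.2 hx)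

theorem lintegral_ofReal (h : IsDensity m f P) [IsProbabilityMeasure P] :
    ∫⁻ x, ENNReal.ofReal (f x) ∂m = 1 := by
  have := h.lintegral_eq (φ := fun _ => 1) measurable_const
  simpa using this.symm

theorem pi [SigmaFinite m] [SigmaFinite P] (h : IsDensity m f P) (n : ℕ) :
    IsDensity (Measure.pi fun _ : Fin n => m) (fun x => ∏ i, f (x i))
      (Measure.pi fun _ : Fin n => P) where
  measurable := Finset.measurable_prod _ fun i _ => h.measurable.comp (measurable_pi_apply i)
  nonneg x := Finset.prod_nonneg fun i _ => h.nonneg _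
  eq := by
    refine Measure.pi_eq fun s hs => ?_
    rw [withDensity_apply _ (MeasurableSet.univ_pi hs), ← lintegral_indicator
      (MeasurableSet.univ_pi hs)]
    have : ∀ x : Fin n → X, (Set.univ.pi s).indicator
        (fun x => ENNReal.ofReal (∏ i, f (x i))) x =
        ∏ i, (s i).indicator (fun x => ENNReal.ofReal (f x)) (x i) := by
      intro x
      by_cases hx : x ∈ Set.univ.pi s
      · rw [Set.indicator_of_mem hx, ENNReal.ofReal_prod_of_nonneg fun i _ => h.nonneg _]
        refine Finset.prod_congr rfl fun i _ => ?_
        rw [Set.indicator_of_mem (hx i (Set.mem_univ i))]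
      · rw [Set.indicator_of_notMem hx]
        simp only [Set.mem_pi, Set.mem_univ, true_imp_iff, not_forall] at hx
        obtain ⟨i, hi⟩ := hx
        exact (Finset.prod_eq_zero (Finset.mem_univ i) (Set.indicator_of_notMem hi _)).symm
    simp only [this]
    rw [lintegral_pi_prod m fun i => h.measurable.ennreal_ofReal.indicator (hs i)]
    refine Finset.prod_congr rfl fun i _ => ?_
    rw [lintegral_indicator (hs i), h.eq, withDensity_apply _ (hs i)]

end IsDensity

theorem ae_pi_of_ae {X : Type*} [MeasurableSpace X] {P : Measure X} [IsProbabilityMeasure P]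
    {p : X → Prop} (h : ∀ᵐ x ∂P, p x) (n : ℕ) :
    ∀ᵐ x ∂(Measure.pi fun _ : Fin n => P), ∀ i, p (x i) := by
  rw [ae_all_iff]
  intro i
  exact (measurePreserving_eval (fun _ : Fin n => P) i).quasiMeasurePreserving.ae h

theorem integrable_sum_pi {X : Type*} [MeasurableSpace X] {P : Measure X} [IsProbabilityMeasure P]
    {φ : X → ℝ} (h : Integrable φ P) (n : ℕ) :
    Integrable (fun x => ∑ i, φ (x i)) (Measure.pi fun _ : Fin n => P) :=
  integrable_finsetSum _ fun i _ => integrable_comp_eval (μ := fun _ : Fin n => P) (i := i) h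

theorem integral_sum_pi {X : Type*} [MeasurableSpace X] {P : Measure X} [IsProbabilityMeasure P]
    {φ : X → ℝ} (h : Integrable φ P) (n : ℕ) :
    ∫ x, ∑ i, φ (x i) ∂(Measure.pi fun _ : Fin n => P) = n * ∫ x, φ x ∂P := by
  rw [integral_finsetSum _ fun i _ => integrable_comp_eval (μ := fun _ : Fin n => P) (i := i) h]
  have : ∀ i : Fin n, ∫ x, φ (x i) ∂(Measure.pi fun _ : Fin n => P) = ∫ x, φ x ∂P := fun i => by
    have h1 := measurePreserving_eval (fun _ : Fin n => P) i
    have h2 := integral_map (μ := Measure.pi fun _ : Fin n => P) (φ := Function.eval i)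
      h1.measurable.aemeasurable (f := φ) (by rw [h1.map_eq]; exact h.aestronglyMeasurable)
    rw [h1.map_eq] at h2
    exact h2.symm
  simp [this]

/-- `ι` reads a time as a real number: the inclusion of `ℕ` or the identity of `ℝ`. -/
structure IsClock {T : Type} [LinearOrder T] [AddCommMonoid T] [MeasurableSpace T]
    (ι : T → ℝ) : Prop where
  zero : ι 0 = 0
  add : ∀ x y, ι (x + y) = ι x + ι y
  strictMono : StrictMono ι
  measurable : Measurable ι

theorem IsClock.sum {T : Type} [LinearOrder T] [AddCommMonoid T] [MeasurableSpace T] {ι : T → ℝ}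
    (h : IsClock ι) {κ : Type*} (s : Finset κ) (x : κ → T) :
    ι (∑ i ∈ s, x i) = ∑ i ∈ s, ι (x i) :=
  map_sum (⟨⟨ι, h.zero⟩, h.add⟩ : T →+ ℝ) x s

/-- A (sub-)probability density `g` on positive times whose logarithm is an affine function of
time, namely `c₀ - c₁ t`, as it is the case for geometric and exponential densities. -/
structure IsLogAffine {T : Type} [LinearOrder T] [AddCommMonoid T] [MeasurableSpace T]
    (m : Measure T) (ι : T → ℝ) (g : T → ℝ) (c₀ c₁ : ℝ) : Prop where
  measurable : Measurable g
  nonneg : ∀ x, 0 ≤ g x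
  lintegral_le : ∫⁻ x, ENNReal.ofReal (g x) ∂m ≤ 1
  pos : ∀ x, 0 < x → 0 < g x
  log_eq : ∀ x, 0 < x → Real.log (g x) = c₀ - c₁ * ι x

theorem IsLogAffine.log_prod {T : Type} [LinearOrder T] [AddCommMonoid T] [MeasurableSpace T]
    {m : Measure T} {ι g : T → ℝ} {c₀ c₁ : ℝ} (h : IsLogAffine m ι g c₀ c₁) (hι : IsClock ι)
    {n : ℕ} {y : Fin n → T} (hy : ∀ i, 0 < y i) :
    0 < ∏ i, g (y i) ∧ Real.log (∏ i, g (y i)) = n * c₀ - c₁ * ι (∑ i, y i) := by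
  refine ⟨Finset.prod_pos fun i _ => h.pos _ (hy i), ?_⟩
  rw [Real.log_prod fun i _ => (h.pos _ (hy i)).ne', hι.sum, Finset.mul_sum]
  simp only [h.log_eq _ (hy _), Finset.sum_sub_distrib]
  simp

/-- The tangent line to the logarithm at `2`.  The test functions in the converse have mean mass at
most `2` per message, so that this tangent costs no more than `log 2`. -/
theorem log_le_half (x : ℝ) (hx : 0 < x) : Real.log x ≤ x / 2 - 1 + Real.log 2 := by
  have := Real.log_le_sub_one_of_pos (x := x / 2) (by positivity)
  rw [Real.log_div hx.ne' two_ne_zero] at this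
  linarith

/-! ### The converse -/

section Converse

variable {T : Type} [LinearOrder T] [AddCommMonoid T] [Sub T] [MeasurableSpace T]
  [IsOrderedCancelAddMonoid T] [OrderedSub T] [ExistsAddOfLE T]
  [TopologicalSpace T] [OrderClosedTopology T] [SecondCountableTopology T] [BorelSpace T]
  [MeasurableAdd₂ T] [MeasurableSub₂ T]
  {m : Measure T} [SigmaFinite m] {ν : Measure T} [IsProbabilityMeasure ν] {ι f g : T → ℝ}
  {c₀ c₁ : ℝ}

/-- Change of measure for one message: `p` is any test function of the interdepartures. -/
theorem lintegral_div_density_le (hm : IsReference m) (hf : IsDensity m f ν) (Q : Discipline T)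
    {n : ℕ} {enc dep : (Fin n → T) → Fin n → T} (henc : Measurable enc) (hdep : Measurable dep)
    (hc : Causal enc)
    (hE : ∀ᵐ s ∂(Measure.pi fun _ : Fin n => ν), IsInput n (extendZero (enc (dep s)))
      (extendZero s) ∧ dep s = Q.departures (enc (dep s)) s)
    {p : (Fin n → T) → ℝ} (hp : Measurable p) (hp0 : ∀ y, 0 ≤ p y) :
    ∫⁻ s, ENNReal.ofReal (p (interdepartures (dep s)) / ∏ i, f (s i))
      ∂(Measure.pi fun _ : Fin n => ν) ≤
    ∫⁻ y, ENNReal.ofReal (p y) ∂(Measure.pi fun _ : Fin n => m) := by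
  set π := Measure.pi fun _ : Fin n => ν
  have hF := hf.pi n
  obtain ⟨E, hEmem, hEmeas, hEprop⟩ : ∃ E : Set (Fin n → T), E ∈ ae π ∧ MeasurableSet E ∧
      ∀ s ∈ E, IsInput n (extendZero (enc (dep s))) (extendZero s) ∧
        dep s = Q.departures (enc (dep s)) s := by
    have h0 := (measure_toMeasurable _).trans (ae_iff.1 hE)
    refine ⟨_, compl_mem_ae_iff.2 h0, (measurableSet_toMeasurable _ _).compl, fun s hs => ?_⟩
    by_contra hcon
    exact hs (subset_toMeasurable _ _ hcon)
  have hG : Measurable fun s => interdepartures (dep s) :=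
    (measurable_interdepartures n).comp hdep
  have hmap : (((Measure.pi fun _ : Fin n => m).restrict E).map fun s => interdepartures (dep s)) ≤
      Measure.pi fun _ : Fin n => m := by
    refine Measure.le_iff.2 fun B hB => ?_
    rw [Measure.map_apply hG hB, Measure.restrict_apply (hG hB), Set.inter_comm]
    exact hm.departures_le Q n enc dep E B henc hc hEprop hB
  have hmeas : Measurable fun s => ENNReal.ofReal (p (interdepartures (dep s)) / ∏ i, f (s i)) :=
    ((hp.comp hG).div hF.measurable).ennreal_ofReal
  calc ∫⁻ s, ENNReal.ofReal (p (interdepartures (dep s)) / ∏ i, f (s i)) ∂π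
      = ∫⁻ s, E.indicator (fun s => ENNReal.ofReal
          (p (interdepartures (dep s)) / ∏ i, f (s i))) s ∂π := by
        refine lintegral_congr_ae ?_
        filter_upwards [hEmem] with s hs
        rw [Set.indicator_of_mem hs]
    _ = ∫⁻ s, ENNReal.ofReal (∏ i, f (s i)) * E.indicator (fun s => ENNReal.ofReal
          (p (interdepartures (dep s)) / ∏ i, f (s i))) s ∂(Measure.pi fun _ : Fin n => m) :=
        hF.lintegral_eq (hmeas.indicator hEmeas)
    _ ≤ ∫⁻ s, E.indicator (fun s => ENNReal.ofReal (p (interdepartures (dep s)))) s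
          ∂(Measure.pi fun _ : Fin n => m) := by
        refine lintegral_mono fun s => ?_
        by_cases hs : s ∈ E
        · simp only [Set.indicator_of_mem hs]
          rw [← ENNReal.ofReal_mul (hF.nonneg s)]
          refine ENNReal.ofReal_le_ofReal ?_
          rcases (hF.nonneg s).eq_or_lt with h0 | h0
          · rw [← h0, zero_mul]; exact hp0 _
          · rw [mul_div_cancel₀ _ h0.ne']
        · simp [hs]
    _ = ∫⁻ y, ENNReal.ofReal (p y)
          ∂(((Measure.pi fun _ : Fin n => m).restrict E).map fun s => interdepartures (dep s)) := by
        rw [lintegral_indicator hEmeas, lintegral_map hp.ennreal_ofReal hG]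
    _ ≤ _ := lintegral_mono' hmap le_rfl

/-- The converse for one code: the information about the message is bounded with the help of the
auxiliary output law under which the interdepartures are i.i.d. with density `g`. -/
theorem log_card_le_of_hasFeedbackCode (hm : IsReference m) (hι : IsClock ι)
    (hf : IsDensity m f ν) (hlog : Integrable (fun x => Real.log (f x)) ν)
    (hpos : ∀ᵐ x ∂ν, 0 < x) (hg : IsLogAffine m ι g c₀ c₁) (hc₁ : 0 ≤ c₁) {Q : Discipline T}
    {n M : ℕ} {τ ε : ℝ} (hτ : 0 ≤ τ) (hcode : Q.HasFeedbackCode ν ι n M τ ε) :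
    (1 - ε) * Real.log M ≤ n * (∫ x, Real.log (f x) ∂ν) - n * c₀ + c₁ * τ + Real.log 2 := by
  obtain ⟨hM, enc, dep, dec, henc, hdep, hdec, hcaus, hloop, hcost, herr⟩ := hcode
  set π := Measure.pi fun _ : Fin n => ν with hπ
  have hM1 : (1 : ℝ) ≤ M := by exact_mod_cast hM
  have hM0 : (0 : ℝ) < M := by linarith
  have hin : ∀ u, ∀ᵐ s ∂π, IsInput n (extendZero (enc u (dep u s))) (extendZero s) ∧
      dep u s = Q.departures (enc u (dep u s)) s := by
    intro u
    filter_upwards [hloop u, ae_pi_of_ae hpos n] with s h1 h2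
    exact ⟨isInput_extendZero h1.1 h1.2.1 h2, h1.2.2⟩
  set q : (Fin n → T) → ℝ := fun y => ∏ i, g (y i)
  have hq : Measurable q :=
    Finset.measurable_prod _ fun i _ => hg.measurable.comp (measurable_pi_apply i)
  have hq0 : ∀ y, 0 ≤ q y := fun y => Finset.prod_nonneg fun i _ => hg.nonneg _
  set w : Fin M → (Fin n → T) → ℝ := fun u d => if dec d = u then (M : ℝ) else 1
  have hw : ∀ u, Measurable (w u) := fun u =>
    Measurable.ite (hdec (measurableSet_singleton u)) measurable_const measurable_const
  have hw1 : ∀ u d, 1 ≤ w u d := by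
    intro u d; simp only [w]; split_ifs <;> simp [hM1]
  set p : Fin M → (Fin n → T) → ℝ := fun u y => w u (arrivalTimes y) * q y
  have hp : ∀ u, Measurable (p u) := fun u => ((hw u).comp (measurable_arrivalTimes n)).mul hq
  have hp0 : ∀ u y, 0 ≤ p u y := fun u y => mul_nonneg (zero_le_one.trans (hw1 _ _)) (hq0 y)
  set Z : Fin M → ℝ≥0∞ := fun u => ∫⁻ y, ENNReal.ofReal (p u y) ∂(Measure.pi fun _ : Fin n => m)
  -- a decoder is right for one message at most, so the test functions have total mass at most `2 M`
  have hZsum : ∑ u, Z u ≤ ENNReal.ofReal (2 * M) := by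
    simp only [Z]
    rw [← lintegral_finsetSum _ fun u _ => (hp u).ennreal_ofReal]
    calc ∫⁻ y, ∑ u, ENNReal.ofReal (p u y) ∂(Measure.pi fun _ : Fin n => m)
        ≤ ∫⁻ y, ENNReal.ofReal (2 * M) * ∏ i, ENNReal.ofReal (g (y i))
            ∂(Measure.pi fun _ : Fin n => m) := by
          refine lintegral_mono fun y => ?_
          rw [← ENNReal.ofReal_sum_of_nonneg fun u _ => hp0 u y,
            ← ENNReal.ofReal_prod_of_nonneg fun i _ => hg.nonneg _,
            ← ENNReal.ofReal_mul (by positivity)]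
          refine ENNReal.ofReal_le_ofReal ?_
          simp only [p, ← Finset.sum_mul]
          refine mul_le_mul_of_nonneg_right ?_ (hq0 y)
          calc ∑ u, w u (arrivalTimes y)
              ≤ ∑ u, ((if dec (arrivalTimes y) = u then (M : ℝ) else 0) + 1) := by
                refine Finset.sum_le_sum fun u _ => ?_
                simp only [w]; split_ifs <;> simp
            _ = 2 * M := by
                rw [Finset.sum_add_distrib]; simp; ring
      _ ≤ ENNReal.ofReal (2 * M) * 1 := by
          have hgm : Measurable fun y : Fin n → T => ∏ i, ENNReal.ofReal (g (y i)) :=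
            Finset.measurable_prod _ fun i _ =>
              (hg.measurable.comp (measurable_pi_apply i)).ennreal_ofReal
          rw [lintegral_const_mul _ hgm]
          refine mul_le_mul_right ?_ _
          rw [lintegral_pi_prod m fun i => hg.measurable.ennreal_ofReal]
          exact Finset.prod_le_one' fun i _ => hg.lintegral_le
      _ = _ := mul_one _
  have hZtop : ∀ u, Z u ≠ ∞ := by
    intro u
    refine ne_top_of_le_ne_top ENNReal.ofReal_ne_top
      ((Finset.single_le_sum (f := Z) (fun _ _ => zero_le) (Finset.mem_univ u)).trans hZsum)
  set L : Fin M → ℝ≥0∞ := fun u => ∫⁻ s, ENNReal.ofReal (ι (lastTime (dep u s))) ∂π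
  have hLsum : ∑ u, L u ≤ ENNReal.ofReal (τ * M) := by
    rw [ENNReal.ofReal_mul hτ, ENNReal.ofReal_natCast]
    exact (ENNReal.div_le_iff (by simp; omega) (by simp)).1 hcost
  have hLtop : ∀ u, L u ≠ ∞ := by
    intro u
    refine ne_top_of_le_ne_top ENNReal.ofReal_ne_top
      ((Finset.single_le_sum (f := L) (fun _ _ => zero_le) (Finset.mem_univ u)).trans hLsum)
  have hF := hf.pi n
  -- the bound for one message
  have hmain : ∀ u, (1 - π.real {s | dec (dep u s) ≠ u}) * Real.log M + n * c₀ -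
      c₁ * (L u).toReal - n * (∫ x, Real.log (f x) ∂ν) ≤ (Z u).toReal / 2 - 1 + Real.log 2 := by
    intro u
    set ψ : (Fin n → T) → ℝ := fun s => p u (interdepartures (dep u s)) / ∏ i, f (s i) with hψ
    have hψm : Measurable ψ :=
      ((hp u).comp ((measurable_interdepartures n).comp (hdep u))).div hF.measurable
    have hψ0 : ∀ s, 0 ≤ ψ s := fun s => div_nonneg (hp0 _ _) (hF.nonneg s)
    have hψle : ∫⁻ s, ENNReal.ofReal (ψ s) ∂π ≤ Z u :=
      lintegral_div_density_le hm hf Q (henc u) (hdep u) (fun i d d' h => hcaus u i d d' h)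
        (hin u) (hp u) (hp0 u)
    have hψint : Integrable ψ π := by
      refine ⟨hψm.aestronglyMeasurable, ?_⟩
      rw [hasFiniteIntegral_iff_ofReal (ae_of_all _ hψ0)]
      exact hψle.trans_lt (hZtop u).lt_top
    have hψZ : ∫ s, ψ s ∂π ≤ (Z u).toReal := by
      rw [integral_eq_lintegral_of_nonneg_ae (ae_of_all _ hψ0) hψm.aestronglyMeasurable]
      exact ENNReal.toReal_mono (hZtop u) hψle
    have htm : Measurable fun s => ι (lastTime (dep u s)) :=
      hι.measurable.comp ((measurable_lastTime n).comp (hdep u))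
    have ht0 : ∀ᵐ s ∂π, 0 ≤ ι (lastTime (dep u s)) := by
      filter_upwards [hin u] with s hs
      rw [← hι.zero]
      refine hι.strictMono.monotone ?_
      unfold lastTime
      split_ifs
      · rw [hs.2]
        exact (Q.departures_pos hs.1 _).le
      · exact le_rfl
    have htint : Integrable (fun s => ι (lastTime (dep u s))) π := by
      refine ⟨htm.aestronglyMeasurable, ?_⟩
      rw [hasFiniteIntegral_iff_ofReal ht0]
      exact (hLtop u).lt_top
    have htL : ∫ s, ι (lastTime (dep u s)) ∂π = (L u).toReal :=
      integral_eq_lintegral_of_nonneg_ae ht0 htm.aestronglyMeasurable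
    have hset : MeasurableSet {s | dec (dep u s) = u} :=
      (hdec.comp (hdep u)) (measurableSet_singleton u)
    have hwint : Integrable ({s | dec (dep u s) = u}.indicator fun _ => Real.log M) π :=
      (integrable_const _).indicator hset
    have hle : ∀ᵐ s ∂π, {s | dec (dep u s) = u}.indicator (fun _ => Real.log M) s + n * c₀ -
        c₁ * ι (lastTime (dep u s)) - ∑ i, Real.log (f (s i)) ≤ ψ s / 2 - 1 + Real.log 2 := by
      filter_upwards [hin u, ae_pi_of_ae hf.ae_pos n] with s hs hfs
      have hmono : Monotone (dep u s) := by
        rw [hs.2]; exact (Q.departures_strictMono hs.1).monotone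
      have hD : ∀ i, 0 < interdepartures (dep u s) i := by
        intro i
        rw [hs.2]; exact Q.interdepartures_pos hs.1 i
      obtain ⟨hq1, hq2⟩ := hg.log_prod hι hD
      have hFs : 0 < ∏ i, f (s i) := Finset.prod_pos fun i _ => hfs i
      have hw2 := hw1 u (dep u s)
      have hψeq : ψ s = w u (dep u s) * q (interdepartures (dep u s)) / ∏ i, f (s i) := by
        simp only [hψ, p, arrivalTimes_interdepartures hmono]
      have hψpos : 0 < ψ s := by
        rw [hψeq]
        exact div_pos (mul_pos (by linarith) hq1) hFs
      have hlogw : Real.log (w u (dep u s)) =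
          {s | dec (dep u s) = u}.indicator (fun _ => Real.log M) s := by
        simp only [w, Set.indicator, Set.mem_ofPred_eq]
        split_ifs <;> simp
      refine le_trans (le_of_eq ?_) (log_le_half _ hψpos)
      rw [hψeq, Real.log_div (mul_pos (by linarith) hq1).ne' hFs.ne',
        Real.log_mul (by linarith) hq1.ne', hlogw, hq2, lastTime_eq_sum_interdepartures hmono,
        Real.log_prod fun i _ => (hfs i).ne']
      ring
    have hi1 : Integrable (fun s => {s | dec (dep u s) = u}.indicator (fun _ => Real.log M) s +
        n * c₀) π := hwint.add (integrable_const _)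
    have hi2 : Integrable (fun s => {s | dec (dep u s) = u}.indicator (fun _ => Real.log M) s +
        n * c₀ - c₁ * ι (lastTime (dep u s))) π := hi1.sub (htint.const_mul _)
    have hi3 : Integrable (fun s => ψ s / 2 - 1) π := (hψint.div_const 2).sub (integrable_const _)
    have hint : ∫ s, ({s | dec (dep u s) = u}.indicator (fun _ => Real.log M) s + n * c₀ -
        c₁ * ι (lastTime (dep u s)) - ∑ i, Real.log (f (s i))) ∂π =
        (1 - π.real {s | dec (dep u s) ≠ u}) * Real.log M + n * c₀ -
          c₁ * (L u).toReal - n * (∫ x, Real.log (f x) ∂ν) := by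
      rw [integral_sub hi2 (integrable_sum_pi hlog n), integral_sum_pi hlog n,
        integral_sub hi1 (htint.const_mul _), integral_const_mul, htL,
        integral_add hwint (integrable_const _), integral_indicator hset]
      have h1 : π.real {s | dec (dep u s) = u} = 1 - π.real {s | dec (dep u s) ≠ u} := by
        have := probReal_compl_eq_one_sub (μ := π) hset
        have h2 : {s | dec (dep u s) = u}ᶜ = {s | dec (dep u s) ≠ u} := rfl
        rw [h2] at this
        linarith
      simp [h1]
    rw [← hint]
    refine (integral_mono_ae (hi2.sub (integrable_sum_pi hlog n))
      (hi3.add (integrable_const _)) hle).trans ?_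
    rw [integral_add' hi3 (integrable_const _), integral_sub (hψint.div_const 2)
      (integrable_const _), integral_div]
    simp only [integral_const, probReal_univ, smul_eq_mul, one_mul]
    linarith
  have hsum := Finset.sum_le_sum fun u (_ : u ∈ Finset.univ) => hmain u
  have hZr : ∑ u, (Z u).toReal ≤ 2 * M := by
    rw [← ENNReal.toReal_sum fun u _ => hZtop u]
    exact ENNReal.toReal_le_of_le_ofReal (by positivity) hZsum
  have hLr : ∑ u, (L u).toReal ≤ τ * M := by
    rw [← ENNReal.toReal_sum fun u _ => hLtop u]
    exact ENNReal.toReal_le_of_le_ofReal (by positivity) hLsum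
  have herr' : ∑ u, π.real {s | dec (dep u s) ≠ u} ≤ ε * M := (div_le_iff₀ hM0).1 herr
  have hlogM : 0 ≤ Real.log M := Real.log_nonneg hM1
  simp only [Finset.sum_sub_distrib, Finset.sum_add_distrib, ← Finset.sum_mul, ← Finset.mul_sum,
    ← Finset.sum_div, Finset.sum_const, Finset.card_univ, Fintype.card_fin, nsmul_eq_mul,
    mul_one] at hsum
  have h1 := mul_le_mul_of_nonneg_right herr' hlogM
  have h2 := mul_le_mul_of_nonneg_left hLr hc₁
  refine le_of_mul_le_mul_left ?_ hM0
  nlinarith [hsum, h1, h2, hZr]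

end Converse

/-! ### Capacity and achievable rates -/

section Capacity

variable {T : Type} [LinearOrder T] [AddCommMonoid T] [Sub T] [MeasurableSpace T]
  [IsOrderedCancelAddMonoid T] [OrderedSub T] [ExistsAddOfLE T]
  [TopologicalSpace T] [OrderClosedTopology T] [SecondCountableTopology T] [BorelSpace T]
  [MeasurableAdd₂ T] [MeasurableSub₂ T]
  {m : Measure T} [SigmaFinite m] {ν : Measure T} [IsProbabilityMeasure ν] {ι f g : T → ℝ}
  {c₀ c₁ : ℝ}

/-- The converse: no feedback code has a rate above that of the auxiliary output law. -/
theorem le_of_achievable_feedback (hm : IsReference m) (hι : IsClock ι)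
    (hf : IsDensity m f ν) (hlog : Integrable (fun x => Real.log (f x)) ν)
    (hpos : ∀ᵐ x ∂ν, 0 < x) (hg : IsLogAffine m ι g c₀ c₁) (hc₁ : 0 ≤ c₁) {Q : Discipline T}
    {lam R : ℝ} (hlam : 0 < lam) (hR : Achievable (Q.HasFeedbackCode ν ι) lam R) :
    R * Real.log 2 ≤ lam * ((∫ x, Real.log (f x) ∂ν) - c₀ + c₁ / lam) := by
  set J := (∫ x, Real.log (f x) ∂ν) - c₀ + c₁ / lam with hJ
  have hlog2 : 0 < Real.log 2 := Real.log_pos one_lt_two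
  have key : ∀ γ : ℝ, 0 < γ → (R - γ) * Real.log 2 / lam ≤ J := by
    intro γ hγ
    obtain ⟨M, ε, hε, hev⟩ := hR γ hγ
    have hlim1 : Tendsto (fun n : ℕ => (1 - ε n) * ((R - γ) * Real.log 2 / lam)) atTop
        (𝓝 ((1 - 0) * ((R - γ) * Real.log 2 / lam))) := (hε.const_sub 1).mul_const _
    have hlim2 : Tendsto (fun n : ℕ => J + Real.log 2 / (n : ℝ)) atTop (𝓝 (J + 0)) :=
      (tendsto_const_div_atTop_nhds_zero_nat _).const_add _
    rw [sub_zero, one_mul] at hlim1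
    rw [add_zero] at hlim2
    refine le_of_tendsto_of_tendsto hlim1 hlim2 ?_
    filter_upwards [hev, eventually_gt_atTop 0, hε.eventually (gt_mem_nhds one_pos)] with
      n ⟨hcode, hrate⟩ hn hεn
    have hn' : (0 : ℝ) < n := by exact_mod_cast hn
    have h1 := log_card_le_of_hasFeedbackCode hm hι hf hlog hpos hg hc₁ (by positivity) hcode
    have h2 : (n : ℝ) * ((R - γ) * Real.log 2 / lam) ≤ Real.log (M n) := by
      have : (R - γ) * Real.log 2 / lam * n * lam ≤ Real.log (M n) * lam := by
        have h3 : lam * (Real.logb 2 (M n) / n) * (n * Real.log 2) = Real.log (M n) * lam := by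
          rw [Real.logb]; field_simp
        have h4 : (R - γ) * Real.log 2 / lam * n * lam = (R - γ) * (n * Real.log 2) := by
          field_simp
        rw [← h3, h4]
        exact mul_le_mul_of_nonneg_right hrate.le (by positivity)
      have := le_of_mul_le_mul_right this hlam
      linarith
    have h3 := mul_le_mul_of_nonneg_left h2 (sub_nonneg.2 hεn.le)
    have h4 : (n : ℝ) * ((1 - ε n) * ((R - γ) * Real.log 2 / lam)) ≤
        n * (J + Real.log 2 / n) := by
      have : (n : ℝ) * (J + Real.log 2 / n) = n * J + Real.log 2 := by field_simp
      rw [this, hJ]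
      have h5 : (n : ℝ) * ((∫ x, Real.log (f x) ∂ν) - c₀ + c₁ / lam) =
        n * (∫ x, Real.log (f x) ∂ν) - n * c₀ + c₁ * (n / lam) := by ring
      rw [h5]
      linarith
    exact le_of_mul_le_mul_left h4 hn'
  have h1 : R * Real.log 2 / lam ≤ J := by
    refine le_of_forall_pos_le_add fun δ hδ => ?_
    have := key (δ * lam / Real.log 2) (by positivity)
    have h2 : (R - δ * lam / Real.log 2) * Real.log 2 / lam = R * Real.log 2 / lam - δ := by
      field_simp
    linarith
  rw [div_le_iff₀ hlam] at h1
  rwa [mul_comm lam]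

theorem hasFeedbackCode_of_hasCode {Q : Discipline T} {n M : ℕ} {τ ε : ℝ}
    (h : Q.HasCode ν ι n M τ ε) : Q.HasFeedbackCode ν ι n M τ ε := by
  obtain ⟨hM, enc, dec, hmono, h0, hdec, hcost, herr⟩ := h
  exact ⟨hM, fun u _ => enc u, fun u s => Q.departures (enc u) s, dec, fun _ => measurable_const,
    fun u => Q.measurable_departures measurable_const measurable_id, hdec, fun _ _ _ _ _ => rfl,
    fun u => ae_of_all _ fun s => ⟨hmono u, h0 u, rfl⟩, hcost, herr⟩

theorem Achievable.mono_code {C C' : ℕ → ℕ → ℝ → ℝ → Prop} (h : ∀ n M τ ε, C n M τ ε → C' n M τ ε)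
    {lam R : ℝ} (hR : Achievable C lam R) : Achievable C' lam R := by
  intro γ hγ
  obtain ⟨M, ε, hε, hev⟩ := hR γ hγ
  exact ⟨M, ε, hε, hev.mono fun n hn => ⟨h _ _ _ _ hn.1, hn.2⟩⟩

theorem capacity_le_feedbackCapacity (Q : Discipline T) (lam : ℝ) :
    Q.capacity ν ι lam ≤ Q.feedbackCapacity ν ι lam := by
  refine sSup_le_sSup (Set.image_mono fun R hR => ?_)
  exact Achievable.mono_code (C := Q.HasCode ν ι) (C' := Q.HasFeedbackCode ν ι)
    (fun n M τ ε h => hasFeedbackCode_of_hasCode h) hR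

theorem feedbackCapacity_le (hm : IsReference m) (hι : IsClock ι)
    (hf : IsDensity m f ν) (hlog : Integrable (fun x => Real.log (f x)) ν)
    (hpos : ∀ᵐ x ∂ν, 0 < x) (hg : IsLogAffine m ι g c₀ c₁) (hc₁ : 0 ≤ c₁) (Q : Discipline T)
    {lam : ℝ} (hlam : 0 < lam) :
    Q.feedbackCapacity ν ι lam ≤
      ((lam * ((∫ x, Real.log (f x) ∂ν) - c₀ + c₁ / lam) / Real.log 2 : ℝ) : EReal) := by
  refine sSup_le ?_
  rintro _ ⟨R, hR, rfl⟩
  have := le_of_achievable_feedback hm hι hf hlog hpos hg hc₁ hlam hR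
  exact EReal.coe_le_coe_iff.2 ((le_div_iff₀ (Real.log_pos one_lt_two)).2 this)

theorem completion_zero_left (s : ℕ → T) (hs : ∀ i, 0 ≤ s i) (n : ℕ) :
    completion (fun _ => 0) s n = ∑ i ∈ Finset.range n, s i := by
  induction n with
  | zero => rfl
  | succ n ih =>
    rw [completion, ih, Finset.sum_range_succ, max_eq_left (Finset.sum_nonneg fun i _ => hs i)]

theorem completion_congr {a a' s s' : ℕ → T} {n : ℕ} (ha : ∀ i < n, a i = a' i)
    (hs : ∀ i < n, s i = s' i) : completion a s n = completion a' s' n := by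
  induction n with
  | zero => rfl
  | succ n ih =>
    rw [completion, completion, ih (fun i hi => ha i (by omega)) (fun i hi => hs i (by omega)),
      ha n (by omega), hs n (by omega)]

/-- The rate `0` is achievable at output rates up to `μ`: all packets are sent at time `0`. -/
theorem achievable_zero (hι : IsClock ι) (hpos : ∀ᵐ x ∂ν, 0 < x) {μ : ℝ}
    (hμ : ∫⁻ x, ENNReal.ofReal (ι x) ∂ν = ENNReal.ofReal (1 / μ)) (Q : Discipline T)
    {lam : ℝ} (hlam : 0 < lam) (hle : lam ≤ μ) : Achievable (Q.HasCode ν ι) lam 0 := by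
  intro γ hγ
  refine ⟨fun _ => 1, fun _ => 0, tendsto_const_nhds, Eventually.of_forall fun n => ⟨?_, ?_⟩⟩
  · refine ⟨one_pos, fun _ _ => 0, fun _ => 0, fun _ _ _ _ => le_rfl, fun _ _ => le_rfl,
      measurable_const, ?_, ?_⟩
    · simp only [Finset.univ_unique, Finset.sum_singleton, Nat.cast_one, div_one]
      have hlast : ∫⁻ s, ENNReal.ofReal (ι (lastTime (Q.departures (fun _ : Fin n => (0 : T)) s)))
          ∂(Measure.pi fun _ : Fin n => ν) =
          ∫⁻ s, ∑ i, ENNReal.ofReal (ι (s i)) ∂(Measure.pi fun _ : Fin n => ν) := by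
        refine lintegral_congr_ae ?_
        filter_upwards [ae_pi_of_ae hpos n] with s hs
        have hin : IsInput n (extendZero fun _ : Fin n => (0 : T)) (extendZero s) :=
          isInput_extendZero (fun _ _ _ => le_rfl) (fun _ => le_rfl) hs
        have h1 : ∀ i, 0 ≤ extendZero s i := by
          intro i
          unfold extendZero
          split_ifs
          · exact (hs _).le
          · exact le_rfl
        have h2 : extendZero (fun _ : Fin n => (0 : T)) = fun _ => 0 := by
          ext i; unfold extendZero; split_ifs <;> rfl
        rw [Q.lastTime_departures hin, h2, completion_zero_left _ h1, Finset.sum_range, hι.sum]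
        simp only [extendZero_fin]
        refine ENNReal.ofReal_sum_of_nonneg fun i _ => ?_
        rw [← hι.zero]
        exact hι.strictMono.monotone (hs i).le
      have hm : ∀ i : Fin n, Measurable fun s : Fin n → T => ENNReal.ofReal (ι (s i)) := fun i =>
        (hι.measurable.comp (measurable_pi_apply i)).ennreal_ofReal
      rw [hlast, lintegral_finsetSum _ fun i _ => hm i]
      have h3 : ∀ i : Fin n, ∫⁻ s, ENNReal.ofReal (ι (s i)) ∂(Measure.pi fun _ : Fin n => ν) =
          ENNReal.ofReal (1 / μ) := by
        intro i
        rw [← hμ]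
        exact (measurePreserving_eval (fun _ : Fin n => ν) i).lintegral_comp
          hι.measurable.ennreal_ofReal
      simp only [h3, Finset.sum_const, Finset.card_univ, Fintype.card_fin, nsmul_eq_mul]
      rw [← ENNReal.ofReal_natCast, ← ENNReal.ofReal_mul (by positivity)]
      refine ENNReal.ofReal_le_ofReal ?_
      rw [mul_one_div]
      exact div_le_div_of_nonneg_left (by positivity) hlam hle
    · simp
  · simpa using hγ

theorem Achievable.mono {C : ℕ → ℕ → ℝ → ℝ → Prop} {lam R R' : ℝ} (h : Achievable C lam R)
    (hR : R' ≤ R) : Achievable C lam R' := by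
  intro γ hγ
  obtain ⟨M, ε, hε, hev⟩ := h γ hγ
  exact ⟨M, ε, hε, hev.mono fun n hn => ⟨hn.1, by linarith [hn.2]⟩⟩

end Capacity

/-! ### The law of large numbers in mean -/

section LawOfLargeNumbers

variable {X : Type} [MeasurableSpace X] (P : Measure X) [IsProbabilityMeasure P]

/-- The mean deviation of a sum of `n` i.i.d. terms from its expectation. -/
noncomputable def meanDev (φ : X → ℝ) (n : ℕ) : ℝ :=
  ∫ ω, |∑ i ∈ Finset.range n, φ (ω i) - n * ∫ x, φ x ∂P| ∂(Measure.infinitePi fun _ : ℕ => P)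

variable {P}

theorem meanDev_nonneg (φ : X → ℝ) (n : ℕ) : 0 ≤ meanDev P φ n :=
  integral_nonneg fun _ => abs_nonneg _

theorem integrable_eval_infinitePi {φ : X → ℝ} (h : Integrable φ P) (i : ℕ) :
    Integrable (fun ω => φ (ω i)) (Measure.infinitePi fun _ : ℕ => P) :=
  (measurePreserving_eval_infinitePi (fun _ : ℕ => P) i).integrable_comp_of_integrable h

theorem integrable_deviation {φ : X → ℝ} (h : Integrable φ P) (n : ℕ) :
    Integrable (fun ω => |∑ i ∈ Finset.range n, φ (ω i) - n * ∫ x, φ x ∂P|)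
      (Measure.infinitePi fun _ : ℕ => P) :=
  ((integrable_finsetSum _ fun i _ => integrable_eval_infinitePi h i).sub
    (integrable_const _)).abs

theorem tendsto_meanDev {φ : X → ℝ} (hφ : Measurable φ) (h : Integrable φ P) :
    Tendsto (fun n : ℕ => meanDev P φ n / n) atTop (𝓝 0) := by
  set Q := Measure.infinitePi fun _ : ℕ => P
  have hmp := fun i => measurePreserving_eval_infinitePi (fun _ : ℕ => P) i
  have hindep : iIndepFun (fun (i : ℕ) (ω : ℕ → X) => φ (ω i)) Q :=
    iIndepFun_infinitePi (X := fun _ => φ) fun _ => hφ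
  have hident : ∀ i, IdentDistrib (fun ω : ℕ → X => φ (ω i)) (fun ω => φ (ω 0)) Q Q := by
    intro i
    refine IdentDistrib.comp (u := φ) ⟨(measurable_pi_apply i).aemeasurable,
      (measurable_pi_apply 0).aemeasurable, ?_⟩ hφ
    exact (hmp i).map_eq.trans (hmp 0).map_eq.symm
  have hmean : ∫ ω, φ (ω 0) ∂Q = ∫ x, φ x ∂P := by
    have h2 := integral_map (μ := Q) (φ := Function.eval 0) (hmp 0).measurable.aemeasurable (f := φ)
      (by rw [(hmp 0).map_eq]; exact h.aestronglyMeasurable)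
    rw [(hmp 0).map_eq] at h2
    exact h2.symm
  have hlaw := strong_law_Lp (μ := Q) (p := 1) le_rfl ENNReal.one_ne_top
    (fun (i : ℕ) (ω : ℕ → X) => φ (ω i))
    (memLp_one_iff_integrable.2 (integrable_eval_infinitePi h 0))
    (fun i j hij => hindep.indepFun hij) hident
  have hlaw' := (ENNReal.tendsto_toReal ENNReal.zero_ne_top).comp hlaw
  rw [ENNReal.toReal_zero] at hlaw'
  refine hlaw'.congr' ?_
  filter_upwards [eventually_gt_atTop 0] with n hn
  have hn' : (0 : ℝ) < n := by exact_mod_cast hn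
  have hfun : ∀ ω : ℕ → X, |∑ i ∈ Finset.range n, φ (ω i) - n * ∫ x, φ x ∂P| / n =
      ‖(n : ℝ)⁻¹ • (∑ i ∈ Finset.range n, φ (ω i)) - ∫ ω, φ (ω 0) ∂Q‖ := by
    intro ω
    rw [hmean, Real.norm_eq_abs, smul_eq_mul, ← abs_of_pos hn', ← abs_div, abs_of_pos hn']
    congr 1
    field_simp
  rw [meanDev, ← integral_div]
  simp only [hfun, Function.comp_apply]
  rw [eLpNorm_one_eq_lintegral_enorm]
  refine (integral_norm_eq_lintegral_enorm ?_).symm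
  exact (((integrable_finsetSum _ fun i _ => integrable_eval_infinitePi h i).smul
    (n : ℝ)⁻¹).sub (integrable_const _)).aestronglyMeasurable

/-- Mean deviations are sublinear. -/
theorem exists_meanDev_le {φ : X → ℝ} (hφ : Measurable φ) (h : Integrable φ P) {δ : ℝ}
    (hδ : 0 < δ) : ∃ C : ℝ, 0 ≤ C ∧ ∀ n : ℕ, meanDev P φ n ≤ C + δ * n := by
  obtain ⟨N, hN⟩ := eventually_atTop.1 ((tendsto_meanDev hφ h).eventually (gt_mem_nhds hδ))
  refine ⟨∑ k ∈ Finset.range (N + 1), meanDev P φ k,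
    Finset.sum_nonneg fun _ _ => meanDev_nonneg _ _, fun n => ?_⟩
  have hs : 0 ≤ ∑ k ∈ Finset.range (N + 1), meanDev P φ k :=
    Finset.sum_nonneg fun _ _ => meanDev_nonneg _ _
  rcases le_or_gt n N with hn | hn
  · have h1 := Finset.single_le_sum (f := fun k => meanDev P φ k)
      (fun k _ => meanDev_nonneg φ k) (Finset.mem_range.2 (Nat.lt_succ_of_le hn))
    have h2 : 0 ≤ δ * n := by positivity
    exact h1.trans (by linarith)
  · have h1 := hN n hn.le
    have hn' : (0 : ℝ) < n := by exact_mod_cast (Nat.zero_le N).trans_lt hn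
    rw [div_lt_iff₀ hn'] at h1
    linarith

/-- The first `n` coordinates of an i.i.d. sequence. -/
theorem measurePreserving_restrict_fin (n : ℕ) :
    MeasurePreserving (fun (ω : ℕ → X) (i : Fin n) => ω i) (Measure.infinitePi fun _ : ℕ => P)
      (Measure.pi fun _ : Fin n => P) := by
  refine ⟨measurable_pi_lambda _ fun i => measurable_pi_apply _, ?_⟩
  have := Measure.map_infinitePi_infinitePi_of_inj (P := fun _ : ℕ => P)
    (f := fun i : Fin n => (i : ℕ)) Fin.val_injective
  rw [this, Measure.infinitePi_eq_pi]

theorem integral_deviation_pi {φ : X → ℝ} (hφ : Measurable φ) (n : ℕ) :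
    ∫ x, |∑ i, φ (x i) - n * ∫ x, φ x ∂P| ∂(Measure.pi fun _ : Fin n => P) = meanDev P φ n := by
  have h := measurePreserving_restrict_fin (P := P) n
  have hm : Measurable fun x : Fin n → X => |∑ i, φ (x i) - n * ∫ x, φ x ∂P| :=
    _root_.continuous_abs.measurable.comp ((Finset.measurable_sum _ fun i _ =>
      hφ.comp (measurable_pi_apply i)).sub measurable_const)
  rw [← h.map_eq, integral_map h.measurable.aemeasurable hm.aestronglyMeasurable, meanDev]
  simp only [Finset.sum_range]

/-- The weak law of large numbers, for the lower tail. -/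
theorem tendsto_measure_sum_le {φ : X → ℝ} (hφ : Measurable φ) (h : Integrable φ P) {r : ℝ}
    (hr : r < ∫ x, φ x ∂P) :
    Tendsto (fun n : ℕ => (Measure.pi fun _ : Fin n => P).real {x | ∑ i, φ (x i) ≤ n * r}) atTop
      (𝓝 0) := by
  set δ := (∫ x, φ x ∂P) - r with hδ
  have hδ0 : 0 < δ := sub_pos.2 hr
  have hlim := (tendsto_meanDev hφ h).div_const δ
  rw [zero_div] at hlim
  refine tendsto_of_tendsto_of_tendsto_of_le_of_le' tendsto_const_nhds hlim
    (Eventually.of_forall fun n => measureReal_nonneg) ?_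
  filter_upwards [eventually_gt_atTop 0] with n hn
  have hn' : (0 : ℝ) < n := by exact_mod_cast hn
  have hint : Integrable (fun x : Fin n → X => |∑ i, φ (x i) - n * ∫ x, φ x ∂P|)
      (Measure.pi fun _ : Fin n => P) := ((integrable_sum_pi h n).sub (integrable_const _)).abs
  have hmk := mul_meas_ge_le_integral_of_nonneg (μ := Measure.pi fun _ : Fin n => P)
    (ae_of_all _ fun x => abs_nonneg _) hint (n * δ)
  rw [integral_deviation_pi hφ] at hmk
  rw [div_div, le_div_iff₀ (by positivity), mul_comm]
  refine le_trans ?_ hmk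
  refine mul_le_mul_of_nonneg_left (measureReal_mono ?_) (by positivity)
  intro x hx
  have hx' : ∑ i, φ (x i) ≤ n * r := hx
  change n * δ ≤ |∑ i, φ (x i) - n * ∫ x, φ x ∂P|
  rw [abs_sub_comm]
  refine le_trans ?_ (le_abs_self _)
  rw [hδ]
  linarith

end LawOfLargeNumbers

/-! ### The mean time of the last departure -/

/-- The last packets leave in one busy period, which starts with the arrival of some packet `k`. -/
theorem exists_completion_le (a s : ℕ → ℝ) (n : ℕ) (ha : 0 ≤ a 0) :
    ∃ k ≤ n, completion a s (n + 1) ≤ a k + ∑ j ∈ Finset.Ico k (n + 1), s j := by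
  induction n with
  | zero => exact ⟨0, le_rfl, by simp [completion, ha]⟩
  | succ n ih =>
    obtain ⟨k, hk, h⟩ := ih
    rw [completion]
    rcases le_total (completion a s (n + 1)) (a (n + 1)) with h1 | h1
    · exact ⟨n + 1, le_rfl, by simp [max_eq_right h1]⟩
    · refine ⟨k, by omega, ?_⟩
      rw [max_eq_left h1, Finset.sum_Ico_succ_top (by omega)]
      linarith

/-- The last departure time of a queue with nonnegative interarrivals `x` and service times `s` is
bounded with the help of the deviations of partial sums at `B` equidistant indices only.  The start
of the last busy period is not known in advance; it is rounded to the grid, at the cost of at most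
`n / B + 2` interarrivals, and all `B` deviations are added up. -/
theorem completion_le_blocks {x s : ℕ → ℝ} (hx : ∀ i, 0 ≤ x i) (hs : ∀ i, 0 ≤ s i)
    {ex es : ℝ} (hex : 0 ≤ ex) (hle : es ≤ ex) {n B : ℕ} (hn : 0 < n) (hB : 0 < B) :
    completion (fun i => ∑ j ∈ Finset.range (i + 1), x j) s n ≤
      n * ex + (n / B + 2) * ex + |∑ j ∈ Finset.range n, s j - n * es| +
        ∑ b ∈ Finset.range B,
          (|∑ j ∈ Finset.range ((b + 1) * n / B + 1), x j - ((b + 1) * n / B + 1 : ℕ) * ex| +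
            |∑ j ∈ Finset.range (b * n / B), s j - (b * n / B : ℕ) * es|) := by
  obtain ⟨n', rfl⟩ : ∃ n', n = n' + 1 := ⟨n - 1, by omega⟩
  obtain ⟨k, hk, hle1⟩ := exists_completion_le (fun i => ∑ j ∈ Finset.range (i + 1), x j) s n'
    (Finset.sum_nonneg fun i _ => hx i)
  set n := n' + 1
  have hkn : k < n := by omega
  set b := k * B / n with hb
  have hbB : b < B := by
    rw [hb, Nat.div_lt_iff_lt_mul hn, mul_comm B n]
    exact Nat.mul_lt_mul_of_pos_right hkn hB
  have hlo : b * n / B ≤ k := by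
    refine Nat.div_le_of_le_mul ?_
    rw [mul_comm B k]
    exact Nat.div_mul_le_self _ _
  have hhi : k + 1 ≤ (b + 1) * n / B + 1 := by
    refine Nat.succ_le_succ ((Nat.le_div_iff_mul_le hB).2 ?_)
    have := Nat.lt_div_mul_add (a := k * B) hn
    rw [← hb] at this
    nlinarith
  set lo := b * n / B
  set hi := (b + 1) * n / B + 1
  have h1 : ∑ j ∈ Finset.range (k + 1), x j ≤ ∑ j ∈ Finset.range hi, x j :=
    Finset.sum_le_sum_of_subset_of_nonneg (Finset.range_mono hhi) fun i _ _ => hx i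
  have h2 : ∑ j ∈ Finset.range lo, s j ≤ ∑ j ∈ Finset.range k, s j :=
    Finset.sum_le_sum_of_subset_of_nonneg (Finset.range_mono hlo) fun i _ _ => hs i
  have h3 : ∑ j ∈ Finset.Ico k n, s j = ∑ j ∈ Finset.range n, s j - ∑ j ∈ Finset.range k, s j :=
    Finset.sum_Ico_eq_sub _ hkn.le
  have hB' : (0 : ℝ) < B := by exact_mod_cast hB
  have h4 : (hi : ℝ) ≤ lo + (n / B + 2) := by
    have e1 : (((b + 1) * n / B : ℕ) : ℝ) ≤ (b + 1) * n / B := by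
      exact_mod_cast Nat.cast_div_le (α := ℝ) (m := (b + 1) * n) (n := B)
    have e2 : (b * n : ℝ) / B < (lo : ℝ) + 1 := by
      rw [div_lt_iff₀ hB']
      have := Nat.lt_div_mul_add (a := b * n) hB
      have e3 : b * n < (lo + 1) * B := by rw [add_mul, one_mul]; exact this
      exact_mod_cast e3
    have e4 : ((b : ℝ) + 1) * n / B = b * n / B + n / B := by ring
    simp only [hi]
    push_cast at e1 ⊢
    linarith
  have h5 : (lo : ℝ) ≤ n := by exact_mod_cast hlo.trans hkn.le
  have h6 := Finset.single_le_sum (f := fun b : ℕ =>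
    (|∑ j ∈ Finset.range ((b + 1) * n / B + 1), x j - ((b + 1) * n / B + 1 : ℕ) * ex| +
      |∑ j ∈ Finset.range (b * n / B), s j - (b * n / B : ℕ) * es|))
    (fun i _ => add_nonneg (abs_nonneg _) (abs_nonneg _)) (Finset.mem_range.2 hbB)
  have h7 := le_abs_self (∑ j ∈ Finset.range hi, x j - hi * ex)
  have h8 := neg_abs_le (∑ j ∈ Finset.range lo, s j - lo * es)
  have h9 := le_abs_self (∑ j ∈ Finset.range n, s j - n * es)
  have h10 : (hi : ℝ) * ex ≤ (lo + (n / B + 2)) * ex := mul_le_mul_of_nonneg_right h4 hex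
  have h11 : (n - lo : ℝ) * es ≤ (n - lo) * ex :=
    mul_le_mul_of_nonneg_left hle (sub_nonneg.2 h5)
  have hle1' : completion (fun i => ∑ j ∈ Finset.range (i + 1), x j) s n ≤
    ∑ j ∈ Finset.range (k + 1), x j + ∑ j ∈ Finset.Ico k n, s j := hle1
  change |∑ j ∈ Finset.range hi, x j - hi * ex| + |∑ j ∈ Finset.range lo, s j - lo * es| ≤ _ at h6
  nlinarith [h1, h2, h3, h6, h7, h8, h9, h10, h11, hle1']

section MeanCompletion

variable {T : Type} [LinearOrder T] [AddCommMonoid T] [Sub T] [MeasurableSpace T]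
  {ι : T → ℝ} {α ν : Measure T} [IsProbabilityMeasure α] [IsProbabilityMeasure ν]

theorem IsClock.completion (hι : IsClock ι) (a s : ℕ → T) (n : ℕ) :
    ι (completion a s n) = TimingChannel.completion (fun i => ι (a i)) (fun i => ι (s i)) n := by
  induction n with
  | zero => exact hι.zero
  | succ n ih =>
    rw [TimingChannel.completion, TimingChannel.completion, hι.add, hι.strictMono.monotone.map_max,
      ih]

theorem integrable_clock (hι : IsClock ι) (hα : ∀ᵐ x ∂α, 0 ≤ x) {e : ℝ}
    (he : ∫⁻ x, ENNReal.ofReal (ι x) ∂α = ENNReal.ofReal e) (he0 : 0 ≤ e) :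
    Integrable ι α ∧ ∫ x, ι x ∂α = e := by
  have h0 : ∀ᵐ x ∂α, 0 ≤ ι x := by
    filter_upwards [hα] with x hx
    rw [← hι.zero]
    exact hι.strictMono.monotone hx
  refine ⟨⟨hι.measurable.aestronglyMeasurable, ?_⟩, ?_⟩
  · rw [hasFiniteIntegral_iff_ofReal h0, he]
    exact ENNReal.ofReal_lt_top
  · rw [integral_eq_lintegral_of_nonneg_ae h0 hι.measurable.aestronglyMeasurable, he,
      ENNReal.toReal_ofReal he0]

theorem extendZero_arrivalTimes_restrict (A : ℕ → T) {n i : ℕ} (hi : i < n) :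
    extendZero (arrivalTimes fun k : Fin n => A k) i = ∑ j ∈ Finset.range (i + 1), A j := by
  rw [extendZero_apply _ hi, arrivalTimes]
  refine Finset.sum_nbij (fun k : Fin n => (k : ℕ)) ?_ ?_ ?_ ?_
  · intro k hk
    simp only [Finset.mem_Iic, Fin.le_def, Finset.mem_range] at hk ⊢
    omega
  · exact fun k _ l _ h => Fin.ext h
  · intro j hj
    simp only [Finset.coe_range, Set.mem_Iio] at hj
    refine ⟨⟨j, by omega⟩, ?_, rfl⟩
    simp only [Finset.coe_Iic, Set.mem_Iic, Fin.le_def]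
    omega
  · exact fun _ _ => rfl

variable [TopologicalSpace T] [OrderClosedTopology T] [SecondCountableTopology T] [BorelSpace T]
  [MeasurableAdd₂ T] [MeasurableSub₂ T]

theorem measurable_completion {Ω : Type} [MeasurableSpace Ω] {a s : Ω → ℕ → T}
    (ha : ∀ i, Measurable fun ω => a ω i) (hs : ∀ i, Measurable fun ω => s ω i) (n : ℕ) :
    Measurable fun ω => completion (a ω) (s ω) n := by
  induction n with
  | zero => exact measurable_const
  | succ n ih => exact (ih.max (ha n)).add (hs n)

/-- If the arrival rate does not exceed the service rate, the mean time of the last of `n`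
departures is at most `n` mean interarrival times, up to `o(n)`. -/
theorem eventually_lintegral_completion_le (hι : IsClock ι) (hα : ∀ᵐ x ∂α, 0 ≤ x)
    (hν : ∀ᵐ x ∂ν, 0 ≤ x) {ex es : ℝ} (hes : 0 ≤ es) (hle : es ≤ ex)
    (hex : ∫⁻ x, ENNReal.ofReal (ι x) ∂α = ENNReal.ofReal ex)
    (hesν : ∫⁻ x, ENNReal.ofReal (ι x) ∂ν = ENNReal.ofReal es) {η : ℝ} (hη : 0 < η) :
    ∀ᶠ n : ℕ in atTop,
      ∫⁻ p, ENNReal.ofReal (ι (completion (extendZero (arrivalTimes p.1)) (extendZero p.2) n))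
        ∂((Measure.pi fun _ : Fin n => α).prod (Measure.pi fun _ : Fin n => ν)) ≤
      ENNReal.ofReal (n * (ex + η)) := by
  have hex0 : 0 ≤ ex := hes.trans hle
  obtain ⟨hiα, hmα⟩ := integrable_clock hι hα hex hex0
  obtain ⟨hiν, hmν⟩ := integrable_clock hι hν hesν hes
  -- the rounding to `B` indices costs `n * ex / B ≤ n * η / 4`
  obtain ⟨B, hB⟩ := exists_nat_gt (ex * 4 / η)
  have hB0' : (0 : ℝ) < B := lt_of_le_of_lt (by positivity) hB
  have hB0 : 0 < B := by exact_mod_cast hB0'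
  have hBη : ex / B ≤ η / 4 := by
    rw [div_lt_iff₀ hη] at hB
    rw [div_le_iff₀ hB0']
    linarith
  -- there are `2 * B + 1` deviations, each with mean at most `C + δ * (n + 1)`
  set δ := η / (4 * (2 * B + 1)) with hδ
  have hδ0 : 0 < δ := by positivity
  obtain ⟨C₁, hC₁, hdα⟩ := exists_meanDev_le hι.measurable hiα hδ0
  obtain ⟨C₂, hC₂, hdν⟩ := exists_meanDev_le hι.measurable hiν hδ0
  set C := max C₁ C₂
  obtain ⟨N, hN⟩ := exists_nat_gt ((2 * ex + (2 * B + 1) * (C + δ)) * 2 / η)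
  filter_upwards [eventually_ge_atTop (max N 1)] with n hn
  have hn0 : 0 < n := (le_max_right N 1).trans hn
  have hn0' : (0 : ℝ) < n := by exact_mod_cast hn0
  have hnN : (N : ℝ) ≤ n := by exact_mod_cast (le_max_left N 1).trans hn
  have hrestr := (measurePreserving_restrict_fin (P := α) n).prod
    (measurePreserving_restrict_fin (P := ν) n)
  have hmeas : Measurable fun p : (Fin n → T) × (Fin n → T) => ENNReal.ofReal
      (ι (completion (extendZero (arrivalTimes p.1)) (extendZero p.2) n)) :=
    (hι.measurable.comp (measurable_completion (measurable_extendZero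
      ((measurable_arrivalTimes n).comp measurable_fst))
      (measurable_extendZero measurable_snd) n)).ennreal_ofReal
  rw [← hrestr.lintegral_comp hmeas]
  set Pα := Measure.infinitePi fun _ : ℕ => α
  set Pν := Measure.infinitePi fun _ : ℕ => ν
  set Dα : ℕ → (ℕ → T) → ℝ := fun k ω => |∑ j ∈ Finset.range k, ι (ω j) - k * ex|
  set Dν : ℕ → (ℕ → T) → ℝ := fun k ω => |∑ j ∈ Finset.range k, ι (ω j) - k * es|
  have hDα : ∀ k, Integrable (fun p : (ℕ → T) × (ℕ → T) => Dα k p.1) (Pα.prod Pν) ∧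
      ∫ p, Dα k p.1 ∂(Pα.prod Pν) ≤ C + δ * k := by
    intro k
    have h1 := integrable_deviation hiα k
    rw [hmα] at h1
    refine ⟨h1.comp_fst Pν, ?_⟩
    rw [integral_fun_fst (fun ω => Dα k ω)]
    have h2 := hdα k
    rw [meanDev, hmα] at h2
    simpa using h2.trans (add_le_add_left (le_max_left C₁ C₂) _)
  have hDν : ∀ k, Integrable (fun p : (ℕ → T) × (ℕ → T) => Dν k p.2) (Pα.prod Pν) ∧
      ∫ p, Dν k p.2 ∂(Pα.prod Pν) ≤ C + δ * k := by
    intro k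
    have h1 := integrable_deviation hiν k
    rw [hmν] at h1
    refine ⟨h1.comp_snd Pα, ?_⟩
    rw [integral_fun_snd (fun ω => Dν k ω)]
    have h2 := hdν k
    rw [meanDev, hmν] at h2
    simpa using h2.trans (add_le_add_left (le_max_right C₁ C₂) _)
  set Φ : (ℕ → T) × (ℕ → T) → ℝ := fun p =>
    (n * ex + (n / B + 2) * ex) + Dν n p.2 + ∑ b ∈ Finset.range B,
      (Dα ((b + 1) * n / B + 1) p.1 + Dν (b * n / B) p.2) with hΦ
  have hΦint : Integrable Φ (Pα.prod Pν) :=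
    ((integrable_const _).add (hDν n).1).add
      (integrable_finsetSum _ fun b _ => (hDα _).1.add (hDν _).1)
  have hΦ0 : ∀ p, 0 ≤ Φ p := fun p => by
    simp only [hΦ, Dα, Dν]
    positivity
  have hΦle : ∫ p, Φ p ∂(Pα.prod Pν) ≤ n * (ex + η) := by
    have h0 : ∫ p, Φ p ∂(Pα.prod Pν) = (n * ex + (n / B + 2) * ex) +
        ∫ p, Dν n p.2 ∂(Pα.prod Pν) + ∑ b ∈ Finset.range B,
          (∫ p, Dα ((b + 1) * n / B + 1) p.1 ∂(Pα.prod Pν) +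
            ∫ p, Dν (b * n / B) p.2 ∂(Pα.prod Pν)) := by
      simp only [hΦ]
      have i1 : Integrable (fun p : (ℕ → T) × (ℕ → T) =>
          (n * ex + (n / B + 2) * ex) + Dν n p.2) (Pα.prod Pν) :=
        (integrable_const _).add (hDν n).1
      have i2 : ∀ b ∈ Finset.range B, Integrable (fun p : (ℕ → T) × (ℕ → T) =>
          Dα ((b + 1) * n / B + 1) p.1 + Dν (b * n / B) p.2) (Pα.prod Pν) :=
        fun b _ => (hDα _).1.add (hDν _).1
      rw [integral_add i1 (integrable_finsetSum _ i2), integral_add (integrable_const _) (hDν n).1,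
        integral_finsetSum _ i2]
      congr 1
      · simp
      · exact Finset.sum_congr rfl fun b _ => integral_add (hDα _).1 (hDν _).1
    have h1 : ∀ b ∈ Finset.range B, (∫ p, Dα ((b + 1) * n / B + 1) p.1 ∂(Pα.prod Pν) +
        ∫ p, Dν (b * n / B) p.2 ∂(Pα.prod Pν)) ≤ 2 * (C + δ * (n + 1)) := by
      intro b hb
      rw [Finset.mem_range] at hb
      have e1 : ((b + 1) * n / B + 1 : ℕ) ≤ n + 1 := by
        refine Nat.succ_le_succ (Nat.div_le_of_le_mul ?_)
        exact Nat.mul_le_mul_right _ hb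
      have e2 : b * n / B ≤ n + 1 := by
        refine (Nat.div_le_of_le_mul ?_).trans (Nat.le_succ n)
        exact Nat.mul_le_mul_right _ hb.le
      have e1' : (((b + 1) * n / B + 1 : ℕ) : ℝ) ≤ n + 1 := by exact_mod_cast e1
      have e2' : ((b * n / B : ℕ) : ℝ) ≤ n + 1 := by exact_mod_cast e2
      have f1 := (hDα ((b + 1) * n / B + 1)).2.trans
        (add_le_add_right (mul_le_mul_of_nonneg_left e1' hδ0.le) C)
      have f2 := (hDν (b * n / B)).2.trans
        (add_le_add_right (mul_le_mul_of_nonneg_left e2' hδ0.le) C)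
      linarith
    have h2 := Finset.sum_le_sum h1
    simp only [Finset.sum_const, Finset.card_range, nsmul_eq_mul] at h2
    have h3 := (hDν n).2
    rw [h0]
    have h4 : (2 * ex + (2 * B + 1) * (C + δ)) * 2 ≤ n * η := by
      rw [div_lt_iff₀ hη] at hN
      nlinarith
    have h5 : (n / B : ℝ) * ex ≤ n * (η / 4) := by
      have : (n / B : ℝ) * ex = n * (ex / B) := by ring
      rw [this]
      exact mul_le_mul_of_nonneg_left hBη hn0'.le
    have h6 : (2 * B + 1) * δ = η / 4 := by
      rw [hδ]; field_simp
    have h7 : (2 * (B : ℝ) + 1) * (C + δ * (n + 1)) = (2 * B + 1) * (C + δ) + n * (η / 4) := by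
      rw [← h6]; ring
    nlinarith
  calc _ ≤ ∫⁻ p, ENNReal.ofReal (Φ p) ∂(Pα.prod Pν) := by
        refine lintegral_mono_ae ?_
        have g1 : ∀ᵐ p ∂(Pα.prod Pν), ∀ i, 0 ≤ p.1 i := by
          have : ∀ᵐ ω ∂Pα, ∀ i, 0 ≤ ω i := ae_all_iff.2 fun i =>
            (measurePreserving_eval_infinitePi (fun _ : ℕ => α) i).quasiMeasurePreserving.ae hα
          exact Measure.quasiMeasurePreserving_fst.ae this
        have g2 : ∀ᵐ p ∂(Pα.prod Pν), ∀ i, 0 ≤ p.2 i := by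
          have : ∀ᵐ ω ∂Pν, ∀ i, 0 ≤ ω i := ae_all_iff.2 fun i =>
            (measurePreserving_eval_infinitePi (fun _ : ℕ => ν) i).quasiMeasurePreserving.ae hν
          exact Measure.quasiMeasurePreserving_snd.ae this
        filter_upwards [g1, g2] with p hp1 hp2
        refine ENNReal.ofReal_le_ofReal ?_
        have hmono : ∀ {x : T}, 0 ≤ x → 0 ≤ ι x := fun {x} hx => by
          rw [← hι.zero]; exact hι.strictMono.monotone hx
        have hb := completion_le_blocks (x := fun i => ι (p.1 i)) (s := fun i => ι (p.2 i))
          (fun i => hmono (hp1 i)) (fun i => hmono (hp2 i)) hex0 hle hn0 hB0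
        refine le_trans (le_of_eq ?_) (hb.trans (le_of_eq rfl))
        rw [hι.completion]
        refine completion_congr (fun i hi => ?_) (fun i hi => ?_)
        · change ι (extendZero (arrivalTimes fun k : Fin n => p.1 k) i) = _
          rw [extendZero_arrivalTimes_restrict _ hi, hι.sum]
        · change ι (extendZero (fun k : Fin n => p.2 k) i) = _
          rw [extendZero_apply _ hi]
    _ = ENNReal.ofReal (∫ p, Φ p ∂(Pα.prod Pν)) :=
        (ofReal_integral_eq_lintegral_ofReal hΦint (ae_of_all _ hΦ0)).symm
    _ ≤ _ := ENNReal.ofReal_le_ofReal hΦle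

end MeanCompletion

/-! ### Random coding -/

section RandomCoding

variable {X S Y : Type*} [MeasurableSpace X] [MeasurableSpace S] [MeasurableSpace Y]

theorem map_pair_pi (α : Measure X) [IsProbabilityMeasure α] {M : ℕ} {u v : Fin M} (h : u ≠ v) :
    (Measure.pi fun _ : Fin M => α).map (fun c => (c u, c v)) = α.prod α := by
  have h1 : iIndepFun (fun (i : Fin M) (c : Fin M → X) => c i) (Measure.pi fun _ : Fin M => α) :=
    iIndepFun_pi (X := fun (_ : Fin M) (x : X) => x) fun _ => measurable_id.aemeasurable
  have h2 := (indepFun_iff_map_prod_eq_prod_map_map (measurable_pi_apply u).aemeasurable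
    (measurable_pi_apply v).aemeasurable).1 (h1.indepFun h)
  have h3 := fun i => (measurePreserving_eval (fun _ : Fin M => α) i).map_eq
  have h4 : ∀ i, (Measure.pi fun _ : Fin M => α).map (fun c => c i) = α := h3
  rw [h2, h4, h4]

theorem map_eval_pi (α : Measure X) [IsProbabilityMeasure α] {M : ℕ} (u : Fin M) :
    (Measure.pi fun _ : Fin M => α).map (fun c => c u) = α :=
  (measurePreserving_eval (fun _ : Fin M => α) u).map_eq

/-- Threshold decoding: the first message whose codeword is related to the output by `Γ`. -/
theorem exists_decoder {M : ℕ} (hM : 0 < M) {Γ : Set (X × Y)} (hΓ : MeasurableSet Γ)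
    (c : Fin M → X) : ∃ dec : Y → Fin M, Measurable dec ∧ ∀ u y, dec y ≠ u →
      (c u, y) ∉ Γ ∨ ∃ v, v ≠ u ∧ (c v, y) ∈ Γ := by
  classical
  have hp : ∀ u, MeasurableSet {y | (c u, y) ∈ Γ} := fun u =>
    measurable_prodMk_left hΓ
  let t : Y → Finset (Fin M) := fun y => Finset.univ.filter fun u => (c u, y) ∈ Γ
  have ht : Measurable fun y => (fun u => decide ((c u, y) ∈ Γ) : Fin M → Bool) :=
    measurable_pi_lambda _ fun u => by
      refine measurable_to_bool ?_
      convert hp u using 1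
      ext y; simp
  let sel : (Fin M → Bool) → Fin M := fun b =>
    if h : ∃ u, b u = true then h.choose else ⟨0, hM⟩
  refine ⟨fun y => sel fun u => decide ((c u, y) ∈ Γ), (measurable_of_countable sel).comp ht, ?_⟩
  intro u y hne
  by_cases hu : (c u, y) ∈ Γ
  · right
    have hex : ∃ v, (fun u => decide ((c u, y) ∈ Γ)) v = true := ⟨u, by simpa using hu⟩
    refine ⟨_, hne, ?_⟩
    have := hex.choose_spec
    simp only [sel, dif_pos hex]
    simpa using this
  · exact Or.inl hu

/-- Random coding.  Some codebook of `M` codewords avoiding a null set has at most the mean error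
and the mean cost of a codebook of i.i.d. codewords; `K` is the weight of the errors. -/
theorem exists_codebook (α : Measure X) [IsProbabilityMeasure α] (π : Measure S)
    [IsProbabilityMeasure π] {G : X × S → Y} (hG : Measurable G) {Γ : Set (X × Y)}
    (hΓ : MeasurableSet Γ) {C : X × S → ℝ≥0∞} (hC : Measurable C) {p : X → Prop}
    (hp : ∀ᵐ x ∂α, p x) {M : ℕ} (hM : 0 < M) (K : ℝ≥0∞) :
    ∃ (c : Fin M → X) (dec : Y → Fin M), (∀ u, p (c u)) ∧ Measurable dec ∧
      ∑ u, (K * π {s | dec (G (c u, s)) ≠ u} + ∫⁻ s, C (c u, s) ∂π) ≤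
        M * (K * ((α.prod π) {q | (q.1, G q) ∉ Γ} + M * (α.prod ((α.prod π).map G)) Γ) +
          ∫⁻ q, C q ∂(α.prod π)) := by
  set P := Measure.pi fun _ : Fin M => α with hP
  set e₁ : X → ℝ≥0∞ := fun x => π {s | (x, G (x, s)) ∉ Γ} with he₁
  set e₂ : X × X → ℝ≥0∞ := fun x => π {s | (x.2, G (x.1, s)) ∈ Γ} with he₂
  set cost : X → ℝ≥0∞ := fun x => ∫⁻ s, C (x, s) ∂π with hcost
  have hm₁ : MeasurableSet {q : X × S | (q.1, G q) ∉ Γ} :=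
    (measurable_fst.prodMk hG) hΓ.compl
  have hm₂ : MeasurableSet {q : (X × X) × S | (q.1.2, G (q.1.1, q.2)) ∈ Γ} :=
    ((measurable_snd.comp measurable_fst).prodMk
      (hG.comp ((measurable_fst.comp measurable_fst).prodMk measurable_snd))) hΓ
  have h₁ : Measurable e₁ := measurable_measure_prodMk_left hm₁
  have h₂ : Measurable e₂ := measurable_measure_prodMk_left hm₂
  have h₃ : Measurable cost := hC.lintegral_prod_right'
  have i₁ : ∫⁻ x, e₁ x ∂α = (α.prod π) {q | (q.1, G q) ∉ Γ} := (Measure.prod_apply hm₁).symm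
  have i₂ : ∫⁻ x, e₂ x ∂(α.prod α) = (α.prod ((α.prod π).map G)) Γ := by
    rw [Measure.prod_apply hΓ, lintegral_prod_symm _ h₂.aemeasurable]
    refine lintegral_congr fun x' => ?_
    have hx' : MeasurableSet {y | (x', y) ∈ Γ} := measurable_prodMk_left hΓ
    change _ = (α.prod π).map G {y | (x', y) ∈ Γ}
    rw [Measure.map_apply hG hx', Measure.prod_apply (hG hx')]
    rfl
  have i₃ : ∫⁻ x, cost x ∂α = ∫⁻ q, C q ∂(α.prod π) := (lintegral_prod _ hC.aemeasurable).symm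
  set Φ : (Fin M → X) → ℝ≥0∞ := fun c => ∑ u, (K * (e₁ (c u) + ∑ v ∈ Finset.univ.erase u,
    e₂ (c u, c v)) + cost (c u)) with hΦ
  have hpair : ∀ u v : Fin M, Measurable fun c : Fin M → X => e₂ (c u, c v) := fun u v =>
    h₂.comp ((measurable_pi_apply u).prodMk (measurable_pi_apply v))
  have hsum : ∀ u : Fin M, Measurable fun c : Fin M → X =>
      ∑ v ∈ Finset.univ.erase u, e₂ (c u, c v) := fun u =>
    Finset.measurable_sum _ fun v _ => hpair u v
  have he : ∀ u : Fin M, Measurable fun c : Fin M → X => e₁ (c u) := fun u =>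
    h₁.comp (measurable_pi_apply u)
  have hc : ∀ u : Fin M, Measurable fun c : Fin M → X => cost (c u) := fun u =>
    h₃.comp (measurable_pi_apply u)
  have hes : ∀ u : Fin M, Measurable fun c : Fin M → X =>
      e₁ (c u) + ∑ v ∈ Finset.univ.erase u, e₂ (c u, c v) := fun u => (he u).add (hsum u)
  have hterm : ∀ u : Fin M, Measurable fun c : Fin M → X =>
      K * (e₁ (c u) + ∑ v ∈ Finset.univ.erase u, e₂ (c u, c v)) + cost (c u) := fun u =>
    ((hes u).const_mul K).add (hc u)
  have hΦm : Measurable Φ := Finset.measurable_sum _ fun u _ => hterm u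
  have hint : ∫⁻ c, Φ c ∂P ≤ M * (K * ((α.prod π) {q | (q.1, G q) ∉ Γ} +
      M * (α.prod ((α.prod π).map G)) Γ) + ∫⁻ q, C q ∂(α.prod π)) := by
    rw [lintegral_finsetSum _ fun u _ => hterm u]
    have hone : ∀ u : Fin M, ∫⁻ c, (K * (e₁ (c u) + ∑ v ∈ Finset.univ.erase u,
        e₂ (c u, c v)) + cost (c u)) ∂P ≤ K * ((α.prod π) {q | (q.1, G q) ∉ Γ} +
      M * (α.prod ((α.prod π).map G)) Γ) + ∫⁻ q, C q ∂(α.prod π) := by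
      intro u
      rw [lintegral_add_right _ (hc u), lintegral_const_mul _ (hes u),
        lintegral_add_left (he u), lintegral_finsetSum _ fun v _ => hpair u v]
      have j₁ : ∫⁻ c, e₁ (c u) ∂P = (α.prod π) {q | (q.1, G q) ∉ Γ} := by
        rw [← i₁, ← map_eval_pi α u, lintegral_map h₁ (measurable_pi_apply u)]
      have j₃ : ∫⁻ c, cost (c u) ∂P = ∫⁻ q, C q ∂(α.prod π) := by
        rw [← i₃]
        conv_rhs => rw [← map_eval_pi α u]
        rw [lintegral_map h₃ (measurable_pi_apply u)]
      have j₂ : ∀ v ∈ Finset.univ.erase u, ∫⁻ c, e₂ (c u, c v) ∂P =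
          (α.prod ((α.prod π).map G)) Γ := by
        intro v hv
        rw [← i₂, ← map_pair_pi α (Finset.ne_of_mem_erase hv).symm,
          lintegral_map h₂ ((measurable_pi_apply u).prodMk (measurable_pi_apply v))]
      rw [j₁, j₃, Finset.sum_congr rfl j₂, Finset.sum_const, nsmul_eq_mul]
      gcongr
      exact (Finset.card_le_univ _).trans (by simp)
    calc _ ≤ ∑ _u : Fin M, _ := Finset.sum_le_sum fun u _ => hone u
      _ = _ := by rw [Finset.sum_const, Finset.card_univ, Fintype.card_fin, nsmul_eq_mul]
  obtain ⟨c, hcp, hcle⟩ := exists_notMem_null_le_lintegral hΦm.aemeasurable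
    (ae_iff.1 (ae_pi_of_ae hp M))
  obtain ⟨dec, hdec, hdec'⟩ := exists_decoder hM hΓ c
  refine ⟨c, dec, by simpa using hcp, hdec, ?_⟩
  refine le_trans (Finset.sum_le_sum fun u _ => ?_) (hcle.trans hint)
  refine add_le_add (mul_le_mul_right ?_ K) le_rfl
  calc π {s | dec (G (c u, s)) ≠ u}
      ≤ π ({s | (c u, G (c u, s)) ∉ Γ} ∪ ⋃ v ∈ Finset.univ.erase u,
          {s | (c v, G (c u, s)) ∈ Γ}) := by
        refine measure_mono fun s hs => ?_
        rcases hdec' u _ hs with h | ⟨v, hv, h⟩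
        · exact Or.inl h
        · refine Or.inr ?_
          simp only [Set.mem_iUnion]
          exact ⟨v, by simpa using hv, h⟩
    _ ≤ _ := (measure_union_le _ _).trans (add_le_add le_rfl (measure_biUnion_finset_le _ _))

end RandomCoding

/-! ### The output law -/

theorem isDensity_rnDeriv {X : Type*} [MeasurableSpace X] {m P : Measure X} [SigmaFinite m]
    [SigmaFinite P] (h : P ≪ m) : IsDensity m (fun x => (P.rnDeriv m x).toReal) P where
  measurable := (Measure.measurable_rnDeriv P m).ennreal_toReal
  nonneg _ := ENNReal.toReal_nonneg
  eq := by
    conv_lhs => rw [← Measure.withDensity_rnDeriv_eq P m h]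
    refine withDensity_congr_ae ?_
    filter_upwards [Measure.rnDeriv_lt_top P m] with x hx
    rw [ENNReal.ofReal_toReal hx.ne]

theorem IsDensity.absolutelyContinuous {X : Type*} [MeasurableSpace X] {m P : Measure X}
    {f : X → ℝ} (h : IsDensity m f P) : P ≪ m := by
  rw [h.eq]
  exact withDensity_absolutelyContinuous _ _

section OutputLaw

variable {T : Type} [LinearOrder T] [AddCommMonoid T] [Sub T] [MeasurableSpace T]
  [IsOrderedCancelAddMonoid T] [OrderedSub T] [ExistsAddOfLE T]
  [TopologicalSpace T] [OrderClosedTopology T] [SecondCountableTopology T] [BorelSpace T]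
  [MeasurableAdd₂ T] [MeasurableSub₂ T]
  {m : Measure T} [SigmaFinite m] {ν α : Measure T} [IsProbabilityMeasure ν]
  [IsProbabilityMeasure α] {ι f g : T → ℝ} {c₀ c₁ : ℝ}

theorem Discipline.measurable_channel_prod (Q : Discipline T) (n : ℕ) :
    Measurable fun p : (Fin n → T) × (Fin n → T) => Q.channel p.1 p.2 :=
  Q.measurable_channel measurable_fst measurable_snd

theorem Discipline.interdepartureLaw_eq (Q : Discipline T) (ν α : Measure T) (n : ℕ) :
    Q.interdepartureLaw ν α n = ((Measure.pi fun _ : Fin n => α).prod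
      (Measure.pi fun _ : Fin n => ν)).map fun p => Q.channel p.1 p.2 := rfl

theorem isProbabilityMeasure_interdepartureLaw (Q : Discipline T) (n : ℕ) :
    IsProbabilityMeasure (Q.interdepartureLaw ν α n) := by
  rw [Q.interdepartureLaw_eq]
  exact Measure.isProbabilityMeasure_map (Q.measurable_channel_prod n).aemeasurable

theorem ae_prod_nonneg_pos (hα : ∀ᵐ x ∂α, 0 ≤ x) (hpos : ∀ᵐ x ∂ν, 0 < x) (n : ℕ) :
    ∀ᵐ p ∂((Measure.pi fun _ : Fin n => α).prod (Measure.pi fun _ : Fin n => ν)),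
      (∀ i, 0 ≤ p.1 i) ∧ ∀ i, 0 < p.2 i :=
  (Measure.quasiMeasurePreserving_fst.ae (ae_pi_of_ae hα n)).and
    (Measure.quasiMeasurePreserving_snd.ae (ae_pi_of_ae hpos n))

theorem ae_pos_interdepartureLaw (hα : ∀ᵐ x ∂α, 0 ≤ x) (hpos : ∀ᵐ x ∂ν, 0 < x)
    (Q : Discipline T) (n : ℕ) : ∀ᵐ y ∂(Q.interdepartureLaw ν α n), ∀ i, 0 < y i := by
  have hms : MeasurableSet {y : Fin n → T | ∀ i, 0 < y i} := by
    rw [Set.ofPred_forall]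
    exact MeasurableSet.iInter fun i => measurableSet_lt measurable_const (measurable_pi_apply i)
  rw [Q.interdepartureLaw_eq, ae_map_iff (Q.measurable_channel_prod n).aemeasurable hms]
  filter_upwards [ae_prod_nonneg_pos hα hpos n] with p hp
  exact Q.channel_pos hp.1 hp.2

theorem absolutelyContinuous_interdepartureLaw (hm : IsReference m) (hν : ν ≪ m)
    (hα : ∀ᵐ x ∂α, 0 ≤ x) (hpos : ∀ᵐ x ∂ν, 0 < x) (Q : Discipline T) (n : ℕ) :
    Q.interdepartureLaw ν α n ≪ Measure.pi fun _ : Fin n => m := by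
  have hπ := (isDensity_rnDeriv hν).pi n |>.absolutelyContinuous
  refine Measure.AbsolutelyContinuous.mk fun B hB hB0 => ?_
  have hG := Q.measurable_channel_prod n
  rw [Q.interdepartureLaw_eq, Measure.map_apply hG hB, Measure.measure_prod_null (hG hB)]
  filter_upwards [ae_pi_of_ae hα n] with A hA
  have h1 := hm.departures_le Q n (fun _ => arrivalTimes A)
    (fun s => Q.departures (arrivalTimes A) s) {s | ∀ i, 0 < s i} B measurable_const
    (fun _ _ _ _ => rfl) (fun s hs => ⟨isInput_arrivalTimes hA hs, rfl⟩) hB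
  rw [hB0, nonpos_iff_eq_zero] at h1
  have h2 := hπ h1
  refine measure_mono_null_ae ?_ h2
  filter_upwards [ae_pi_of_ae hpos n] with s hs hsB
  exact ⟨hs, hsB⟩

/-- The mean of the last departure time, when the arrival rate does not exceed the
service rate. -/
theorem eventually_lintegral_sum_interdepartureLaw_le (hι : IsClock ι) (hα : ∀ᵐ x ∂α, 0 ≤ x)
    (hpos : ∀ᵐ x ∂ν, 0 < x) (Q : Discipline T) {ex es : ℝ} (hes : 0 ≤ es) (hle : es ≤ ex)
    (hex : ∫⁻ x, ENNReal.ofReal (ι x) ∂α = ENNReal.ofReal ex)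
    (hesν : ∫⁻ x, ENNReal.ofReal (ι x) ∂ν = ENNReal.ofReal es) {η : ℝ} (hη : 0 < η) :
    ∀ᶠ n : ℕ in atTop, ∫⁻ y, ENNReal.ofReal (ι (∑ i, y i)) ∂(Q.interdepartureLaw ν α n) ≤
      ENNReal.ofReal (n * (ex + η)) := by
  filter_upwards [eventually_lintegral_completion_le hι hα (hpos.mono fun x hx => hx.le) hes hle
    hex hesν hη] with n hn
  have hmeas : Measurable fun y : Fin n → T => ENNReal.ofReal (ι (∑ i, y i)) :=
    (hι.measurable.comp (Finset.measurable_sum _ fun i _ => measurable_pi_apply i)).ennreal_ofReal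
  rw [Q.interdepartureLaw_eq, lintegral_map hmeas (Q.measurable_channel_prod n)]
  refine le_trans (le_of_eq (lintegral_congr_ae ?_)) hn
  filter_upwards [ae_prod_nonneg_pos hα hpos n] with p hp
  rw [Q.sum_channel hp.1 hp.2]

/-- The interdepartures have densities with finite entropies, and `h` (in nats) is an asymptotic
lower bound for these entropies per packet. -/
def HasOutputEntropy (Q : Discipline T) (m ν α : Measure T) (h : ℝ) : Prop :=
  ∀ δ : ℝ, 0 < δ → ∀ᶠ n : ℕ in atTop, ∃ ρ : (Fin n → T) → ℝ,
    IsDensity (Measure.pi fun _ : Fin n => m) ρ (Q.interdepartureLaw ν α n) ∧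
    Integrable (fun y => Real.log (ρ y)) (Q.interdepartureLaw ν α n) ∧
    ∫ y, Real.log (ρ y) ∂(Q.interdepartureLaw ν α n) ≤ -(n * (h - δ))

/-- With high probability the output density is not much larger than the i.i.d. density: the mean
logarithm of their ratio is sublinear, and its negative part is bounded in the mean, so Markov's
inequality applies.  This is the place where the hypothesis on the output entropy enters. -/
theorem eventually_measure_ratio_le (hι : IsClock ι) (hα : ∀ᵐ x ∂α, 0 ≤ x)
    (hpos : ∀ᵐ x ∂ν, 0 < x) (hg : IsLogAffine m ι g c₀ c₁) (hc₁ : 0 < c₁) (Q : Discipline T)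
    {ex es : ℝ} (hes : 0 ≤ es) (hle : es ≤ ex)
    (hex : ∫⁻ x, ENNReal.ofReal (ι x) ∂α = ENNReal.ofReal ex)
    (hesν : ∫⁻ x, ENNReal.ofReal (ι x) ∂ν = ENNReal.ofReal es)
    (hfull : HasOutputEntropy Q m ν α (c₁ * ex - c₀)) {κ θ : ℝ} (hκ : 0 < κ) (hθ : 0 < θ) :
    ∀ᶠ n : ℕ in atTop, ∃ ρ : (Fin n → T) → ℝ,
      IsDensity (Measure.pi fun _ : Fin n => m) ρ (Q.interdepartureLaw ν α n) ∧
      (Q.interdepartureLaw ν α n).real {y | Real.exp (n * κ) * ∏ i, g (y i) < ρ y} ≤ θ := by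
  have hex0 : 0 ≤ ex := hes.trans hle
  set δ := κ * θ / 4 with hδ
  have hδ0 : 0 < δ := by positivity
  obtain ⟨N, hN⟩ := exists_nat_gt (1 / δ)
  filter_upwards [hfull δ hδ0, eventually_lintegral_sum_interdepartureLaw_le hι hα hpos Q hes hle
    hex hesν (div_pos hδ0 hc₁), eventually_ge_atTop (max N 1)] with n ⟨ρ, hρ, hint, hent⟩ hsum hn
  refine ⟨ρ, hρ, ?_⟩
  have hn1 : 1 ≤ n := (le_max_right N 1).trans hn
  have hn0 : (0 : ℝ) < n := by exact_mod_cast hn1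
  have hnN : (N : ℝ) ≤ n := by exact_mod_cast (le_max_left N 1).trans hn
  set P := Q.interdepartureLaw ν α n with hP
  have : IsProbabilityMeasure P := isProbabilityMeasure_interdepartureLaw Q n
  set q : (Fin n → T) → ℝ := fun y => ∏ i, g (y i)
  have hq : Measurable q :=
    Finset.measurable_prod _ fun i _ => hg.measurable.comp (measurable_pi_apply i)
  have hpy : ∀ᵐ y ∂P, ∀ i, 0 < y i := ae_pos_interdepartureLaw hα hpos Q n
  have htm : Measurable fun y : Fin n → T => ι (∑ i, y i) :=
    hι.measurable.comp (Finset.measurable_sum _ fun i _ => measurable_pi_apply i)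
  have ht0 : ∀ᵐ y ∂P, 0 ≤ ι (∑ i, y i) := by
    filter_upwards [hpy] with y hy
    rw [← hι.zero]
    exact hι.strictMono.monotone (Finset.sum_nonneg fun i _ => (hy i).le)
  have htint : Integrable (fun y : Fin n → T => ι (∑ i, y i)) P := by
    refine ⟨htm.aestronglyMeasurable, ?_⟩
    rw [hasFiniteIntegral_iff_ofReal ht0]
    exact hsum.trans_lt ENNReal.ofReal_lt_top
  have htle : ∫ y, ι (∑ i, y i) ∂P ≤ n * (ex + δ / c₁) := by
    rw [integral_eq_lintegral_of_nonneg_ae ht0 htm.aestronglyMeasurable]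
    exact ENNReal.toReal_le_of_le_ofReal (by positivity) hsum
  set D : (Fin n → T) → ℝ := fun y => Real.log (ρ y) - (n * c₀ - c₁ * ι (∑ i, y i)) with hD
  have hDint : Integrable D P := hint.sub ((integrable_const _).sub (htint.const_mul _))
  have hDle : ∫ y, D y ∂P ≤ n * (2 * δ) := by
    have h1 : ∫ y, D y ∂P = ∫ y, Real.log (ρ y) ∂P - (n * c₀ - c₁ * ∫ y, ι (∑ i, y i) ∂P) := by
      have i1 : Integrable (fun y : Fin n → T => n * c₀ - c₁ * ι (∑ i, y i)) P :=
        (integrable_const _).sub (htint.const_mul _)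
      simp only [hD]
      rw [integral_sub hint i1, integral_sub (integrable_const _) (htint.const_mul _),
        integral_const_mul c₁]
      simp
    have h2 := mul_le_mul_of_nonneg_left htle hc₁.le
    have h3 : c₁ * (n * (ex + δ / c₁)) = n * (c₁ * ex + δ) := by field_simp
    rw [h1]
    nlinarith
  -- `exp (-D)` has integral at most one
  set Ex : (Fin n → T) → ℝ := fun y => q y / ρ y
  have hExm : Measurable Ex := hq.div hρ.measurable
  have hq0 : ∀ y, 0 ≤ q y := fun y => Finset.prod_nonneg fun i _ => hg.nonneg _
  have hEx0 : ∀ y, 0 ≤ Ex y := fun y => div_nonneg (hq0 y) (hρ.nonneg y)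
  have hExl : ∫⁻ y, ENNReal.ofReal (Ex y) ∂P ≤ 1 := by
    rw [hρ.lintegral_eq hExm.ennreal_ofReal]
    calc _ ≤ ∫⁻ y, ∏ i, ENNReal.ofReal (g (y i)) ∂(Measure.pi fun _ : Fin n => m) := by
          refine lintegral_mono fun y => ?_
          rw [← ENNReal.ofReal_mul (hρ.nonneg y),
            ← ENNReal.ofReal_prod_of_nonneg fun i _ => hg.nonneg _]
          refine ENNReal.ofReal_le_ofReal ?_
          rcases (hρ.nonneg y).eq_or_lt with h0 | h0
          · rw [← h0, zero_mul]; exact hq0 y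
          · exact (mul_div_cancel₀ _ h0.ne').le
      _ ≤ 1 := by
          rw [lintegral_pi_prod m fun i => hg.measurable.ennreal_ofReal]
          exact Finset.prod_le_one' fun i _ => hg.lintegral_le
  have hExint : Integrable Ex P := by
    refine ⟨hExm.aestronglyMeasurable, ?_⟩
    rw [hasFiniteIntegral_iff_ofReal (ae_of_all _ hEx0)]
    exact hExl.trans_lt ENNReal.one_lt_top
  have hExle : ∫ y, Ex y ∂P ≤ 1 := by
    rw [integral_eq_lintegral_of_nonneg_ae (ae_of_all _ hEx0) hExm.aestronglyMeasurable]
    exact ENNReal.toReal_le_of_le_ofReal zero_le_one (by simpa using hExl)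
  have hkey : ∀ᵐ y ∂P, Real.log (ρ y / q y) = D y ∧ 0 < ρ y ∧ 0 < q y := by
    filter_upwards [hpy, hρ.ae_pos] with y hy hr
    obtain ⟨h1, h2⟩ := hg.log_prod hι hy
    exact ⟨by rw [Real.log_div hr.ne' h1.ne', h2], hr, h1⟩
  have hsum0 : ∀ᵐ y ∂P, 0 ≤ D y + Ex y := by
    filter_upwards [hkey] with y ⟨h1, h2, h3⟩
    have := Real.log_le_sub_one_of_pos (div_pos h3 h2)
    rw [← inv_div, Real.log_inv, h1] at this
    simp only [Ex]
    rw [inv_div] at this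
    linarith
  have hmk := mul_meas_ge_le_integral_of_nonneg (μ := P) hsum0 (hDint.add hExint) (n * κ)
  have h4 : ∫ y, (D y + Ex y) ∂P ≤ n * (2 * δ) + 1 := by
    rw [integral_add hDint hExint]; linarith
  have h5 : P.real {y | Real.exp (n * κ) * q y < ρ y} ≤ P.real {y | n * κ ≤ D y + Ex y} := by
    refine ENNReal.toReal_mono (measure_ne_top _ _) (measure_mono_ae ?_)
    filter_upwards [hkey] with y ⟨h1, h2, h3⟩ hy
    have hy' : Real.exp (n * κ) * q y < ρ y := hy
    rw [← lt_div_iff₀ h3] at hy'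
    have h6 := Real.log_lt_log (Real.exp_pos _) hy'
    rw [Real.log_exp, h1] at h6
    change n * κ ≤ D y + Ex y
    linarith [hEx0 y]
  have h6 : 1 ≤ n * δ := by
    rw [div_lt_iff₀ hδ0] at hN
    nlinarith
  have h7 : (n * κ) * P.real {y | Real.exp (n * κ) * q y < ρ y} ≤ (n * κ) * θ := by
    have h8 := mul_le_mul_of_nonneg_left h5 (by positivity : 0 ≤ n * κ)
    have h9 : (n * κ) * P.real {y | n * κ ≤ D y + Ex y} ≤ n * (2 * δ) + 1 := hmk.trans h4
    have h10 : (n * κ) * θ = n * (4 * δ) := by rw [hδ]; ring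
    rw [h10]
    nlinarith
  exact le_of_mul_le_mul_left h7 (by positivity)

/-! ### The threshold decoder -/

/-- The pairs of interarrivals and interdepartures that are compatible, for which the likelihood
exceeds `τ` times the i.i.d. output density, and whose output density is at most `κ` times the
i.i.d. one. -/
def typicalSet (Q : Discipline T) (f g : T → ℝ) {n : ℕ} (ρ : (Fin n → T) → ℝ) (τ κ : ℝ) :
    Set ((Fin n → T) × (Fin n → T)) :=
  {p | (Q.channel p.1 (Q.unchannel p.1 p.2) = p.2 ∧ ∀ i, 0 < Q.unchannel p.1 p.2 i) ∧
    τ * ∏ i, g (p.2 i) < ∏ i, f (Q.unchannel p.1 p.2 i) ∧ ρ p.2 ≤ κ * ∏ i, g (p.2 i)}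

theorem measurableSet_compatible (Q : Discipline T) (n : ℕ) :
    MeasurableSet {p : (Fin n → T) × (Fin n → T) |
      Q.channel p.1 (Q.unchannel p.1 p.2) = p.2 ∧ ∀ i, 0 < Q.unchannel p.1 p.2 i} := by
  have hu : Measurable fun p : (Fin n → T) × (Fin n → T) => Q.unchannel p.1 p.2 :=
    Q.measurable_unchannel measurable_fst measurable_snd
  have h1 : MeasurableSet {p : (Fin n → T) × (Fin n → T) |
      Q.channel p.1 (Q.unchannel p.1 p.2) = p.2} := by
    have : {p : (Fin n → T) × (Fin n → T) | Q.channel p.1 (Q.unchannel p.1 p.2) = p.2} =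
        ⋂ i, {p | Q.channel p.1 (Q.unchannel p.1 p.2) i = p.2 i} := by
      ext p
      simp [funext_iff]
    rw [this]
    exact MeasurableSet.iInter fun i => measurableSet_eq_fun
      ((measurable_pi_apply i).comp (Q.measurable_channel measurable_fst hu))
      ((measurable_pi_apply i).comp measurable_snd)
  have h2 : MeasurableSet {p : (Fin n → T) × (Fin n → T) | ∀ i, 0 < Q.unchannel p.1 p.2 i} := by
    rw [Set.ofPred_forall]
    exact MeasurableSet.iInter fun i =>
      measurableSet_lt measurable_const ((measurable_pi_apply i).comp hu)
  exact h1.inter h2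

theorem measurableSet_typicalSet (Q : Discipline T) (hf : Measurable f) (hg : Measurable g) {n : ℕ}
    {ρ : (Fin n → T) → ℝ} (hρ : Measurable ρ) (τ κ : ℝ) :
    MeasurableSet (typicalSet Q f g ρ τ κ) := by
  have hu : Measurable fun p : (Fin n → T) × (Fin n → T) => Q.unchannel p.1 p.2 :=
    Q.measurable_unchannel measurable_fst measurable_snd
  have hq : Measurable fun p : (Fin n → T) × (Fin n → T) => ∏ i, g (p.2 i) :=
    Finset.measurable_prod _ fun i _ => hg.comp ((measurable_pi_apply i).comp measurable_snd)
  have hF : Measurable fun p : (Fin n → T) × (Fin n → T) => ∏ i, f (Q.unchannel p.1 p.2 i) :=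
    Finset.measurable_prod _ fun i _ => hf.comp ((measurable_pi_apply i).comp hu)
  exact (measurableSet_compatible Q n).inter ((measurableSet_lt (hq.const_mul τ) hF).inter
    (measurableSet_le (hρ.comp measurable_snd) (hq.const_mul κ)))

/-- An independent codeword is rarely typical with the output.  For a fixed codeword, `recover_le`
bounds the integral over the outputs of the likelihood by `1`, and on the typical set the output
density is at most `κ / τ` times the likelihood. -/
theorem measure_typicalSet_le (hm : IsReference m) (hf : IsDensity m f ν)
    (hα : ∀ᵐ x ∂α, 0 ≤ x) (hgm : Measurable g) (Q : Discipline T) {n : ℕ}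
    {ρ : (Fin n → T) → ℝ} {PD : Measure (Fin n → T)} [IsProbabilityMeasure PD]
    (hρ : IsDensity (Measure.pi fun _ : Fin n => m) ρ PD) {τ κ : ℝ} (hτ : 0 < τ) (hκ : 0 ≤ κ) :
    ((Measure.pi fun _ : Fin n => α).prod PD) (typicalSet Q f g ρ τ κ) ≤
      ENNReal.ofReal (κ / τ) := by
  have hΓ := measurableSet_typicalSet Q hf.measurable hgm hρ.measurable τ κ
  rw [Measure.prod_apply hΓ]
  have hF := hf.pi n
  have hone : ∀ᵐ A ∂(Measure.pi fun _ : Fin n => α),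
      PD (Prod.mk A ⁻¹' typicalSet Q f g ρ τ κ) ≤ ENNReal.ofReal (κ / τ) := by
    filter_upwards [ae_pi_of_ae hα n] with A hA
    have hA' := measurable_prodMk_left (x := A) hΓ
    have hu : Measurable fun y : Fin n → T => Q.unchannel A y :=
      Q.measurable_unchannel measurable_const measurable_id
    set L : Set (Fin n → T) := {y | Q.channel A (Q.unchannel A y) = y ∧
      ∀ i, 0 < Q.unchannel A y i}
    have hL : MeasurableSet L := measurable_prodMk_left (x := A) (measurableSet_compatible Q n)
    have hmap : ((Measure.pi fun _ : Fin n => m).restrict L).map (fun y => Q.unchannel A y) ≤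
        Measure.pi fun _ : Fin n => m := by
      refine Measure.le_iff.2 fun B hB => ?_
      rw [Measure.map_apply hu hB, Measure.restrict_apply (hu hB), Set.inter_comm]
      refine le_trans (measure_mono ?_) (hm.recover_le Q n A B hA hB)
      exact fun y hy => ⟨hy.1.1, hy.1.2, hy.2⟩
    calc PD (Prod.mk A ⁻¹' typicalSet Q f g ρ τ κ)
        = ∫⁻ y, ENNReal.ofReal (ρ y) * (Prod.mk A ⁻¹' typicalSet Q f g ρ τ κ).indicator 1 y
            ∂(Measure.pi fun _ : Fin n => m) := by
          rw [← hρ.lintegral_eq (measurable_one.indicator hA'), lintegral_indicator_one hA']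
      _ ≤ ∫⁻ y, ENNReal.ofReal (κ / τ) * L.indicator
            (fun y => ENNReal.ofReal (∏ i, f (Q.unchannel A y i))) y
            ∂(Measure.pi fun _ : Fin n => m) := by
          refine lintegral_mono fun y => ?_
          by_cases hy : y ∈ Prod.mk A ⁻¹' typicalSet Q f g ρ τ κ
          · obtain ⟨h1, h2, h3⟩ := hy
            have hyL : y ∈ L := h1
            rw [Set.indicator_of_mem hyL, Set.indicator_of_mem (show y ∈ Prod.mk A ⁻¹'
              typicalSet Q f g ρ τ κ from ⟨h1, h2, h3⟩), Pi.one_apply, mul_one,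
              ← ENNReal.ofReal_mul (by positivity)]
            refine ENNReal.ofReal_le_ofReal (h3.trans ?_)
            rw [div_mul_eq_mul_div, le_div_iff₀ hτ, mul_assoc, mul_comm _ τ]
            exact mul_le_mul_of_nonneg_left h2.le hκ
          · rw [Set.indicator_of_notMem hy, mul_zero]
            exact zero_le
      _ = ENNReal.ofReal (κ / τ) * ∫⁻ y, ENNReal.ofReal (∏ i, f (Q.unchannel A y i))
            ∂((Measure.pi fun _ : Fin n => m).restrict L) := by
          have hmeas : Measurable fun y => ENNReal.ofReal (∏ i, f (Q.unchannel A y i)) :=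
            (hF.measurable.comp hu).ennreal_ofReal
          rw [lintegral_const_mul _ (hmeas.indicator hL), lintegral_indicator hL]
      _ = ENNReal.ofReal (κ / τ) * ∫⁻ s, ENNReal.ofReal (∏ i, f (s i))
            ∂(((Measure.pi fun _ : Fin n => m).restrict L).map fun y => Q.unchannel A y) := by
          rw [lintegral_map hF.measurable.ennreal_ofReal hu]
      _ ≤ ENNReal.ofReal (κ / τ) * ∫⁻ s, ENNReal.ofReal (∏ i, f (s i))
            ∂(Measure.pi fun _ : Fin n => m) :=
          mul_le_mul_right (lintegral_mono' hmap le_rfl) _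
      _ = ENNReal.ofReal (κ / τ) := by rw [hF.lintegral_ofReal, mul_one]
  calc _ ≤ ∫⁻ _, ENNReal.ofReal (κ / τ) ∂(Measure.pi fun _ : Fin n => α) := lintegral_mono_ae hone
    _ = _ := by simp

end OutputLaw

/-! ### Achievability -/

/-- A sequence of tolerances that tends to zero, from bounds for each fixed tolerance. -/
theorem exists_tendsto_zero_of_eventually {p : ℕ → ℝ → Prop}
    (hmono : ∀ n θ θ', θ ≤ θ' → p n θ → p n θ') (h : ∀ θ : ℝ, 0 < θ → ∀ᶠ n in atTop, p n θ) :
    ∃ ε : ℕ → ℝ, Tendsto ε atTop (𝓝 0) ∧ ∀ᶠ n in atTop, p n (ε n) := by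
  set S : ℕ → Set ℝ := fun n => {θ | 0 < θ ∧ p n θ}
  have hbdd : ∀ n, BddBelow (S n) := fun n => ⟨0, fun θ hθ => hθ.1.le⟩
  have hinf : ∀ n, 0 ≤ sInf (S n) := fun n => Real.sInf_nonneg fun θ hθ => hθ.1.le
  have hlim : Tendsto (fun n => sInf (S n)) atTop (𝓝 0) := by
    rw [Metric.tendsto_atTop']
    intro δ hδ
    obtain ⟨N, hN⟩ := eventually_atTop.1 (h (δ / 2) (by positivity))
    refine ⟨N, fun n hn => ?_⟩
    rw [Real.dist_eq, sub_zero, abs_of_nonneg (hinf n)]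
    have := csInf_le (hbdd n) (show δ / 2 ∈ S n from ⟨by positivity, hN n (le_of_lt hn)⟩)
    linarith
  refine ⟨fun n => sInf (S n) + 1 / ((n : ℝ) + 1), ?_, ?_⟩
  · simpa using hlim.add tendsto_one_div_add_atTop_nhds_zero_nat
  · filter_upwards [h 1 one_pos] with n hn
    obtain ⟨θ, hθ, hlt⟩ := exists_lt_of_csInf_lt (show (S n).Nonempty from ⟨1, one_pos, hn⟩)
      (lt_add_of_pos_right (sInf (S n)) (by positivity : 0 < 1 / ((n : ℝ) + 1)))
    exact hmono n _ _ hlt.le hθ.2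

section Achievability

variable {T : Type} [LinearOrder T] [AddCommMonoid T] [Sub T] [MeasurableSpace T]
  [IsOrderedCancelAddMonoid T] [OrderedSub T] [ExistsAddOfLE T]
  [TopologicalSpace T] [OrderClosedTopology T] [SecondCountableTopology T] [BorelSpace T]
  [MeasurableAdd₂ T] [MeasurableSub₂ T]
  {m : Measure T} [SigmaFinite m] {ν α : Measure T} [IsProbabilityMeasure ν]
  [IsProbabilityMeasure α] {ι f g φ : T → ℝ} {c₀ c₁ : ℝ}

theorem Discipline.sum_le_sum_channel (Q : Discipline T) {n : ℕ} {A s : Fin n → T}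
    (hA : ∀ i, 0 ≤ A i) (hs : ∀ i, 0 < s i) : ∑ i, A i ≤ ∑ i, Q.channel A s i := by
  rw [Q.sum_channel hA hs]
  rcases n with _ | n
  · simp [TimingChannel.completion]
  · rw [TimingChannel.completion, extendZero_apply _ (Nat.lt_succ_self n),
      extendZero_apply _ (Nat.lt_succ_self n)]
    have h1 : arrivalTimes A ⟨n, Nat.lt_succ_self n⟩ = ∑ i, A i := by
      rw [arrivalTimes]
      congr 1
      ext i
      simp only [Finset.mem_Iic, Finset.mem_univ, iff_true, Fin.le_def]
      omega
    rw [h1]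
    exact (le_max_right _ _).trans (le_add_of_nonneg_right (hs _).le)

/-- The codeword that is sent fails to be typical with the output only if the likelihood of the
service times is too small, the last arrival is too early, or the output density is too large. -/
theorem measure_not_typicalSet_le (hι : IsClock ι) (hf : IsDensity m f ν)
    (hα : ∀ᵐ x ∂α, 0 ≤ x) (hpos : ∀ᵐ x ∂ν, 0 < x) (hg : IsLogAffine m ι g c₀ c₁) (hc₁ : 0 < c₁)
    (hφ : ∀ᵐ x ∂ν, φ x ≤ Real.log (f x)) (Q : Discipline T) {n : ℕ} {ρ : (Fin n → T) → ℝ}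
    (hρ : Measurable ρ) (r e κ : ℝ) :
    ((Measure.pi fun _ : Fin n => α).prod (Measure.pi fun _ : Fin n => ν)).real
      {p | (p.1, Q.channel p.1 p.2) ∉ typicalSet Q f g ρ (Real.exp (n * (r - c₀ + c₁ * e))) κ} ≤
    (Measure.pi fun _ : Fin n => ν).real {s | ∑ i, φ (s i) ≤ n * r} +
      (Measure.pi fun _ : Fin n => α).real {A | ∑ i, ι (A i) ≤ n * e} +
      (Q.interdepartureLaw ν α n).real {y | κ * ∏ i, g (y i) < ρ y} := by
  set Pα := Measure.pi fun _ : Fin n => α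
  set π := Measure.pi fun _ : Fin n => ν
  have hq : Measurable fun y : Fin n → T => ∏ i, g (y i) :=
    Finset.measurable_prod _ fun i _ => hg.measurable.comp (measurable_pi_apply i)
  have e1 : π.real {s | ∑ i, φ (s i) ≤ n * r} =
      (Pα.prod π).real (Set.univ ×ˢ {s | ∑ i, φ (s i) ≤ n * r}) := by
    rw [measureReal_prod_prod]; simp
  have e2 : Pα.real {A | ∑ i, ι (A i) ≤ n * e} =
      (Pα.prod π).real ({A | ∑ i, ι (A i) ≤ n * e} ×ˢ Set.univ) := by
    rw [measureReal_prod_prod]; simp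
  have e3 : (Q.interdepartureLaw ν α n).real {y | κ * ∏ i, g (y i) < ρ y} =
      (Pα.prod π).real ((fun p => Q.channel p.1 p.2) ⁻¹' {y | κ * ∏ i, g (y i) < ρ y}) := by
    rw [Q.interdepartureLaw_eq, map_measureReal_apply (Q.measurable_channel_prod n)
      (measurableSet_lt (hq.const_mul κ) hρ)]
  rw [e1, e2, e3]
  refine le_trans ?_ ((measureReal_union_le _ _).trans
    (add_le_add (measureReal_union_le _ _) le_rfl))
  refine ENNReal.toReal_mono (measure_ne_top _ _) (measure_mono_ae ?_)
  filter_upwards [ae_prod_nonneg_pos hα hpos n,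
    Measure.quasiMeasurePreserving_snd.ae (ae_pi_of_ae hφ n),
    Measure.quasiMeasurePreserving_snd.ae (ae_pi_of_ae hf.ae_pos n)] with p hp hpφ hpf hnot
  by_contra hcon
  have h1 : ¬ ∑ i, φ (p.2 i) ≤ n * r := fun h => hcon (Or.inl (Or.inl ⟨trivial, h⟩))
  have h2 : ¬ ∑ i, ι (p.1 i) ≤ n * e := fun h => hcon (Or.inl (Or.inr ⟨h, trivial⟩))
  have h3 : ¬ κ * ∏ i, g (Q.channel p.1 p.2 i) < ρ (Q.channel p.1 p.2) :=
    fun h => hcon (Or.inr h)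
  rw [not_le] at h1 h2
  rw [not_lt] at h3
  apply hnot
  have hun := Q.unchannel_channel hp.1 hp.2
  refine ⟨?_, ?_, h3⟩
  · simp only [hun]
    exact ⟨trivial, hp.2⟩
  · simp only [hun]
    obtain ⟨h4, h5⟩ := hg.log_prod hι (Q.channel_pos hp.1 hp.2)
    have hFpos : 0 < ∏ i, f (p.2 i) := Finset.prod_pos fun i _ => hpf i
    rw [← Real.log_lt_log_iff (by positivity) hFpos, Real.log_mul (Real.exp_pos _).ne' h4.ne', h5,
      Real.log_exp, Real.log_prod fun i _ => (hpf i).ne']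
    have h6 : ∑ i, φ (p.2 i) ≤ ∑ i, Real.log (f (p.2 i)) := Finset.sum_le_sum fun i _ => hpφ i
    have h7 : ι (∑ i, p.1 i) ≤ ι (∑ i, Q.channel p.1 p.2 i) :=
      hι.strictMono.monotone (Q.sum_le_sum_channel hp.1 hp.2)
    rw [hι.sum] at h7
    have h8 := mul_lt_mul_of_pos_left (h2.trans_le h7) hc₁
    nlinarith

/-- Codes with a given tolerance for the probability of error.  The codebook has to satisfy the
constraints on the error and on the mean of the last departure time at once; this is achieved by one
average over the codebooks of a weighted sum of both. -/
theorem eventually_exists_hasCode (hm : IsReference m) (hι : IsClock ι) (hf : IsDensity m f ν)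
    (hα : ∀ᵐ x ∂α, 0 ≤ x) (hpos : ∀ᵐ x ∂ν, 0 < x) (hg : IsLogAffine m ι g c₀ c₁) (hc₁ : 0 < c₁)
    (hφm : Measurable φ) (hφi : Integrable φ ν) (hφ : ∀ᵐ x ∂ν, φ x ≤ Real.log (f x))
    (Q : Discipline T) {ex es : ℝ} (hes : 0 ≤ es) (hle : es ≤ ex)
    (hex : ∫⁻ x, ENNReal.ofReal (ι x) ∂α = ENNReal.ofReal ex)
    (hesν : ∫⁻ x, ENNReal.ofReal (ι x) ∂ν = ENNReal.ofReal es)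
    (hfull : HasOutputEntropy Q m ν α (c₁ * ex - c₀)) {lam r : ℝ} (hlam : 0 < lam)
    (hexl : ex < 1 / lam) (hr0 : 0 ≤ r) (hr : r < (∫ x, φ x ∂ν) - c₀ + c₁ * ex) {θ : ℝ}
    (hθ : 0 < θ) :
    ∀ᶠ n : ℕ in atTop, Q.HasCode ν ι n ⌈Real.exp (n * r)⌉₊ (n / lam) θ := by
  obtain ⟨b, hb1, hb2⟩ := exists_between hexl
  obtain ⟨hια, hmα⟩ := integrable_clock hι hα hex (hes.trans hle)
  -- In the exponents, an eighth of the gap goes to the service times, an eighth to the last arrival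
  -- and a quarter to the output density.  The remaining half beats the number of codewords.
  set gap := (∫ x, φ x ∂ν) - c₀ + c₁ * ex - r with hgap
  have hgap0 : 0 < gap := by rw [hgap]; linarith
  set e₀ := θ * lam * (1 / lam - b) with he₀
  have he₀0 : 0 < e₀ := mul_pos (mul_pos hθ hlam) (sub_pos.2 hb2)
  set rS := (∫ x, φ x ∂ν) - gap / 8 with hrS
  set e := ex - gap / (8 * c₁) with he
  have hlimS := tendsto_measure_sum_le hφm hφi (r := rS) (by rw [hrS]; linarith)
  have hlimA := tendsto_measure_sum_le hι.measurable hια (r := e)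
    (by rw [hmα, he]; linarith [div_pos hgap0 (mul_pos (by norm_num : (0 : ℝ) < 8) hc₁)])
  have hlimE : Tendsto (fun n : ℕ => 2 * Real.exp (-(gap / 2 * n))) atTop (𝓝 (2 * 0)) := by
    refine Tendsto.const_mul 2 (Real.tendsto_exp_neg_atTop_nhds_zero.comp ?_)
    exact tendsto_natCast_atTop_atTop.const_mul_atTop (by positivity)
  rw [mul_zero] at hlimE
  have he4 : 0 < e₀ / 4 := by positivity
  filter_upwards [hlimS.eventually (gt_mem_nhds he4), hlimA.eventually (gt_mem_nhds he4),
    hlimE.eventually (gt_mem_nhds he4), eventually_measure_ratio_le hι hα hpos hg hc₁ Q hes hle hex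
      hesν hfull (κ := gap / 4) (by positivity) he4,
    eventually_lintegral_completion_le hι hα (hpos.mono fun x hx => hx.le) hes hle hex hesν
      (sub_pos.2 hb1), eventually_gt_atTop 0] with n hS hA hE ⟨ρ, hρ, hρle⟩ hcost hn
  have hn0 : (0 : ℝ) < n := by exact_mod_cast hn
  set M := ⌈Real.exp (n * r)⌉₊ with hM
  have hM0 : 0 < M := Nat.ceil_pos.2 (Real.exp_pos _)
  have hM0' : (0 : ℝ) < M := by exact_mod_cast hM0
  have hM2 : (M : ℝ) ≤ 2 * Real.exp (n * r) := by
    have h1 := (Nat.ceil_lt_add_one (Real.exp_pos (n * r)).le).le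
    have h2 := Real.one_le_exp (mul_nonneg hn0.le hr0)
    rw [← hM] at h1
    linarith
  set Pα := Measure.pi fun _ : Fin n => α
  set π := Measure.pi fun _ : Fin n => ν
  set PD := Q.interdepartureLaw ν α n with hPD
  have : IsProbabilityMeasure PD := isProbabilityMeasure_interdepartureLaw Q n
  set τ := Real.exp (n * (rS - c₀ + c₁ * e)) with hτ
  set κ := Real.exp (n * (gap / 4)) with hκ
  set Γ := typicalSet Q f g ρ τ κ with hΓ
  have hΓm : MeasurableSet Γ := measurableSet_typicalSet Q hf.measurable hg.measurable
    hρ.measurable τ κ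
  have hG := Q.measurable_channel_prod n
  have hfail := measure_not_typicalSet_le (n := n) hι hf hα hpos hg hc₁ hφ Q hρ.measurable rS e κ
  have hconf := measure_typicalSet_le (α := α) (g := g) hm hf hα hg.measurable Q hρ
    (Real.exp_pos (n * (rS - c₀ + c₁ * e))) (Real.exp_pos (n * (gap / 4))).le
  have hMκ : M * (κ / τ) ≤ e₀ / 4 := by
    refine le_trans ?_ hE.le
    have h1 : κ / τ = Real.exp (n * (gap / 4) - n * (rS - c₀ + c₁ * e)) := by
      rw [hκ, hτ, Real.exp_sub]
    have h2 : c₁ * e = c₁ * ex - gap / 8 := by rw [he]; field_simp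
    rw [h1]
    refine (mul_le_mul_of_nonneg_right hM2 (Real.exp_pos _).le).trans (le_of_eq ?_)
    rw [mul_assoc, ← Real.exp_add, h2]
    congr 2
    rw [hrS, hgap]
    ring
  set C : (Fin n → T) × (Fin n → T) → ℝ≥0∞ := fun p =>
    ENNReal.ofReal (ι (lastTime (Q.departures (arrivalTimes p.1) p.2))) with hC
  have hCm : Measurable C := (hι.measurable.comp ((measurable_lastTime n).comp
    (Q.measurable_departures ((measurable_arrivalTimes n).comp measurable_fst)
      measurable_snd))).ennreal_ofReal
  have hCle : ∫⁻ p, C p ∂(Pα.prod π) ≤ ENNReal.ofReal (n * b) := by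
    have : (n : ℝ) * (ex + (b - ex)) = n * b := by ring
    rw [this] at hcost
    refine le_trans (le_of_eq (lintegral_congr_ae ?_)) hcost
    filter_upwards [ae_prod_nonneg_pos hα hpos n] with p hp
    simp only [hC]
    rw [Q.lastTime_departures (isInput_arrivalTimes hp.1 hp.2)]
  -- With this weight, an error probability `e₀` costs as much as the slack `n * (1 / lam - b)` in the
  -- last departure time.  As the weighted sum is at most `n / lam`, the choice of `e₀` makes the
  -- probability of error at most `θ`.
  set K := n * (1 / lam - b) / e₀ with hK
  have hK0 : 0 < K := div_pos (mul_pos hn0 (sub_pos.2 hb2)) he₀0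
  obtain ⟨c, dec, hc, hdec, hcode⟩ := exists_codebook Pα π hG hΓm hCm (ae_pi_of_ae hα n) hM0
    (ENNReal.ofReal K)
  have htot : ∑ u, (ENNReal.ofReal K * π {s | dec (Q.channel (c u) s) ≠ u} +
      ∫⁻ s, C (c u, s) ∂π) ≤ M * ENNReal.ofReal (n / lam) := by
    refine hcode.trans (mul_le_mul_right ?_ _)
    have h1 : (Pα.prod π) {p | (p.1, Q.channel p.1 p.2) ∉ Γ} ≤ ENNReal.ofReal (3 * (e₀ / 4)) := by
      rw [← ENNReal.ofReal_toReal (measure_ne_top _ _)]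
      refine ENNReal.ofReal_le_ofReal (hfail.trans ?_)
      linarith
    have h2 : (M : ℝ≥0∞) * (Pα.prod ((Pα.prod π).map fun p => Q.channel p.1 p.2)) Γ ≤
        ENNReal.ofReal (e₀ / 4) := by
      calc _ ≤ (M : ℝ≥0∞) * ENNReal.ofReal (κ / τ) := mul_le_mul_right hconf _
        _ = ENNReal.ofReal (M * (κ / τ)) := by
          rw [ENNReal.ofReal_mul (Nat.cast_nonneg _), ENNReal.ofReal_natCast]
        _ ≤ _ := ENNReal.ofReal_le_ofReal hMκ
    calc _ ≤ ENNReal.ofReal K * (ENNReal.ofReal (3 * (e₀ / 4)) + ENNReal.ofReal (e₀ / 4)) +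
          ENNReal.ofReal (n * b) := by gcongr
      _ = ENNReal.ofReal (n / lam) := by
        have hb0 : 0 ≤ b := hes.trans (hle.trans hb1.le)
        rw [← ENNReal.ofReal_add (by positivity) (by positivity), ← ENNReal.ofReal_mul hK0.le,
          ← ENNReal.ofReal_add (by positivity) (by positivity)]
        congr 1
        rw [hK]
        field_simp
        ring
  have hM0e : (M : ℝ≥0∞) ≠ 0 := by exact_mod_cast hM0.ne'
  refine ⟨hM0, fun u => arrivalTimes (c u), fun d => dec (interdepartures d),
    fun u => monotone_arrivalTimes (hc u), fun u => arrivalTimes_nonneg (hc u),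
    hdec.comp (measurable_interdepartures n), ?_, ?_⟩
  · rw [ENNReal.div_le_iff hM0e (ENNReal.natCast_ne_top _), mul_comm]
    refine le_trans (Finset.sum_le_sum fun u _ => ?_) htot
    exact le_add_self
  · rw [div_le_iff₀ hM0']
    have h1 : ENNReal.ofReal K * ∑ u, π {s | dec (Q.channel (c u) s) ≠ u} ≤
        ENNReal.ofReal (M * (n / lam)) := by
      rw [ENNReal.ofReal_mul (Nat.cast_nonneg _), ENNReal.ofReal_natCast, Finset.mul_sum]
      refine le_trans (Finset.sum_le_sum fun u _ => ?_) htot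
      exact le_self_add
    have h2 := ENNReal.toReal_le_of_le_ofReal (by positivity) h1
    rw [ENNReal.toReal_mul, ENNReal.toReal_ofReal hK0.le,
      ENNReal.toReal_sum fun u _ => measure_ne_top _ _] at h2
    have h3 : (M : ℝ) * (n / lam) = K * (θ * M) := by
      have : 1 / lam - b ≠ 0 := (sub_pos.2 hb2).ne'
      rw [hK, he₀]
      generalize 1 / lam - b = w at *
      field_simp
    rw [h3] at h2
    exact le_of_mul_le_mul_left h2 hK0

/-- Random coding with i.i.d. interarrivals achieves every rate below the difference of the output
entropy and the service entropy. -/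
theorem achievable_of_lt (hm : IsReference m) (hι : IsClock ι) (hf : IsDensity m f ν)
    (hα : ∀ᵐ x ∂α, 0 ≤ x) (hpos : ∀ᵐ x ∂ν, 0 < x) (hg : IsLogAffine m ι g c₀ c₁) (hc₁ : 0 < c₁)
    (hφm : Measurable φ) (hφi : Integrable φ ν) (hφ : ∀ᵐ x ∂ν, φ x ≤ Real.log (f x))
    (Q : Discipline T) {ex es : ℝ} (hes : 0 ≤ es) (hle : es ≤ ex)
    (hex : ∫⁻ x, ENNReal.ofReal (ι x) ∂α = ENNReal.ofReal ex)
    (hesν : ∫⁻ x, ENNReal.ofReal (ι x) ∂ν = ENNReal.ofReal es)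
    (hfull : HasOutputEntropy Q m ν α (c₁ * ex - c₀)) {lam r : ℝ} (hlam : 0 < lam)
    (hexl : ex < 1 / lam) (hr0 : 0 ≤ r) (hr : r < (∫ x, φ x ∂ν) - c₀ + c₁ * ex) :
    Achievable (Q.HasCode ν ι) lam (lam * (r / Real.log 2)) := by
  intro γ hγ
  obtain ⟨ε, hε, hev⟩ := exists_tendsto_zero_of_eventually
    (p := fun n θ => Q.HasCode ν ι n ⌈Real.exp (n * r)⌉₊ (n / lam) θ)
    (fun n θ θ' hθ h => by
      obtain ⟨h1, enc, dec, h2, h3, h4, h5, h6⟩ := h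
      exact ⟨h1, enc, dec, h2, h3, h4, h5, h6.trans hθ⟩)
    (fun θ hθ => eventually_exists_hasCode hm hι hf hα hpos hg hc₁ hφm hφi hφ Q hes hle hex hesν
      hfull hlam hexl hr0 hr hθ)
  refine ⟨fun n => ⌈Real.exp (n * r)⌉₊, ε, hε, ?_⟩
  filter_upwards [hev, eventually_gt_atTop 0] with n hn hn0
  refine ⟨hn, ?_⟩
  have hn0' : (0 : ℝ) < n := by exact_mod_cast hn0
  have h1 : n * r ≤ Real.log (⌈Real.exp (n * r)⌉₊ : ℝ) := by
    rw [Real.le_log_iff_exp_le (by exact_mod_cast Nat.ceil_pos.2 (Real.exp_pos _))]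
    exact Nat.le_ceil _
  have h2 : r / Real.log 2 ≤ Real.logb 2 (⌈Real.exp (n * r)⌉₊ : ℝ) / n := by
    have hlog2 : 0 < Real.log 2 := Real.log_pos one_lt_two
    rw [Real.logb, div_div, div_le_div_iff₀ hlog2 (by positivity)]
    nlinarith
  have h3 := mul_le_mul_of_nonneg_left h2 hlam.le
  linarith

end Achievability

/-! ### Entropies -/

section Entropy

variable {X : Type} [MeasurableSpace X] {m P : Measure X} {p q : X → ℝ}

/-- The entropy in bits of a law `P` with density `p`: the mean of `-log₂ p`, as the difference of
the means of its positive and its negative part. -/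
noncomputable def densityEntropy (P : Measure X) (p : X → ℝ) : EReal :=
  ((∫⁻ x, ENNReal.ofReal (-Real.logb 2 (p x)) ∂P : ℝ≥0∞) : EReal) -
    ((∫⁻ x, ENNReal.ofReal (Real.logb 2 (p x)) ∂P : ℝ≥0∞) : EReal)

theorem measurable_logb (hp : Measurable p) : Measurable fun x => Real.logb 2 (p x) :=
  (Real.measurable_log.comp hp).div_const _

theorem IsDensity.densityEntropy_eq (h : IsDensity m p P) : densityEntropy P p =
    ((∫⁻ x, ENNReal.ofReal (-(p x * Real.logb 2 (p x))) ∂m : ℝ≥0∞) : EReal) -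
      ((∫⁻ x, ENNReal.ofReal (p x * Real.logb 2 (p x)) ∂m : ℝ≥0∞) : EReal) := by
  have hl := measurable_logb h.measurable
  have hl' : Measurable fun x => -Real.logb 2 (p x) := hl.neg
  rw [densityEntropy, h.lintegral_eq hl'.ennreal_ofReal, h.lintegral_eq hl.ennreal_ofReal]
  congr 3
  · funext x
    rw [← ENNReal.ofReal_mul (h.nonneg x), mul_neg]
  · funext x
    rw [← ENNReal.ofReal_mul (h.nonneg x)]

theorem diffEntropy_eq {X : Type} [MeasureSpace X] [SigmaFinite (volume : Measure X)]
    {P : Measure X} [SigmaFinite P] (h : P ≪ volume) :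
    diffEntropy P = densityEntropy P fun x => (P.rnDeriv volume x).toReal := by
  rw [(isDensity_rnDeriv h).densityEntropy_eq, diffEntropy, if_pos h]

theorem isDensity_count [Countable X] [MeasurableSingletonClass X] [IsFiniteMeasure P] :
    IsDensity Measure.count (fun x => P.real {x}) P where
  measurable := measurable_of_countable _
  nonneg _ := measureReal_nonneg
  eq := by
    refine Measure.ext_of_singleton fun x => ?_
    rw [withDensity_apply _ (measurableSet_singleton x), lintegral_singleton]
    simp [measureReal_def]

theorem shannonEntropy_eq [Countable X] [MeasurableSingletonClass X] [IsProbabilityMeasure P] :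
    shannonEntropy P = densityEntropy P fun x => P.real {x} := by
  have h0 : ∀ x, ENNReal.ofReal (P.real {x} * Real.logb 2 (P.real {x})) = 0 := fun x => by
    refine ENNReal.ofReal_of_nonpos (mul_nonpos_of_nonneg_of_nonpos measureReal_nonneg ?_)
    exact div_nonpos_of_nonpos_of_nonneg (Real.log_nonpos measureReal_nonneg measureReal_le_one)
      (Real.log_nonneg one_le_two)
  rw [isDensity_count.densityEntropy_eq, lintegral_count, lintegral_count, shannonEntropy]
  simp [h0]

/-- Gibbs' inequality bounds the positive part of the entropy. -/
theorem IsDensity.lintegral_neg_logb_ne_top (h : IsDensity m p P) (hq : Measurable q)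
    (hq0 : ∀ᵐ x ∂P, 0 < q x) (hq1 : ∫⁻ x, ENNReal.ofReal (q x) ∂m ≤ 1)
    (hlog : Integrable (fun x => Real.log (q x)) P) :
    ∫⁻ x, ENNReal.ofReal (-Real.logb 2 (p x)) ∂P ≠ ∞ := by
  have hlog2 : 0 < Real.log 2 := Real.log_pos one_lt_two
  have hr : ∫⁻ x, ENNReal.ofReal (q x / p x) ∂P ≤ 1 := by
    have hd : Measurable fun x => q x / p x := hq.div h.measurable
    rw [h.lintegral_eq hd.ennreal_ofReal]
    refine le_trans (lintegral_mono fun x => ?_) hq1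
    rw [← ENNReal.ofReal_mul (h.nonneg x)]
    rcases (h.nonneg x).eq_or_lt with h0 | h0
    · rw [← h0]; simp
    · rw [mul_div_cancel₀ _ h0.ne']
  have hl : ∫⁻ x, ENNReal.ofReal |Real.log (q x)| ∂P ≠ ∞ := by
    have := hlog.abs.2
    rw [hasFiniteIntegral_iff_ofReal (ae_of_all _ fun x => abs_nonneg _)] at this
    exact this.ne
  have hle : ∫⁻ x, ENNReal.ofReal (-Real.logb 2 (p x)) ∂P ≤
      ENNReal.ofReal (1 / Real.log 2) * (∫⁻ x, ENNReal.ofReal |Real.log (q x)| ∂P +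
        ∫⁻ x, ENNReal.ofReal (q x / p x) ∂P) := by
    have hm : Measurable fun x => ENNReal.ofReal |Real.log (q x)| :=
      (_root_.continuous_abs.measurable.comp (Real.measurable_log.comp hq)).ennreal_ofReal
    have hm2 : Measurable fun x => ENNReal.ofReal (q x / p x) :=
      (hq.div h.measurable).ennreal_ofReal
    have hm3 : Measurable fun x => ENNReal.ofReal |Real.log (q x)| +
        ENNReal.ofReal (q x / p x) := hm.add hm2
    rw [← lintegral_add_left hm, ← lintegral_const_mul _ hm3]
    refine lintegral_mono_ae ?_
    filter_upwards [hq0, h.ae_pos] with x h1 h2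
    rw [← ENNReal.ofReal_add (abs_nonneg _) (div_pos h1 h2).le,
      ← ENNReal.ofReal_mul (by positivity)]
    refine ENNReal.ofReal_le_ofReal ?_
    have h3 := Real.log_le_sub_one_of_pos (div_pos h1 h2)
    rw [Real.log_div h1.ne' h2.ne'] at h3
    rw [Real.logb, ← neg_div, one_div_mul_eq_div]
    refine div_le_div_of_nonneg_right ?_ hlog2.le
    linarith [neg_abs_le (Real.log (q x))]
  refine ne_top_of_le_ne_top (ENNReal.mul_ne_top ENNReal.ofReal_ne_top ?_) hle
  exact ENNReal.add_ne_top.2 ⟨hl, ne_top_of_le_ne_top ENNReal.one_ne_top hr⟩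

theorem lintegral_ofReal_log_eq (φ : X → ℝ) :
    ∫⁻ x, ENNReal.ofReal (φ x) ∂P = ENNReal.ofReal (Real.log 2) *
      ∫⁻ x, ENNReal.ofReal (φ x / Real.log 2) ∂P := by
  have hlog2 : 0 < Real.log 2 := Real.log_pos one_lt_two
  rw [← lintegral_const_mul' _ _ ENNReal.ofReal_ne_top]
  refine lintegral_congr fun x => ?_
  rw [← ENNReal.ofReal_mul hlog2.le, mul_div_cancel₀ _ hlog2.ne']

theorem densityEntropy_eq_integral (hi : Integrable (fun x => Real.log (p x)) P) :
    densityEntropy P p = ((-(∫ x, Real.log (p x) ∂P) / Real.log 2 : ℝ) : EReal) := by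
  have hi' : Integrable (fun x => Real.logb 2 (p x)) P := hi.div_const _
  have hi2 : Integrable (fun x => -Real.logb 2 (p x)) P := hi'.neg
  have h2 : -(∫ x, Real.log (p x) ∂P) / Real.log 2 = -∫ x, Real.logb 2 (p x) ∂P := by
    rw [neg_div, ← integral_div]
    rfl
  rw [h2, integral_eq_lintegral_pos_part_sub_lintegral_neg_part hi', densityEntropy, neg_sub,
    EReal.coe_sub, EReal.coe_ennreal_toReal hi2.lintegral_lt_top.ne,
    EReal.coe_ennreal_toReal hi'.lintegral_lt_top.ne]

theorem enorm_eq_ofReal_add (x : ℝ) : ‖x‖ₑ = ENNReal.ofReal x + ENNReal.ofReal (-x) := by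
  rw [← ofReal_norm, Real.norm_eq_abs]
  rcases le_total 0 x with h | h
  · rw [abs_of_nonneg h, ENNReal.ofReal_of_nonpos (neg_nonpos.2 h), add_zero]
  · rw [abs_of_nonpos h, ENNReal.ofReal_of_nonpos h, zero_add]

/-- If the entropy is finite it is an integral. -/
theorem integrable_log_of_densityEntropy_ne_bot (hp : Measurable p)
    (hpos : ∫⁻ x, ENNReal.ofReal (-Real.logb 2 (p x)) ∂P ≠ ∞) (hbot : densityEntropy P p ≠ ⊥) :
    Integrable (fun x => Real.log (p x)) P ∧
      densityEntropy P p = ((-(∫ x, Real.log (p x) ∂P) / Real.log 2 : ℝ) : EReal) := by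
  have hlog2 : 0 < Real.log 2 := Real.log_pos one_lt_two
  have hl := measurable_logb hp
  have hneg : ∫⁻ x, ENNReal.ofReal (Real.logb 2 (p x)) ∂P ≠ ∞ := by
    intro htop
    apply hbot
    rw [densityEntropy, htop]
    simp
  have hi : Integrable (fun x => Real.logb 2 (p x)) P := by
    refine ⟨hl.aestronglyMeasurable, ?_⟩
    rw [HasFiniteIntegral]
    simp only [enorm_eq_ofReal_add]
    rw [lintegral_add_left hl.ennreal_ofReal]
    exact ENNReal.add_lt_top.2 ⟨hneg.lt_top, hpos.lt_top⟩
  have hi' : Integrable (fun x => Real.log (p x)) P := by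
    have := hi.mul_const (Real.log 2)
    refine this.congr (ae_of_all _ fun x => ?_)
    change Real.logb 2 (p x) * Real.log 2 = _
    rw [Real.logb, div_mul_cancel₀ _ hlog2.ne']
  exact ⟨hi', densityEntropy_eq_integral hi'⟩

/-- If the entropy is below `-r` (in nats) then some integrable minorant of `log p` has an integral
above `r`.  For the entropy `-∞` the minorant is a truncation of `log p`, otherwise it is `log p`
itself. -/
theorem exists_integrable_le_log (hp : Measurable p)
    (hpos : ∫⁻ x, ENNReal.ofReal (-Real.logb 2 (p x)) ∂P ≠ ∞) [IsProbabilityMeasure P] {r : ℝ}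
    (hr : densityEntropy P p < ((-r / Real.log 2 : ℝ) : EReal)) :
    ∃ φ : X → ℝ, Measurable φ ∧ Integrable φ P ∧ (∀ x, φ x ≤ Real.log (p x)) ∧
      r < ∫ x, φ x ∂P := by
  have hlog2 : 0 < Real.log 2 := Real.log_pos one_lt_two
  have hlm : Measurable fun x => Real.log (p x) := Real.measurable_log.comp hp
  by_cases hbot : densityEntropy P p = ⊥
  · have htop : ∫⁻ x, ENNReal.ofReal (Real.log (p x)) ∂P = ∞ := by
      rw [lintegral_ofReal_log_eq]
      have : ∫⁻ x, ENNReal.ofReal (Real.log (p x) / Real.log 2) ∂P = ∞ := by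
        by_contra hne
        rw [densityEntropy] at hbot
        change _ - ((∫⁻ x, ENNReal.ofReal (Real.log (p x) / Real.log 2) ∂P : ℝ≥0∞) : EReal) = ⊥
          at hbot
        rw [← EReal.coe_ennreal_toReal hne, ← EReal.coe_ennreal_toReal hpos,
          ← EReal.coe_sub] at hbot
        exact EReal.coe_ne_bot _ hbot
      rw [this, ENNReal.mul_top (by simpa using hlog2)]
    have hneg : ∫⁻ x, ENNReal.ofReal (-Real.log (p x)) ∂P ≠ ∞ := by
      rw [lintegral_ofReal_log_eq]
      refine ENNReal.mul_ne_top ENNReal.ofReal_ne_top ?_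
      simpa only [neg_div, Real.logb] using hpos
    set φ : ℕ → X → ℝ := fun k x => min (Real.log (p x)) k
    have hφm : ∀ k, Measurable (φ k) := fun k => hlm.min measurable_const
    have hφneg : ∀ k x, ENNReal.ofReal (-φ k x) = ENNReal.ofReal (-Real.log (p x)) := by
      intro k x
      rcases le_total (Real.log (p x)) k with h | h
      · simp only [φ, min_eq_left h]
      · have h0 : (0 : ℝ) ≤ k := Nat.cast_nonneg k
        simp only [φ, min_eq_right h]
        rw [ENNReal.ofReal_of_nonpos (by linarith), ENNReal.ofReal_of_nonpos (by linarith)]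
    have hφpos : ∀ k, ∫⁻ x, ENNReal.ofReal (φ k x) ∂P ≠ ∞ := by
      intro k
      refine ne_top_of_le_ne_top (ENNReal.ofReal_ne_top (r := (k : ℝ))) ?_
      calc _ ≤ ∫⁻ _, ENNReal.ofReal (k : ℝ) ∂P :=
            lintegral_mono fun x => ENNReal.ofReal_le_ofReal (min_le_right _ _)
        _ = _ := by simp
    have hφi : ∀ k, Integrable (φ k) P := by
      intro k
      refine ⟨(hφm k).aestronglyMeasurable, ?_⟩
      rw [HasFiniteIntegral]
      simp only [enorm_eq_ofReal_add]
      rw [lintegral_add_left (hφm k).ennreal_ofReal]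
      refine ENNReal.add_lt_top.2 ⟨(hφpos k).lt_top, ?_⟩
      simp only [hφneg]
      exact hneg.lt_top
    have hsup : ⨆ k, ∫⁻ x, ENNReal.ofReal (φ k x) ∂P = ∞ := by
      rw [← htop, ← lintegral_iSup (fun k => (hφm k).ennreal_ofReal)]
      · refine lintegral_congr fun x => ?_
        refine le_antisymm (iSup_le fun k => ENNReal.ofReal_le_ofReal (min_le_left _ _)) ?_
        obtain ⟨k, hk⟩ := exists_nat_ge (Real.log (p x))
        refine le_iSup_of_le k (ENNReal.ofReal_le_ofReal ?_)
        simp only [φ, min_eq_left hk, le_refl]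
      · intro k l hkl x
        refine ENNReal.ofReal_le_ofReal (min_le_min_left _ ?_)
        exact_mod_cast hkl
    set B := (∫⁻ x, ENNReal.ofReal (-Real.log (p x)) ∂P).toReal
    obtain ⟨k, hk⟩ := lt_iSup_iff.1 (hsup ▸ ENNReal.ofReal_lt_top (r := |r| + B) :
      ENNReal.ofReal (|r| + B) < ⨆ k, ∫⁻ x, ENNReal.ofReal (φ k x) ∂P)
    refine ⟨φ k, hφm k, hφi k, fun x => min_le_left _ _, ?_⟩
    rw [integral_eq_lintegral_pos_part_sub_lintegral_neg_part (hφi k)]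
    simp only [hφneg]
    have h1 := (ENNReal.ofReal_lt_iff_lt_toReal (by positivity) (hφpos k)).1 hk
    change r < _ - B
    linarith [le_abs_self r]
  · obtain ⟨h1, h2⟩ := integrable_log_of_densityEntropy_ne_bot hp hpos hbot
    refine ⟨_, hlm, h1, fun x => le_rfl, ?_⟩
    rw [h2, EReal.coe_lt_coe_iff, div_lt_div_iff_of_pos_right hlog2, neg_lt_neg_iff] at hr
    exact hr

end Entropy

section OutputEntropy

variable {T : Type} [LinearOrder T] [AddCommMonoid T] [Sub T] [MeasurableSpace T]
  [IsOrderedCancelAddMonoid T] [OrderedSub T] [ExistsAddOfLE T]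
  [TopologicalSpace T] [OrderClosedTopology T] [SecondCountableTopology T] [BorelSpace T]
  [MeasurableAdd₂ T] [MeasurableSub₂ T]
  {m : Measure T} [SigmaFinite m] {ν α : Measure T} [IsProbabilityMeasure ν]
  [IsProbabilityMeasure α] {ι f g : T → ℝ} {c₀ c₁ : ℝ}

theorem IsLogAffine.integrable_log_prod (hg : IsLogAffine m ι g c₀ c₁) (hι : IsClock ι) {n : ℕ}
    {PD : Measure (Fin n → T)} [IsProbabilityMeasure PD] (hpy : ∀ᵐ y ∂PD, ∀ i, 0 < y i)
    (hfin : ∫⁻ y, ENNReal.ofReal (ι (∑ i, y i)) ∂PD ≠ ∞) :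
    Integrable (fun y => Real.log (∏ i, g (y i))) PD := by
  have htm : Measurable fun y : Fin n → T => ι (∑ i, y i) :=
    hι.measurable.comp (Finset.measurable_sum _ fun i _ => measurable_pi_apply i)
  have ht0 : ∀ᵐ y ∂PD, 0 ≤ ι (∑ i, y i) := by
    filter_upwards [hpy] with y hy
    rw [← hι.zero]
    exact hι.strictMono.monotone (Finset.sum_nonneg fun i _ => (hy i).le)
  have htint : Integrable (fun y : Fin n → T => ι (∑ i, y i)) PD := by
    refine ⟨htm.aestronglyMeasurable, ?_⟩
    rw [hasFiniteIntegral_iff_ofReal ht0]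
    exact hfin.lt_top
  refine ((integrable_const (n * c₀)).sub (htint.const_mul c₁)).congr ?_
  filter_upwards [hpy] with y hy
  exact (hg.log_prod hι hy).2.symm

theorem IsLogAffine.lintegral_prod_le (hg : IsLogAffine m ι g c₀ c₁) (n : ℕ) :
    ∫⁻ y, ENNReal.ofReal (∏ i, g (y i)) ∂(Measure.pi fun _ : Fin n => m) ≤ 1 := by
  have : ∀ y : Fin n → T, ENNReal.ofReal (∏ i, g (y i)) = ∏ i, ENNReal.ofReal (g (y i)) := fun y =>
    ENNReal.ofReal_prod_of_nonneg fun i _ => hg.nonneg _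
  simp only [this]
  rw [lintegral_pi_prod m fun i => hg.measurable.ennreal_ofReal]
  exact Finset.prod_le_one' fun i _ => hg.lintegral_le

/-- The hypothesis on the output entropies in terms of real integrals.  The entropies are eventually
finite: they are bounded above by the comparison with the i.i.d. density, and below by the limit
inferior. -/
theorem hasOutputEntropy_of_le_liminf (hι : IsClock ι) (hα : ∀ᵐ x ∂α, 0 ≤ x)
    (hpos : ∀ᵐ x ∂ν, 0 < x) (hg : IsLogAffine m ι g c₀ c₁) (Q : Discipline T)
    {ex es : ℝ} (hes : 0 ≤ es) (hle : es ≤ ex)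
    (hex : ∫⁻ x, ENNReal.ofReal (ι x) ∂α = ENNReal.ofReal ex)
    (hesν : ∫⁻ x, ENNReal.ofReal (ι x) ∂ν = ENNReal.ofReal es)
    {ρ : ∀ n : ℕ, (Fin n → T) → ℝ} (hρ : ∀ n, IsDensity (Measure.pi fun _ : Fin n => m) (ρ n)
      (Q.interdepartureLaw ν α n)) {h : ℝ}
    (hlim : ((h / Real.log 2 : ℝ) : EReal) ≤
      liminf (fun n : ℕ => densityEntropy (Q.interdepartureLaw ν α n) (ρ n) / (n : EReal)) atTop) :
    HasOutputEntropy Q m ν α h := by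
  intro δ hδ
  have hlog2 : 0 < Real.log 2 := Real.log_pos one_lt_two
  have hlt : (((h - δ) / Real.log 2 : ℝ) : EReal) < liminf (fun n : ℕ =>
      densityEntropy (Q.interdepartureLaw ν α n) (ρ n) / (n : EReal)) atTop := by
    refine lt_of_lt_of_le (EReal.coe_lt_coe_iff.2 ?_) hlim
    exact div_lt_div_of_pos_right (by linarith) hlog2
  filter_upwards [eventually_lt_of_lt_liminf hlt,
    eventually_lintegral_sum_interdepartureLaw_le hι hα hpos Q hes hle hex hesν one_pos,
    eventually_gt_atTop 0] with n hn hsum hn0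
  have : IsProbabilityMeasure (Q.interdepartureLaw ν α n) :=
    isProbabilityMeasure_interdepartureLaw Q n
  have hn0' : (0 : ℝ) < n := by exact_mod_cast hn0
  have hpy := ae_pos_interdepartureLaw hα hpos Q n
  have hq : Measurable fun y : Fin n → T => ∏ i, g (y i) :=
    Finset.measurable_prod _ fun i _ => hg.measurable.comp (measurable_pi_apply i)
  have hfin := (hρ n).lintegral_neg_logb_ne_top hq
    (hpy.mono fun y hy => (hg.log_prod hι hy).1) (hg.lintegral_prod_le n)
    (hg.integrable_log_prod hι hpy (ne_top_of_le_ne_top ENNReal.ofReal_ne_top hsum))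
  have hbot : densityEntropy (Q.interdepartureLaw ν α n) (ρ n) ≠ ⊥ := by
    intro hb
    rw [hb, EReal.bot_div_of_pos_ne_top (by exact_mod_cast hn0) (EReal.natCast_ne_top n)] at hn
    exact not_lt_bot hn
  obtain ⟨h1, h2⟩ := integrable_log_of_densityEntropy_ne_bot (hρ n).measurable hfin hbot
  refine ⟨ρ n, hρ n, h1, ?_⟩
  rw [h2, ← EReal.coe_coe_eq_natCast, ← EReal.coe_div, EReal.coe_lt_coe_iff, div_div,
    div_lt_div_iff₀ hlog2 (by positivity)] at hn
  have h3 : (h - δ) * n < -∫ y, Real.log (ρ n y) ∂(Q.interdepartureLaw ν α n) := by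
    nlinarith
  linarith

end OutputEntropy

/-! ### The capacity formula in terms of output entropies -/

section CapacityFormula

variable {T : Type} [LinearOrder T] [AddCommMonoid T] [Sub T] [MeasurableSpace T]
  [IsOrderedCancelAddMonoid T] [OrderedSub T] [ExistsAddOfLE T]
  [TopologicalSpace T] [OrderClosedTopology T] [SecondCountableTopology T] [BorelSpace T]
  [MeasurableAdd₂ T] [MeasurableSub₂ T]
  {m : Measure T} [SigmaFinite m] {ν : Measure T} [IsProbabilityMeasure ν]
  {ι f : T → ℝ} {μ : ℝ} {α : ℝ → Measure T} {g : ℝ → T → ℝ} {c₀ c₁ H : ℝ → ℝ}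

/-- The laws `α θ` of the interarrivals for the rates `θ` below `μ`, with log-affine densities
`g θ` and with entropies `H θ` (in nats).  The entropy is also required at the rate `μ` itself,
where it may only be a limit. -/
structure IsInputFamily (m : Measure T) (ι : T → ℝ) (μ : ℝ) (α : ℝ → Measure T)
    (g : ℝ → T → ℝ) (c₀ c₁ H : ℝ → ℝ) : Prop where
  prob : ∀ θ, 0 < θ → θ < μ → IsProbabilityMeasure (α θ)
  nonneg : ∀ θ, 0 < θ → θ < μ → ∀ᵐ x ∂α θ, 0 ≤ x
  mean : ∀ θ, 0 < θ → θ < μ → ∫⁻ x, ENNReal.ofReal (ι x) ∂α θ = ENNReal.ofReal (1 / θ)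
  logAffine : ∀ θ, 0 < θ → θ < μ → IsLogAffine m ι (g θ) (c₀ θ) (c₁ θ)
  pos : ∀ θ, 0 < θ → θ < μ → 0 < c₁ θ
  entropy_eq : ∀ θ, 0 < θ → θ < μ → H θ = c₁ θ * (1 / θ) - c₀ θ
  continuousOn : ContinuousOn H (Set.Ioc 0 μ)
  tendsto : ∀ lam, 0 < lam → lam ≤ μ →
    Tendsto (fun θ => c₁ θ / lam - c₀ θ) (𝓝[<] lam) (𝓝 (H lam))

theorem eventually_nhdsLT_pos {lam : ℝ} (h : 0 < lam) : ∀ᶠ θ in 𝓝[<] lam, 0 < θ ∧ θ < lam := by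
  filter_upwards [Ioo_mem_nhdsLT h] with θ hθ using hθ

/-- The converse part of the capacity formula.  The auxiliary output law has a rate `θ` that
increases to `lam`; the choice `θ = lam` is not possible for geometric laws if `lam = 1`. -/
theorem feedbackCapacity_le_of_isInputFamily (hm : IsReference m) (hι : IsClock ι)
    (hf : IsDensity m f ν) (hlog : Integrable (fun x => Real.log (f x)) ν)
    (hpos : ∀ᵐ x ∂ν, 0 < x) (hfam : IsInputFamily m ι μ α g c₀ c₁ H) (Q : Discipline T) {lam : ℝ}
    (hlam : 0 < lam) (hle : lam ≤ μ) :
    Q.feedbackCapacity ν ι lam ≤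
      ((lam * ((∫ x, Real.log (f x) ∂ν) + H lam) / Real.log 2 : ℝ) : EReal) := by
  have hlim : Tendsto (fun θ => ((lam * ((∫ x, Real.log (f x) ∂ν) +
      (c₁ θ / lam - c₀ θ)) / Real.log 2 : ℝ) : EReal)) (𝓝[<] lam)
      (𝓝 ((lam * ((∫ x, Real.log (f x) ∂ν) + H lam) / Real.log 2 : ℝ) : EReal)) := by
    refine (continuous_coe_real_ereal.tendsto _).comp ?_
    exact (((hfam.tendsto lam hlam hle).const_add _).const_mul lam).div_const _
  refine ge_of_tendsto hlim ?_
  filter_upwards [eventually_nhdsLT_pos hlam] with θ hθ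
  have h := feedbackCapacity_le hm hι hf hlog hpos (hfam.logAffine θ hθ.1 (hθ.2.trans_le hle))
    (hfam.pos θ hθ.1 (hθ.2.trans_le hle)).le Q hlam
  refine h.trans (le_of_eq ?_)
  congr 3
  ring

/-- The achievability part of the capacity formula.  The interarrivals have a rate slightly above
the output rate, so that most codebooks of i.i.d. codewords satisfy the constraint on the mean of
the last departure time. -/
theorem achievable_of_lt_entropy (hm : IsReference m) (hι : IsClock ι) (hf : IsDensity m f ν)
    (hpos : ∀ᵐ x ∂ν, 0 < x) (hμ : 0 < μ)
    (hmean : ∫⁻ x, ENNReal.ofReal (ι x) ∂ν = ENNReal.ofReal (1 / μ))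
    (hfam : IsInputFamily m ι μ α g c₀ c₁ H) (Q : Discipline T)
    (hfull : ∀ θ, 0 < θ → θ < μ → HasOutputEntropy Q m ν (α θ) (H θ))
    {φ : T → ℝ} (hφm : Measurable φ) (hφi : Integrable φ ν) (hφ : ∀ᵐ x ∂ν, φ x ≤ Real.log (f x))
    {lam R : ℝ} (hlam : 0 < lam) (hlt : lam < μ)
    (hR : R * Real.log 2 < lam * ((∫ x, φ x ∂ν) + H lam)) :
    Achievable (Q.HasCode ν ι) lam R := by
  have hlog2 : 0 < Real.log 2 := Real.log_pos one_lt_two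
  rcases le_or_gt R 0 with hR0 | hR0
  · exact (achievable_zero hι hpos hmean Q hlam hlt.le).mono hR0
  set r := R * Real.log 2 / lam with hr
  have hr1 : r < (∫ x, φ x ∂ν) + H lam := by
    rw [hr, div_lt_iff₀ hlam]; linarith
  have hcont : Tendsto (fun θ => (∫ x, φ x ∂ν) + H θ) (𝓝[>] lam) (𝓝 ((∫ x, φ x ∂ν) + H lam)) := by
    refine Tendsto.const_add _ ((hfam.continuousOn lam ⟨hlam, hlt.le⟩).tendsto.mono_left ?_)
    refine nhdsWithin_le_iff.2 ?_
    filter_upwards [Ioo_mem_nhdsGT hlt] with θ hθ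
    exact ⟨hlam.trans hθ.1, hθ.2.le⟩
  obtain ⟨θ, hθr, hθ⟩ := ((hcont.eventually (lt_mem_nhds hr1)).and (Ioo_mem_nhdsGT hlt)).exists
  have hθ0 : 0 < θ := hlam.trans hθ.1
  have := hfam.prob θ hθ0 hθ.2
  have hent := hfam.entropy_eq θ hθ0 hθ.2
  have hach := achievable_of_lt (α := α θ) hm hι hf (hfam.nonneg θ hθ0 hθ.2) hpos
    (hfam.logAffine θ hθ0 hθ.2) (hfam.pos θ hθ0 hθ.2) hφm hφi hφ Q (ex := 1 / θ) (es := 1 / μ)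
    (by positivity) (one_div_le_one_div_of_le hθ0 hθ.2.le) (hfam.mean θ hθ0 hθ.2) hmean
    (by rw [← hent]; exact hfull θ hθ0 hθ.2) hlam (one_div_lt_one_div_of_lt hlam hθ.1)
    (r := r) (by positivity) (by rw [hent] at hθr; linarith)
  have h1 : lam * (r / Real.log 2) = R := by rw [hr]; field_simp
  rwa [h1] at hach

/-- The capacity formula at output rates below the service rate. -/
theorem capacity_eq_of_lt (hm : IsReference m) (hι : IsClock ι) (hf : IsDensity m f ν)
    (hpos : ∀ᵐ x ∂ν, 0 < x) (hμ : 0 < μ)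
    (hmean : ∫⁻ x, ENNReal.ofReal (ι x) ∂ν = ENNReal.ofReal (1 / μ))
    (hfam : IsInputFamily m ι μ α g c₀ c₁ H) (Q : Discipline T)
    (hfull : ∀ θ, 0 < θ → θ < μ → HasOutputEntropy Q m ν (α θ) (H θ))
    (hfin : ∫⁻ x, ENNReal.ofReal (-Real.logb 2 (f x)) ∂ν ≠ ∞)
    {lam : ℝ} (hlam : 0 < lam) (hlt : lam < μ) :
    Q.feedbackCapacity ν ι lam = Q.capacity ν ι lam ∧
      Q.capacity ν ι lam =
        (lam : EReal) * (((H lam / Real.log 2 : ℝ) : EReal) - densityEntropy ν f) := by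
  have hlog2 : 0 < Real.log 2 := Real.log_pos one_lt_two
  have hCF := capacity_le_feedbackCapacity (ν := ν) (ι := ι) Q lam
  -- if the service entropy is `-∞`, truncation makes every real rate achievable
  by_cases hbot : densityEntropy ν f = ⊥
  · have htop : Q.capacity ν ι lam = ⊤ := by
      refine EReal.eq_top_iff_forall_lt _ |>.2 fun R => ?_
      have hachR : Achievable (Q.HasCode ν ι) lam (R + 1) := by
        obtain ⟨φ, h1, h2, h3, h4⟩ := exists_integrable_le_log hf.measurable hfin
          (r := (R + 1) * Real.log 2 / lam - H lam) (by rw [hbot]; exact EReal.bot_lt_coe _)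
        refine achievable_of_lt_entropy hm hι hf hpos hμ hmean hfam Q hfull h1 h2
          (ae_of_all _ h3) hlam hlt ?_
        rw [sub_lt_iff_lt_add, div_lt_iff₀ hlam] at h4
        linarith
      refine lt_of_lt_of_le ?_ (le_sSup (Set.mem_image_of_mem _ hachR))
      exact EReal.coe_lt_coe_iff.2 (by linarith)
    rw [htop, top_le_iff] at hCF
    rw [hCF, htop, hbot]
    refine ⟨rfl, ?_⟩
    rw [EReal.coe_sub_bot, EReal.mul_top_of_pos (by exact_mod_cast hlam)]
  · obtain ⟨hlog, hent⟩ := integrable_log_of_densityEntropy_ne_bot hf.measurable hfin hbot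
    have hle := feedbackCapacity_le_of_isInputFamily hm hι hf hlog hpos hfam Q hlam hlt.le
    set R₀ := lam * ((∫ x, Real.log (f x) ∂ν) + H lam) / Real.log 2 with hR₀
    have hach : Achievable (Q.HasCode ν ι) lam R₀ := by
      intro γ hγ
      have h1 : Achievable (Q.HasCode ν ι) lam (R₀ - γ / 2) := by
        refine achievable_of_lt_entropy hm hι hf hpos hμ hmean hfam Q hfull
          (Real.measurable_log.comp hf.measurable) hlog (ae_of_all _ fun x => le_rfl) hlam hlt ?_
        have h2 : R₀ * Real.log 2 = lam * ((∫ x, Real.log (f x) ∂ν) + H lam) := by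
          rw [hR₀]; field_simp
        have h3 : (∫ x, (Real.log ∘ f) x ∂ν) = ∫ x, Real.log (f x) ∂ν := rfl
        rw [h3, ← h2]
        nlinarith [mul_pos hγ hlog2]
      obtain ⟨M, ε, hε, hev⟩ := h1 (γ / 2) (by positivity)
      exact ⟨M, ε, hε, hev.mono fun n hn => ⟨hn.1, by linarith [hn.2]⟩⟩
    have hge : (R₀ : EReal) ≤ Q.capacity ν ι lam := le_sSup (Set.mem_image_of_mem _ hach)
    have hR : (lam : EReal) * (((H lam / Real.log 2 : ℝ) : EReal) - densityEntropy ν f) = R₀ := by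
      rw [hent, ← EReal.coe_sub, ← EReal.coe_mul, hR₀]
      congr 1
      ring
    rw [hR]
    exact ⟨le_antisymm (hle.trans hge) hCF, le_antisymm (hCF.trans hle) hge⟩

/-- At the output rate `μ` the capacity vanishes as soon as the service entropy is at least that
of the interarrivals. -/
theorem capacity_eq_of_entropy_le (hm : IsReference m) (hι : IsClock ι) (hf : IsDensity m f ν)
    (hpos : ∀ᵐ x ∂ν, 0 < x) (hμ : 0 < μ)
    (hmean : ∫⁻ x, ENNReal.ofReal (ι x) ∂ν = ENNReal.ofReal (1 / μ))
    (hfam : IsInputFamily m ι μ α g c₀ c₁ H) (Q : Discipline T)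
    (hfin : ∫⁻ x, ENNReal.ofReal (-Real.logb 2 (f x)) ∂ν ≠ ∞)
    (hle : ((H μ / Real.log 2 : ℝ) : EReal) ≤ densityEntropy ν f) :
    Q.feedbackCapacity ν ι μ = Q.capacity ν ι μ ∧
      Q.capacity ν ι μ =
        (μ : EReal) * (((H μ / Real.log 2 : ℝ) : EReal) - densityEntropy ν f) := by
  have hlog2 : 0 < Real.log 2 := Real.log_pos one_lt_two
  have hCF := capacity_le_feedbackCapacity (ν := ν) (ι := ι) Q μ
  have hbot : densityEntropy ν f ≠ ⊥ := fun h => by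
    rw [h] at hle
    exact not_le_of_gt (EReal.bot_lt_coe _) hle
  obtain ⟨hlog, hent⟩ := integrable_log_of_densityEntropy_ne_bot hf.measurable hfin hbot
  have hCFle := feedbackCapacity_le_of_isInputFamily hm hι hf hlog hpos hfam Q hμ le_rfl
  have h0 : ((0 : ℝ) : EReal) ≤ Q.capacity ν ι μ :=
    le_sSup (Set.mem_image_of_mem _ (achievable_zero hι hpos hmean Q hμ le_rfl))
  have hR : (μ : EReal) * (((H μ / Real.log 2 : ℝ) : EReal) - densityEntropy ν f) =
      ((μ * ((∫ x, Real.log (f x) ∂ν) + H μ) / Real.log 2 : ℝ) : EReal) := by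
    rw [hent, ← EReal.coe_sub, ← EReal.coe_mul]
    congr 1
    ring
  have hR0 : ((μ * ((∫ x, Real.log (f x) ∂ν) + H μ) / Real.log 2 : ℝ) : EReal) ≤ (0 : ℝ) := by
    rw [hent, EReal.coe_le_coe_iff, div_le_div_iff_of_pos_right hlog2] at hle
    refine EReal.coe_le_coe_iff.2 (div_nonpos_of_nonpos_of_nonneg ?_ hlog2.le)
    exact mul_nonpos_of_nonneg_of_nonpos hμ.le (by linarith)
  rw [hR]
  exact ⟨le_antisymm ((hCFle.trans hR0).trans h0) hCF,
    le_antisymm (hCF.trans hCFle) (hR0.trans h0)⟩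

end CapacityFormula

/-! ### First in first out at the critical rate -/

/-- Drawing one coordinate afresh does not change a product measure. -/
theorem measurePreserving_update {X : Type*} [MeasurableSpace X] (P : Measure X)
    [IsProbabilityMeasure P] {n : ℕ} (i : Fin n) :
    MeasurePreserving (fun p : (Fin n → X) × X => Function.update p.1 i p.2)
      ((Measure.pi fun _ : Fin n => P).prod P) (Measure.pi fun _ : Fin n => P) := by
  have hm : Measurable fun p : (Fin n → X) × X => Function.update p.1 i p.2 := by
    refine measurable_pi_lambda _ fun j => ?_
    by_cases h : j = i
    · subst h; simpa using measurable_snd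
    · simp only [Function.update_of_ne h]
      exact (measurable_pi_apply j).comp measurable_fst
  refine ⟨hm, (Measure.pi_eq fun s hs => ?_).symm⟩
  rw [Measure.map_apply hm (MeasurableSet.univ_pi hs)]
  have : (fun p : (Fin n → X) × X => Function.update p.1 i p.2) ⁻¹' Set.univ.pi s =
      (Set.univ.pi (Function.update s i Set.univ)) ×ˢ s i := by
    ext ⟨x, y⟩
    simp only [Set.mem_preimage, Set.mem_pi, Set.mem_univ, true_imp_iff, Set.mem_prod]
    constructor
    · intro h
      refine ⟨fun j => ?_, by simpa using h i⟩
      by_cases hj : j = i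
      · subst hj; simp
      · simpa [Function.update_of_ne hj] using h j
    · rintro ⟨h1, h2⟩ j
      by_cases hj : j = i
      · subst hj; simpa using h2
      · simpa [Function.update_of_ne hj] using h1 j
  rw [this, Measure.prod_prod, Measure.pi_pi,
    ← Finset.prod_erase_mul _ _ (Finset.mem_univ i), Function.update_self, measure_univ, mul_one,
    ← Finset.prod_erase_mul (f := fun j => P (s j)) _ (Finset.mem_univ i)]
  congr 1
  refine Finset.prod_congr rfl fun j hj => ?_
  rw [Function.update_of_ne (Finset.ne_of_mem_erase hj)]

/-- A coordinate is independent of an event that does not depend on it. -/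
theorem integral_indicator_eval {X Y : Type*} [MeasurableSpace X] [MeasurableSpace Y]
    {PX : Measure X} [IsProbabilityMeasure PX] {P : Measure Y} [IsProbabilityMeasure P] {n : ℕ}
    (i : Fin n) {E : Set (X × (Fin n → Y))} (hE : MeasurableSet E)
    (hinv : ∀ x s y, (x, Function.update s i y) ∈ E ↔ (x, s) ∈ E) {φ : Y → ℝ}
    (hφ : Measurable φ) :
    ∫ p, E.indicator (fun p => φ (p.2 i)) p ∂(PX.prod (Measure.pi fun _ : Fin n => P)) =
      (PX.prod (Measure.pi fun _ : Fin n => P)).real E * ∫ y, φ y ∂P := by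
  set π := Measure.pi fun _ : Fin n => P
  have hmp : MeasurePreserving (fun q : (X × (Fin n → Y)) × Y =>
      (q.1.1, Function.update q.1.2 i q.2)) ((PX.prod π).prod P) (PX.prod π) :=
    ((MeasurePreserving.id PX).prod (measurePreserving_update P i)).comp
      (measurePreserving_prodAssoc PX π P)
  have hFm : Measurable (E.indicator fun p : X × (Fin n → Y) => φ (p.2 i)) :=
    (hφ.comp ((measurable_pi_apply i).comp measurable_snd)).indicator hE
  conv_lhs => rw [← hmp.map_eq]
  rw [integral_map hmp.measurable.aemeasurable hFm.aestronglyMeasurable]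
  have : ∀ q : (X × (Fin n → Y)) × Y, E.indicator (fun p : X × (Fin n → Y) => φ (p.2 i))
      (q.1.1, Function.update q.1.2 i q.2) = E.indicator (fun _ => (1 : ℝ)) q.1 * φ q.2 := by
    rintro ⟨⟨x, s⟩, y⟩
    by_cases h : (x, s) ∈ E
    · rw [Set.indicator_of_mem h, Set.indicator_of_mem ((hinv x s y).2 h)]
      simp
    · rw [Set.indicator_of_notMem h, Set.indicator_of_notMem (fun h' => h ((hinv x s y).1 h'))]
      simp
  simp only [this]
  rw [integral_prod_mul (fun p => E.indicator (fun _ => (1 : ℝ)) p) φ, integral_indicator hE]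
  simp

section Fifo

variable {T : Type} [LinearOrder T] [AddCommMonoid T] [Sub T] [MeasurableSpace T]
  [IsOrderedCancelAddMonoid T] [OrderedSub T] [ExistsAddOfLE T]

/-- The departure time of the packet before the `i`-th one. -/
noncomputable def previousDeparture {n : ℕ} (i : Fin n) (A s : Fin n → T) : T :=
  completion (extendZero (arrivalTimes A)) (extendZero s) i

variable [TopologicalSpace T] [OrderClosedTopology T] [SecondCountableTopology T] [BorelSpace T]
  [MeasurableAdd₂ T] [MeasurableSub₂ T]

theorem arrivalTimes_update_of_lt {n : ℕ} {i j : Fin n} (h : j < i) (A : Fin n → T) (x : T) :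
    arrivalTimes (Function.update A i x) j = arrivalTimes A j := by
  refine Finset.sum_congr rfl fun k hk => ?_
  rw [Function.update_of_ne ((Finset.mem_Iic.1 hk).trans_lt h).ne]

theorem previousDeparture_update_left {n : ℕ} (i : Fin n) (A s : Fin n → T) (x : T) :
    previousDeparture i (Function.update A i x) s = previousDeparture i A s := by
  refine completion_congr (fun j hj => ?_) fun _ _ => rfl
  rw [extendZero_apply _ (hj.trans i.2), extendZero_apply _ (hj.trans i.2),
    arrivalTimes_update_of_lt (Fin.lt_def.2 hj)]

theorem previousDeparture_update_right {n : ℕ} (i : Fin n) (A s : Fin n → T) (x : T) :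
    previousDeparture i A (Function.update s i x) = previousDeparture i A s := by
  refine completion_congr (fun _ _ => rfl) fun j hj => ?_
  rw [extendZero_apply _ (hj.trans i.2), extendZero_apply _ (hj.trans i.2),
    Function.update_of_ne (Fin.lt_def.2 hj).ne]

theorem arrivalTimes_eq_add {n : ℕ} (i : Fin n) (A : Fin n → T) :
    arrivalTimes A i = ∑ j ∈ Finset.Iio i, A j + A i := by
  rw [arrivalTimes, ← Finset.Iio_insert, Finset.sum_insert (by simp), add_comm]

theorem sum_Iio_le_previousDeparture {n : ℕ} (i : Fin n) {A s : Fin n → T}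
    (hs : ∀ i, 0 < s i) : ∑ j ∈ Finset.Iio i, A j ≤ previousDeparture i A s := by
  obtain ⟨i, hi⟩ := i
  rcases i with _ | k
  · have : Finset.Iio (⟨0, hi⟩ : Fin n) = ∅ := by
      ext j; simp [Fin.lt_def]
    rw [this, Finset.sum_empty]
    exact le_rfl
  · have hk : k < n := by omega
    have h1 : Finset.Iio (⟨k + 1, hi⟩ : Fin n) = Finset.Iic ⟨k, hk⟩ := by
      ext j; simp [Fin.lt_def, Fin.le_def]
    rw [h1, previousDeparture, completion, extendZero_apply _ hk, extendZero_apply _ hk]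
    exact (le_max_right _ _).trans (le_add_of_nonneg_right (hs _).le)

/-- Under FIFO the interdeparture is the sum of the idle time and the service time. -/
theorem previousDeparture_add_channel {n : ℕ} (i : Fin n) {A s : Fin n → T}
    (hA : ∀ i, 0 ≤ A i) (hs : ∀ i, 0 < s i) :
    previousDeparture i A s + (fifo T).channel A s i =
      max (previousDeparture i A s) (arrivalTimes A i) + s i := by
  have hin := isInput_arrivalTimes hA hs
  have h1 : (fifo T).departures (arrivalTimes A) s i =
      max (previousDeparture i A s) (arrivalTimes A i) + s i := by
    rw [fifo_departures hin, completion, extendZero_fin, extendZero_fin]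
    rfl
  have h2 : (fifo T).channel A s i = (fifo T).departures (arrivalTimes A) s i -
      previousDeparture i A s := by
    rw [Discipline.channel, interdepartures]
    congr 1
    obtain ⟨i, hi⟩ := i
    rcases i with _ | k
    · simp [previousDeparture, completion]
    · rw [if_pos (Nat.succ_pos k), fifo_departures hin]
      rfl
  rw [h2, add_tsub_cancel_of_le, h1]
  rw [h1]
  exact (le_max_left _ _).trans (le_add_of_nonneg_right (hs i).le)

theorem measurable_previousDeparture {n : ℕ} (i : Fin n) :
    Measurable fun p : (Fin n → T) × (Fin n → T) => previousDeparture i p.1 p.2 :=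
  measurable_completion (measurable_extendZero ((measurable_arrivalTimes n).comp measurable_fst))
    (measurable_extendZero measurable_snd) i

theorem measurable_arrivalTimes_apply {n : ℕ} (i : Fin n) :
    Measurable fun A : Fin n → T => arrivalTimes A i :=
  (measurable_pi_apply i).comp (measurable_arrivalTimes n)

theorem measurableSet_idle {n : ℕ} (i : Fin n) :
    MeasurableSet {p : (Fin n → T) × (Fin n → T) |
      previousDeparture i p.1 p.2 < arrivalTimes p.1 i} :=
  measurableSet_lt (measurable_previousDeparture i)
    ((measurable_arrivalTimes_apply i).comp measurable_fst)

variable {m : Measure T} [SigmaFinite m] {ν α : Measure T} [IsProbabilityMeasure ν]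
  [IsProbabilityMeasure α] {ι f g φ : T → ℝ} {c₀ c₁ : ℝ}

/-- The law `α` has no mass that is concentrated just above a given level: given that a waiting
time with this law exceeds a level, the mean excess is at least `1 / κ`. -/
def HasExcess (α : Measure T) (ι : T → ℝ) (κ : ℝ) : Prop :=
  ∀ b w : T, b ≤ w → α {x | w < b + x} ≤
    ENNReal.ofReal κ * ∫⁻ x, ENNReal.ofReal (ι b + ι x - ι w) ∂α

/-- A packet that finds the queue idle finds it idle for some time in the mean. -/
theorem measure_idle_le (hι : IsClock ι) (hpos : ∀ᵐ x ∂ν, 0 < x) {κ : ℝ}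
    (hex : HasExcess α ι κ) {n : ℕ} (i : Fin n) :
    ((Measure.pi fun _ : Fin n => α).prod (Measure.pi fun _ : Fin n => ν))
      {p | previousDeparture i p.1 p.2 < arrivalTimes p.1 i} ≤
    ENNReal.ofReal κ * ∫⁻ p, ENNReal.ofReal (ι (arrivalTimes p.1 i) -
      ι (previousDeparture i p.1 p.2))
      ∂((Measure.pi fun _ : Fin n => α).prod (Measure.pi fun _ : Fin n => ν)) := by
  have hmeas : Measurable fun p : (Fin n → T) × (Fin n → T) =>
      ENNReal.ofReal (ι (arrivalTimes p.1 i) - ι (previousDeparture i p.1 p.2)) :=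
    ((hι.measurable.comp ((measurable_arrivalTimes_apply i).comp measurable_fst)).sub
      (hι.measurable.comp (measurable_previousDeparture i))).ennreal_ofReal
  rw [Measure.prod_apply_symm (measurableSet_idle i), lintegral_prod_symm _ hmeas.aemeasurable,
    ← lintegral_const_mul' _ _ ENNReal.ofReal_ne_top]
  refine lintegral_mono_ae ?_
  filter_upwards [ae_pi_of_ae hpos n] with s hs
  have hmp := measurePreserving_update α i
  have hset : MeasurableSet {A : Fin n → T | previousDeparture i A s < arrivalTimes A i} :=
    measurable_prodMk_right (y := s) (measurableSet_idle i)
  have hfun : Measurable fun A : Fin n → T =>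
      ENNReal.ofReal (ι (arrivalTimes A i) - ι (previousDeparture i A s)) :=
    hmeas.comp measurable_prodMk_right
  have hfun' : Measurable fun p : (Fin n → T) × T => ENNReal.ofReal
      (ι (arrivalTimes (Function.update p.1 i p.2) i) -
        ι (previousDeparture i (Function.update p.1 i p.2) s)) := hfun.comp hmp.measurable
  have hau : ∀ (A : Fin n → T) x, arrivalTimes (Function.update A i x) i =
      ∑ j ∈ Finset.Iio i, A j + x := by
    intro A x
    rw [arrivalTimes_eq_add, Function.update_self]
    congr 1
    refine Finset.sum_congr rfl fun j hj => ?_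
    rw [Function.update_of_ne (Finset.mem_Iio.1 hj).ne]
  change (Measure.pi fun _ : Fin n => α) {A | previousDeparture i A s < arrivalTimes A i} ≤ _
  rw [← hmp.measure_preimage hset.nullMeasurableSet, Measure.prod_apply (hmp.measurable hset),
    ← hmp.lintegral_comp hfun, lintegral_prod _ hfun'.aemeasurable,
    ← lintegral_const_mul' _ _ ENNReal.ofReal_ne_top]
  refine lintegral_mono fun A => ?_
  have h := hex (∑ j ∈ Finset.Iio i, A j) (previousDeparture i A s)
    (sum_Iio_le_previousDeparture i hs)
  have e1 : Prod.mk A ⁻¹' ((fun p : (Fin n → T) × T => Function.update p.1 i p.2) ⁻¹'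
      {A | previousDeparture i A s < arrivalTimes A i}) =
      {x | previousDeparture i A s < ∑ j ∈ Finset.Iio i, A j + x} := by
    ext x
    simp only [Set.mem_preimage, Set.mem_ofPred_eq, previousDeparture_update_left, hau]
  rw [e1]
  refine h.trans (le_of_eq ?_)
  congr 1
  refine lintegral_congr fun x => ?_
  simp only [previousDeparture_update_left, hau, hι.add]

/-- Gibbs' inequality for the output of a first in first out queue.  The comparison density is a
mixture: while the queue is busy the interdepartures are service times, with density `f`, and the
packets that find the queue idle are taken care of by `g`. -/
theorem fifo_entropy_le (hι : IsClock ι) (hf : IsDensity m f ν)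
    (hα : ∀ᵐ x ∂α, 0 ≤ x) (hpos : ∀ᵐ x ∂ν, 0 < x) (hg : IsLogAffine m ι g c₀ c₁) (hc₁ : 0 < c₁)
    (hφm : Measurable φ) (hφi : Integrable φ ν) (hφ : ∀ᵐ x ∂ν, φ x ≤ Real.log (f x))
    {κ : ℝ} (hκ : 0 ≤ κ) (hexc : HasExcess α ι κ)
    {ex es h : ℝ} (hes : 0 ≤ es) (hle : es ≤ ex)
    (hex : ∫⁻ x, ENNReal.ofReal (ι x) ∂α = ENNReal.ofReal ex)
    (hesν : ∫⁻ x, ENNReal.ofReal (ι x) ∂ν = ENNReal.ofReal es)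
    (hfull : HasOutputEntropy (fifo T) m ν α h) {η : ℝ} (hη0 : 0 < η) (hη1 : η < 1) :
    Real.log (1 - η) + (∫ x, φ x ∂ν) + h ≤ (κ * |Real.log η + c₀ - Real.log (1 - η) -
      (∫ x, φ x ∂ν) - c₁ * es| + c₁) * (ex - es) := by
  obtain ⟨hιν, hmν⟩ := integrable_clock hι (hpos.mono fun x hx => hx.le) hesν hes
  set G := Real.log η + c₀ - Real.log (1 - η) - (∫ x, φ x ∂ν) - c₁ * es with hG
  set L := κ * |G| + c₁ with hL
  have hL0 : 0 < L := by positivity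
  refine le_of_forall_pos_le_add fun δ hδ => ?_
  obtain ⟨n, ⟨ρ, hρ, hint, hent⟩, hsum, hn⟩ := ((hfull (δ / 2) (by positivity)).and
    ((eventually_lintegral_completion_le hι hα (hpos.mono fun x hx => hx.le) hes hle hex hesν
      (η := δ / (2 * L)) (by positivity)).and (eventually_gt_atTop 0))).exists
  have hn0 : (0 : ℝ) < n := by exact_mod_cast hn
  set P := (Measure.pi fun _ : Fin n => α).prod (Measure.pi fun _ : Fin n => ν) with hP
  set D : (Fin n → T) × (Fin n → T) → Fin n → T := fun p => (fifo T).channel p.1 p.2 with hD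
  have hDm : Measurable D := (fifo T).measurable_channel_prod n
  have hPD : (fifo T).interdepartureLaw ν α n = P.map D := rfl
  have hbase := ae_prod_nonneg_pos hα hpos n
  -- the idle times
  set idle : Fin n → Set ((Fin n → T) × (Fin n → T)) := fun i =>
    {p | previousDeparture i p.1 p.2 < arrivalTimes p.1 i} with hidle
  have hidlem : ∀ i, MeasurableSet (idle i) := fun i => measurableSet_idle i
  set I : Fin n → (Fin n → T) × (Fin n → T) → ℝ := fun i p =>
    max 0 (ι (arrivalTimes p.1 i) - ι (previousDeparture i p.1 p.2)) with hI
  have hIm : ∀ i, Measurable (I i) := fun i => measurable_const.max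
    ((hι.measurable.comp ((measurable_arrivalTimes_apply i).comp measurable_fst)).sub
      (hι.measurable.comp (measurable_previousDeparture i)))
  have hI0 : ∀ i p, 0 ≤ I i p := fun i p => le_max_left _ _
  have hιD : ∀ᵐ p ∂P, ∀ i, ι (D p i) = ι (p.2 i) + I i p := by
    filter_upwards [hbase] with p hp i
    have h1 := congrArg ι (previousDeparture_add_channel i hp.1 hp.2)
    rw [hι.add, hι.add, hι.strictMono.monotone.map_max] at h1
    have h2 : I i p = max (ι (previousDeparture i p.1 p.2)) (ι (arrivalTimes p.1 i)) -
        ι (previousDeparture i p.1 p.2) := by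
      rw [hI, ← max_sub_sub_right, sub_self]
    rw [h2]
    change ι ((fifo T).channel p.1 p.2 i) = _
    linarith
  have hs_int : ∀ i, Integrable (fun p : (Fin n → T) × (Fin n → T) => ι (p.2 i)) P := fun i =>
    (integrable_comp_eval (μ := fun _ : Fin n => ν) (i := i) hιν).comp_snd _
  have hs_sum : ∫ p, ∑ i, ι (p.2 i) ∂P = n * es := by
    rw [hP, integral_fun_snd (fun s : Fin n → T => ∑ i, ι (s i)), integral_sum_pi hιν, hmν]
    simp
  set S : (Fin n → T) × (Fin n → T) → ℝ := fun p => ∑ i, ι (p.2 i) + ∑ i, I i p with hS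
  have hSm : Measurable S := (Finset.measurable_sum _ fun i _ =>
    hι.measurable.comp ((measurable_pi_apply i).comp measurable_snd)).add
      (Finset.measurable_sum _ fun i _ => hIm i)
  have hSc : ∀ᵐ p ∂P, S p = ι (completion (extendZero (arrivalTimes p.1)) (extendZero p.2) n) := by
    filter_upwards [hbase, hιD] with p hp h1
    rw [← (fifo T).sum_channel hp.1 hp.2, hι.sum]
    simp only [hS]
    rw [← Finset.sum_add_distrib]
    exact Finset.sum_congr rfl fun i _ => (h1 i).symm
  have hS0 : ∀ᵐ p ∂P, 0 ≤ S p := by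
    filter_upwards [hbase] with p hp
    refine add_nonneg (Finset.sum_nonneg fun i _ => ?_) (Finset.sum_nonneg fun i _ => hI0 i p)
    rw [← hι.zero]
    exact hι.strictMono.monotone (hp.2 i).le
  have hSl : ∫⁻ p, ENNReal.ofReal (S p) ∂P ≤ ENNReal.ofReal (n * (ex + δ / (2 * L))) := by
    refine le_trans (le_of_eq (lintegral_congr_ae ?_)) hsum
    filter_upwards [hSc] with p hp
    rw [hp]
  have hSi : Integrable S P := by
    refine ⟨hSm.aestronglyMeasurable, ?_⟩
    rw [hasFiniteIntegral_iff_ofReal hS0]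
    exact hSl.trans_lt ENNReal.ofReal_lt_top
  have hex0 : 0 ≤ ex := hes.trans hle
  have hSle : ∫ p, S p ∂P ≤ n * (ex + δ / (2 * L)) := by
    rw [integral_eq_lintegral_of_nonneg_ae hS0 hSm.aestronglyMeasurable]
    exact ENNReal.toReal_le_of_le_ofReal (by positivity) hSl
  have hIint : ∀ i, Integrable (I i) P := by
    intro i
    refine hSi.mono (hIm i).aestronglyMeasurable ?_
    filter_upwards [hbase] with p hp
    rw [Real.norm_of_nonneg (hI0 i p)]
    refine le_trans ?_ (le_abs_self _)
    have h1 : 0 ≤ ∑ i, ι (p.2 i) := Finset.sum_nonneg fun i _ => by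
      rw [← hι.zero]
      exact hι.strictMono.monotone (hp.2 i).le
    have h2 := Finset.single_le_sum (f := fun i => I i p) (fun i _ => hI0 i p) (Finset.mem_univ i)
    exact h2.trans (le_add_of_nonneg_left h1)
  have hIsum : ∑ i, ∫ p, I i p ∂P ≤ n * (ex - es + δ / (2 * L)) := by
    have h1 : ∫ p, S p ∂P = ∫ p, ∑ i, ι (p.2 i) ∂P + ∫ p, ∑ i, I i p ∂P :=
      integral_add (integrable_finsetSum _ fun i _ => hs_int i)
        (integrable_finsetSum _ fun i _ => hIint i)
    rw [integral_finsetSum _ fun i _ => hIint i, hs_sum] at h1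
    linarith
  have hidle_le : ∀ i, P.real (idle i) ≤ κ * ∫ p, I i p ∂P := by
    intro i
    have h1 := measure_idle_le hι hpos hexc i (n := n)
    have h2 : ∫⁻ p, ENNReal.ofReal (ι (arrivalTimes p.1 i) - ι (previousDeparture i p.1 p.2)) ∂P =
        ENNReal.ofReal (∫ p, I i p ∂P) := by
      rw [ofReal_integral_eq_lintegral_ofReal (hIint i) (ae_of_all _ (hI0 i))]
      refine lintegral_congr fun p => ?_
      simp only [hI]
      rw [ENNReal.ofReal_max, ENNReal.ofReal_zero, max_eq_right zero_le]
    rw [h2, ← ENNReal.ofReal_mul hκ] at h1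
    exact ENNReal.toReal_le_of_le_ofReal
      (mul_nonneg hκ (integral_nonneg (hI0 i))) h1
  -- the minorant of the logarithm of the comparison density
  -- The term `χ` replaces the logarithm of the busy density by that of the idle one.  Whether packet
  -- `i` finds the queue idle is independent of its service time, so `χ` contributes the probability
  -- of this event times a constant.
  set χ : T → ℝ := fun x => Real.log η + c₀ - Real.log (1 - η) - φ x - c₁ * ι x with hχ
  have hχi : Integrable χ ν := ((integrable_const _).sub hφi).sub (hιν.const_mul c₁)
  have hχm : Measurable χ := (measurable_const.sub hφm).sub (hι.measurable.const_mul c₁)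
  have hχG : ∫ x, χ x ∂ν = G := by
    have i1 : Integrable (fun x => Real.log η + c₀ - Real.log (1 - η) - φ x) ν :=
      (integrable_const _).sub hφi
    rw [hχ, integral_sub i1 (hιν.const_mul c₁), integral_sub (integrable_const _) hφi,
      integral_const_mul, hmν]
    simp [hG]
  set V : Fin n → (Fin n → T) × (Fin n → T) → ℝ := fun i p =>
    Real.log (1 - η) + φ (p.2 i) + (idle i).indicator (fun p => χ (p.2 i)) p - c₁ * I i p with hV
  have hφe : ∀ i, Integrable (fun p : (Fin n → T) × (Fin n → T) => φ (p.2 i)) P := fun i =>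
    (integrable_comp_eval (μ := fun _ : Fin n => ν) (i := i) hφi).comp_snd _
  have hχe : ∀ i, Integrable ((idle i).indicator fun p => χ (p.2 i)) P := fun i =>
    ((integrable_comp_eval (μ := fun _ : Fin n => ν) (i := i) hχi).comp_snd _).indicator (hidlem i)
  have hV1 : ∀ i, Integrable (fun p : (Fin n → T) × (Fin n → T) =>
      Real.log (1 - η) + φ (p.2 i)) P := fun i => (integrable_const _).add (hφe i)
  have hV2 : ∀ i, Integrable (fun p : (Fin n → T) × (Fin n → T) =>
      Real.log (1 - η) + φ (p.2 i) + (idle i).indicator (fun p => χ (p.2 i)) p) P := fun i =>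
    (hV1 i).add (hχe i)
  have hVi : ∀ i, Integrable (V i) P := fun i => (hV2 i).sub ((hIint i).const_mul c₁)
  have hVint : ∀ i, Real.log (1 - η) + (∫ x, φ x ∂ν) - L * ∫ p, I i p ∂P ≤ ∫ p, V i p ∂P := by
    intro i
    have e1 : ∫ p, φ (p.2 i) ∂P = ∫ x, φ x ∂ν := by
      have := integral_indicator_eval (PX := Measure.pi fun _ : Fin n => α) (P := ν) i
        (E := Set.univ) MeasurableSet.univ (by simp) hφm
      simpa using this
    have e2 : ∫ p, (idle i).indicator (fun p => χ (p.2 i)) p ∂P = P.real (idle i) * G := by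
      rw [← hχG]
      refine integral_indicator_eval i (hidlem i) (fun A s y => ?_) hχm
      simp only [hidle, Set.mem_ofPred_eq, previousDeparture_update_right]
    rw [hV, integral_sub (hV2 i) ((hIint i).const_mul c₁), integral_add (hV1 i) (hχe i),
      integral_add (integrable_const _) (hφe i), integral_const_mul, e1, e2]
    simp only [integral_const, probReal_univ, smul_eq_mul, one_mul]
    have h1 : -(|G| * (κ * ∫ p, I i p ∂P)) ≤ P.real (idle i) * G := by
      have h2 := mul_le_mul_of_nonneg_left (hidle_le i) (abs_nonneg G)
      have h3 := mul_le_mul_of_nonneg_left (neg_abs_le G)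
        (measureReal_nonneg (μ := P) (s := idle i))
      linarith
    rw [hL]
    linarith
  -- the comparison density
  set q : (Fin n → T) → ℝ := fun y => ∏ i, ((1 - η) * f (y i) + η * g (y i)) with hq
  have hmix0 : ∀ x, 0 ≤ (1 - η) * f x + η * g x := fun x =>
    add_nonneg (mul_nonneg (by linarith) (hf.nonneg x)) (mul_nonneg hη0.le (hg.nonneg x))
  have hmixm : Measurable fun x => (1 - η) * f x + η * g x :=
    (hf.measurable.const_mul _).add (hg.measurable.const_mul _)
  have hqm : Measurable q :=
    Finset.measurable_prod _ fun i _ => hmixm.comp (measurable_pi_apply i)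
  have hq0 : ∀ y, 0 ≤ q y := fun y => Finset.prod_nonneg fun i _ => hmix0 _
  have hqint : ∫⁻ y, ENNReal.ofReal (q y) ∂(Measure.pi fun _ : Fin n => m) ≤ 1 := by
    have e : ∀ y : Fin n → T, ENNReal.ofReal (q y) =
        ∏ i, ENNReal.ofReal ((1 - η) * f (y i) + η * g (y i)) := fun y =>
      ENNReal.ofReal_prod_of_nonneg fun i _ => hmix0 _
    simp only [e]
    rw [lintegral_pi_prod m fun i => hmixm.ennreal_ofReal]
    refine Finset.prod_le_one' fun i _ => ?_
    have e2 : ∀ x, ENNReal.ofReal ((1 - η) * f x + η * g x) = ENNReal.ofReal (1 - η) *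
        ENNReal.ofReal (f x) + ENNReal.ofReal η * ENNReal.ofReal (g x) := fun x => by
      rw [ENNReal.ofReal_add (mul_nonneg (by linarith) (hf.nonneg x))
        (mul_nonneg hη0.le (hg.nonneg x)), ENNReal.ofReal_mul (by linarith),
        ENNReal.ofReal_mul hη0.le]
    simp only [e2]
    rw [lintegral_add_left (hf.measurable.ennreal_ofReal.const_mul _),
      lintegral_const_mul _ hf.measurable.ennreal_ofReal,
      lintegral_const_mul _ hg.measurable.ennreal_ofReal, hf.lintegral_ofReal, mul_one]
    calc _ ≤ ENNReal.ofReal (1 - η) + ENNReal.ofReal η * 1 := by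
          gcongr
          exact hg.lintegral_le
      _ = 1 := by
          rw [mul_one, ← ENNReal.ofReal_add (by linarith) hη0.le]
          simp
  set Ex : (Fin n → T) → ℝ := fun y => q y / ρ y with hEx
  have hExm : Measurable Ex := hqm.div hρ.measurable
  have hEx0 : ∀ y, 0 ≤ Ex y := fun y => div_nonneg (hq0 y) (hρ.nonneg y)
  have hExl : ∫⁻ p, ENNReal.ofReal (Ex (D p)) ∂P ≤ 1 := by
    rw [← lintegral_map hExm.ennreal_ofReal hDm, ← hPD, hρ.lintegral_eq hExm.ennreal_ofReal]
    refine le_trans (lintegral_mono fun y => ?_) hqint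
    rw [← ENNReal.ofReal_mul (hρ.nonneg y)]
    refine ENNReal.ofReal_le_ofReal ?_
    rcases (hρ.nonneg y).eq_or_lt with h0 | h0
    · rw [← h0, zero_mul]; exact hq0 y
    · exact (mul_div_cancel₀ _ h0.ne').le
  have hExi : Integrable (fun p => Ex (D p)) P := by
    refine ⟨(hExm.comp hDm).aestronglyMeasurable, ?_⟩
    rw [hasFiniteIntegral_iff_ofReal (ae_of_all _ fun p => hEx0 _)]
    exact hExl.trans_lt ENNReal.one_lt_top
  have hExle : ∫ p, Ex (D p) ∂P ≤ 1 := by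
    rw [integral_eq_lintegral_of_nonneg_ae (ae_of_all _ fun p => hEx0 _)
      (hExm.comp hDm).aestronglyMeasurable]
    exact ENNReal.toReal_le_of_le_ofReal zero_le_one (by simpa using hExl)
  have hρpos : ∀ᵐ p ∂P, 0 < ρ (D p) := by
    have := hρ.ae_pos
    rw [hPD] at this
    exact ae_of_ae_map hDm.aemeasurable this
  have hlogint : Integrable (fun p => Real.log (ρ (D p))) P := by
    rw [hPD] at hint
    exact hint.comp_measurable hDm
  have hlogle : ∫ p, Real.log (ρ (D p)) ∂P ≤ -(n * (h - δ / 2)) := by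
    have hlm : Measurable fun y => Real.log (ρ y) := Real.measurable_log.comp hρ.measurable
    rw [hPD, integral_map hDm.aemeasurable hlm.aestronglyMeasurable] at hent
    exact hent
  have hgibbs : ∀ᵐ p ∂P, ∑ i, V i p ≤ Real.log (ρ (D p)) + (Ex (D p) - 1) := by
    filter_upwards [hbase, hιD, hρpos, Measure.quasiMeasurePreserving_snd.ae (ae_pi_of_ae hφ n),
      Measure.quasiMeasurePreserving_snd.ae (ae_pi_of_ae hf.ae_pos n)] with p hp h1 h2 h3 h4
    have hDpos : ∀ i, 0 < D p i := fun i => (fifo T).channel_pos hp.1 hp.2 i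
    have hmixpos : ∀ i, 0 < (1 - η) * f (D p i) + η * g (D p i) := fun i =>
      add_pos_of_nonneg_of_pos (mul_nonneg (by linarith) (hf.nonneg _))
        (mul_pos hη0 (hg.pos _ (hDpos i)))
    have hVle : ∀ i, V i p ≤ Real.log ((1 - η) * f (D p i) + η * g (D p i)) := by
      intro i
      by_cases hid : p ∈ idle i
      · have e1 : V i p = Real.log η + (c₀ - c₁ * ι (D p i)) := by
          simp only [hV, Set.indicator_of_mem hid, hχ]
          rw [h1 i]
          ring
        rw [e1, ← hg.log_eq _ (hDpos i), ← Real.log_mul hη0.ne' (hg.pos _ (hDpos i)).ne']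
        refine Real.log_le_log (mul_pos hη0 (hg.pos _ (hDpos i))) ?_
        exact le_add_of_nonneg_left (mul_nonneg (by linarith) (hf.nonneg _))
      · have hnot : arrivalTimes p.1 i ≤ previousDeparture i p.1 p.2 := not_lt.1 hid
        have e0 : I i p = 0 := by
          simp only [hI]
          exact max_eq_left (sub_nonpos.2 (hι.strictMono.monotone hnot))
        have e1 : D p i = p.2 i := by
          refine hι.strictMono.injective ?_
          rw [h1 i, e0, add_zero]
        have e2 : V i p = Real.log (1 - η) + φ (p.2 i) := by
          simp only [hV, Set.indicator_of_notMem hid, e0]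
          ring
        have h1η : 0 < 1 - η := by linarith
        rw [e2, e1]
        refine (add_le_add le_rfl (h3 i)).trans ?_
        rw [← Real.log_mul h1η.ne' (h4 i).ne']
        refine Real.log_le_log (mul_pos h1η (h4 i)) ?_
        exact le_add_of_nonneg_right (mul_nonneg hη0.le (hg.nonneg _))
    have hqpos : 0 < q (D p) := Finset.prod_pos fun i _ => hmixpos i
    have hlogq : Real.log (q (D p)) = ∑ i, Real.log ((1 - η) * f (D p i) + η * g (D p i)) :=
      Real.log_prod fun i _ => (hmixpos i).ne'
    have h5 := Real.log_le_sub_one_of_pos (div_pos hqpos h2)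
    rw [Real.log_div hqpos.ne' h2.ne', hlogq] at h5
    have h6 := Finset.sum_le_sum fun i (_ : i ∈ Finset.univ) => hVle i
    change _ ≤ Real.log (ρ (D p)) + (q (D p) / ρ (D p) - 1)
    linarith
  have hfinal := integral_mono_ae (integrable_finsetSum _ fun i _ => hVi i)
    (hlogint.add (hExi.sub (integrable_const _))) hgibbs
  rw [integral_add' hlogint (hExi.sub (integrable_const _)), integral_sub' hExi
    (integrable_const _), integral_finsetSum _ fun i _ => hVi i] at hfinal
  have hsumV := Finset.sum_le_sum fun i (_ : i ∈ Finset.univ) => hVint i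
  rw [Finset.sum_sub_distrib, ← Finset.mul_sum] at hsumV
  simp only [Finset.sum_const, Finset.card_univ, Fintype.card_fin, nsmul_eq_mul,
    integral_const, probReal_univ, smul_eq_mul, mul_one] at hsumV hfinal
  have h7 := mul_le_mul_of_nonneg_left hIsum hL0.le
  have h8 : L * (n * (ex - es + δ / (2 * L))) = n * (L * (ex - es) + δ / 2) := by field_simp
  rw [h8] at h7
  have h9 : (n : ℝ) * (Real.log (1 - η) + (∫ x, φ x ∂ν) + h) ≤ n * (L * (ex - es) + δ) := by
    nlinarith
  exact le_of_mul_le_mul_left h9 hn0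

/-- If the output of a first in first out queue is nearly as random as the interarrivals for all
rates below the service rate, then so are the service times: close to the critical rate the
interdepartures are mostly service times. -/
theorem entropy_le_of_fifo (hι : IsClock ι) (hf : IsDensity m f ν)
    (hpos : ∀ᵐ x ∂ν, 0 < x) {μ : ℝ} (hμ : 0 < μ)
    (hmean : ∫⁻ x, ENNReal.ofReal (ι x) ∂ν = ENNReal.ofReal (1 / μ))
    {α : ℝ → Measure T} {g : ℝ → T → ℝ} {c₀ c₁ H : ℝ → ℝ}
    (hfam : IsInputFamily m ι μ α g c₀ c₁ H)
    (hfull : ∀ θ, 0 < θ → θ < μ → HasOutputEntropy (fifo T) m ν (α θ) (H θ))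
    {κ : ℝ} (hκ : 0 ≤ κ) (hexc : ∀ θ, 0 < θ → θ < μ → HasExcess (α θ) ι κ)
    (hfin : ∫⁻ x, ENNReal.ofReal (-Real.logb 2 (f x)) ∂ν ≠ ∞) :
    ((H μ / Real.log 2 : ℝ) : EReal) ≤ densityEntropy ν f := by
  by_contra hcon
  rw [not_le] at hcon
  obtain ⟨φ, hφm, hφi, hφ, hlt⟩ := exists_integrable_le_log hf.measurable hfin (r := -H μ)
    (by rwa [neg_neg])
  -- the idle component of the mixture stays fixed, at the rate `μ / 2`, while the input rate tends
  -- to `μ` and the probability of finding the queue idle to zero; afterwards its weight `η` does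
  have hmid : 0 < μ / 2 := by positivity
  have hmid' : μ / 2 < μ := by linarith
  have hstep : ∀ η : ℝ, 0 < η → η < 1 → Real.log (1 - η) + (∫ x, φ x ∂ν) + H μ ≤ 0 := by
    intro η hη0 hη1
    set L := κ * |Real.log η + c₀ (μ / 2) - Real.log (1 - η) - (∫ x, φ x ∂ν) -
      c₁ (μ / 2) * (1 / μ)| + c₁ (μ / 2)
    have hcont : Tendsto H (𝓝[<] μ) (𝓝 (H μ)) := by
      refine (hfam.continuousOn μ ⟨hμ, le_rfl⟩).tendsto.mono_left (nhdsWithin_le_iff.2 ?_)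
      filter_upwards [eventually_nhdsLT_pos hμ] with θ hθ using ⟨hθ.1, hθ.2.le⟩
    have hl1 : Tendsto (fun θ => Real.log (1 - η) + (∫ x, φ x ∂ν) + H θ) (𝓝[<] μ)
        (𝓝 (Real.log (1 - η) + (∫ x, φ x ∂ν) + H μ)) := hcont.const_add _
    have hl2 : Tendsto (fun θ : ℝ => L * (1 / θ - 1 / μ)) (𝓝[<] μ) (𝓝 (L * (1 / μ - 1 / μ))) := by
      have h1 : Tendsto (fun θ : ℝ => 1 / θ) (𝓝[<] μ) (𝓝 (1 / μ)) :=
        (tendsto_const_nhds.div tendsto_id hμ.ne').mono_left nhdsWithin_le_nhds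
      exact (h1.sub_const _).const_mul L
    rw [sub_self, mul_zero] at hl2
    refine le_of_tendsto_of_tendsto hl1 hl2 ?_
    filter_upwards [eventually_nhdsLT_pos hμ] with θ hθ
    have := hfam.prob θ hθ.1 hθ.2
    exact fifo_entropy_le hι hf (hfam.nonneg θ hθ.1 hθ.2) hpos (hfam.logAffine _ hmid hmid')
      (hfam.pos _ hmid hmid') hφm hφi (ae_of_all _ hφ) hκ (hexc θ hθ.1 hθ.2) (by positivity)
      (one_div_le_one_div_of_le hθ.1 hθ.2.le) (hfam.mean θ hθ.1 hθ.2) hmean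
      (hfull θ hθ.1 hθ.2) hη0 hη1
  have hlog : Tendsto (fun η : ℝ => Real.log (1 - η) + (∫ x, φ x ∂ν) + H μ) (𝓝[>] 0)
      (𝓝 (Real.log (1 - 0) + (∫ x, φ x ∂ν) + H μ)) := by
    refine Tendsto.mono_left ?_ nhdsWithin_le_nhds
    refine (Tendsto.add_const _ ?_).add_const _
    have h1 : Tendsto (fun η : ℝ => 1 - η) (𝓝 0) (𝓝 (1 - 0)) := tendsto_id.const_sub 1
    exact h1.log (by norm_num)
  have h0 := le_of_tendsto hlog (by
    filter_upwards [Ioo_mem_nhdsGT one_pos] with η hη using hstep η hη.1 hη.2)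
  simp only [sub_zero, Real.log_one, zero_add] at h0
  linarith

end Fifo

/-! ### The capacity formula for a general time axis -/

section Main

variable {T : Type} [LinearOrder T] [AddCommMonoid T] [Sub T] [MeasurableSpace T]
  [IsOrderedCancelAddMonoid T] [OrderedSub T] [ExistsAddOfLE T]
  [TopologicalSpace T] [OrderClosedTopology T] [SecondCountableTopology T] [BorelSpace T]
  [MeasurableAdd₂ T] [MeasurableSub₂ T]
  {m : Measure T} [SigmaFinite m] {ν : Measure T} [IsProbabilityMeasure ν]
  {ι f : T → ℝ} {μ : ℝ} {α : ℝ → Measure T} {g : ℝ → T → ℝ} {c₀ c₁ H : ℝ → ℝ}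

/-- The capacity formula for a general time axis with a reference measure.  Discrete and continuous
time differ only in the hypotheses that are to be verified. -/
theorem capacity_eq (hm : IsReference m) (hι : IsClock ι) (hf : IsDensity m f ν)
    (hpos : ∀ᵐ x ∂ν, 0 < x) (hμ : 0 < μ)
    (hmean : ∫⁻ x, ENNReal.ofReal (ι x) ∂ν = ENNReal.ofReal (1 / μ))
    (hfam : IsInputFamily m ι μ α g c₀ c₁ H)
    {κ : ℝ} (hκ : 0 ≤ κ) (hexc : ∀ θ, 0 < θ → θ < μ → HasExcess (α θ) ι κ) (Q : Discipline T)
    {ρ : ∀ (_ : ℝ) (n : ℕ), (Fin n → T) → ℝ}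
    (hρ : ∀ θ, 0 < θ → θ < μ → ∀ n, IsDensity (Measure.pi fun _ : Fin n => m) (ρ θ n)
      (Q.interdepartureLaw ν (α θ) n))
    (hlim : ∀ θ, 0 < θ → θ < μ → ((H θ / Real.log 2 : ℝ) : EReal) ≤ liminf (fun n : ℕ =>
      densityEntropy (Q.interdepartureLaw ν (α θ) n) (ρ θ n) / (n : EReal)) atTop)
    {lam : ℝ} (hlam : 0 < lam) (hcase : lam < μ ∨ (lam = μ ∧ Q = fifo T)) :
    Q.feedbackCapacity ν ι lam = Q.capacity ν ι lam ∧
      Q.capacity ν ι lam =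
        (lam : EReal) * (((H lam / Real.log 2 : ℝ) : EReal) - densityEntropy ν f) := by
  have hmid : 0 < μ / 2 := by positivity
  have hmid' : μ / 2 < μ := by linarith
  have hfull : ∀ θ, 0 < θ → θ < μ → HasOutputEntropy Q m ν (α θ) (H θ) := by
    intro θ h0 h1
    have := hfam.prob θ h0 h1
    exact hasOutputEntropy_of_le_liminf hι (hfam.nonneg θ h0 h1) hpos (hfam.logAffine θ h0 h1) Q
      (by positivity) (one_div_le_one_div_of_le h0 h1.le) (hfam.mean θ h0 h1) hmean
      (hρ θ h0 h1) (hlim θ h0 h1)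
  have hfin : ∫⁻ x, ENNReal.ofReal (-Real.logb 2 (f x)) ∂ν ≠ ∞ := by
    have hg := hfam.logAffine _ hmid hmid'
    obtain ⟨hi, -⟩ := integrable_clock hι (hpos.mono fun x hx => hx.le) hmean (by positivity)
    refine hf.lintegral_neg_logb_ne_top hg.measurable (hpos.mono fun x hx => hg.pos x hx)
      hg.lintegral_le ?_
    refine ((integrable_const (c₀ (μ / 2))).sub (hi.const_mul (c₁ (μ / 2)))).congr ?_
    filter_upwards [hpos] with x hx using (hg.log_eq x hx).symm
  rcases hcase with hlt | ⟨rfl, rfl⟩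
  · exact capacity_eq_of_lt hm hι hf hpos hμ hmean hfam Q hfull hfin hlam hlt
  · exact capacity_eq_of_entropy_le hm hι hf hpos hμ hmean hfam _ hfin
      (entropy_le_of_fifo hι hf hpos hμ hmean hfam hfull hκ hexc hfin)

end Main

/-! ### Discrete time -/

theorem isClock_natCast : IsClock fun t : ℕ => (t : ℝ) where
  zero := Nat.cast_zero
  add := Nat.cast_add
  strictMono := Nat.strictMono_cast
  measurable := measurable_of_countable _

/-- The density of `geomLaw θ` with respect to the counting measure. -/
noncomputable def geomDensity (θ : ℝ) (k : ℕ) : ℝ := if k = 0 then 0 else (1 - θ) ^ (k - 1) * θ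

theorem projIcc_ne_zero {θ : ℝ} (h0 : 0 < θ) (h1 : θ < 1) :
    (Set.projIcc (0 : ℝ) 1 zero_le_one θ) ≠ 0 ∧
      ((Set.projIcc (0 : ℝ) 1 zero_le_one θ : unitInterval) : ℝ) = θ := by
  have h : Set.projIcc (0 : ℝ) 1 zero_le_one θ = ⟨θ, h0.le, h1.le⟩ :=
    Set.projIcc_of_mem _ ⟨h0.le, h1.le⟩
  rw [h]
  refine ⟨fun h2 => h0.ne' ?_, rfl⟩
  exact congrArg Subtype.val h2

instance isProbabilityMeasure_geomLaw (θ : ℝ) : IsProbabilityMeasure (geomLaw θ) :=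
  Measure.isProbabilityMeasure_map (measurable_of_countable _).aemeasurable

theorem isDensity_geomLaw {θ : ℝ} (h0 : 0 < θ) (h1 : θ < 1) :
    IsDensity Measure.count (geomDensity θ) (geomLaw θ) where
  measurable := measurable_of_countable _
  nonneg k := by
    unfold geomDensity
    split_ifs
    · exact le_rfl
    · exact mul_nonneg (pow_nonneg (by linarith) _) h0.le
  eq := by
    obtain ⟨hp, hpθ⟩ := projIcc_ne_zero h0 h1
    refine Measure.ext_of_singleton fun k => ?_
    rw [withDensity_apply _ (measurableSet_singleton k), lintegral_singleton,
      Measure.count_singleton, mul_one, geomLaw, Measure.map_apply (measurable_of_countable _)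
      (measurableSet_singleton k)]
    rcases k with _ | k
    · have : (fun x : ℕ => x + 1) ⁻¹' {0} = ∅ := by ext; simp
      rw [this, measure_empty, geomDensity, if_pos rfl, ENNReal.ofReal_zero]
    · have : (fun x : ℕ => x + 1) ⁻¹' {k + 1} = {k} := by ext; simp
      rw [this, geometricMeasure_singleton hp, hpθ, geomDensity, if_neg (Nat.succ_ne_zero k)]
      rfl

theorem lintegral_geomLaw {θ : ℝ} (h0 : 0 < θ) (h1 : θ < 1) :
    ∫⁻ k, ENNReal.ofReal (k : ℝ) ∂(geomLaw θ) = ENNReal.ofReal (1 / θ) := by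
  obtain ⟨hp, hpθ⟩ := projIcc_ne_zero h0 h1
  rw [geomLaw, lintegral_map (measurable_of_countable _) (measurable_of_countable _),
    geometricMeasure_eq hp, lintegral_sum_measure]
  simp only [lintegral_smul_measure, lintegral_dirac, smul_eq_mul, hpθ]
  have hr0 : 0 ≤ 1 - θ := by linarith
  have hn : ‖1 - θ‖ < 1 := by
    rw [Real.norm_of_nonneg hr0]; linarith
  have hs : HasSum (fun n : ℕ => (1 - θ) ^ n * θ * ((n + 1 : ℕ) : ℝ)) (1 / θ) := by
    have e1 := (hasSum_coe_mul_geometric_of_norm_lt_one hn).add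
      (hasSum_geometric_of_norm_lt_one hn)
    have e2 := e1.mul_right θ
    have e3 : ((1 - θ) / (1 - (1 - θ)) ^ 2 + (1 - (1 - θ))⁻¹) * θ = 1 / θ := by
      rw [sub_sub_cancel]
      field_simp
      ring
    rw [e3] at e2
    convert! e2 using 1
    funext n
    push_cast
    ring
  have hnn : ∀ n : ℕ, 0 ≤ (1 - θ) ^ n * θ * ((n + 1 : ℕ) : ℝ) := fun n => by positivity
  rw [← hs.tsum_eq, ENNReal.ofReal_tsum_of_nonneg hnn hs.summable]
  refine tsum_congr fun n => ?_
  rw [← ENNReal.ofReal_mul (by positivity)]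

theorem isLogAffine_geomDensity {θ : ℝ} (h0 : 0 < θ) (h1 : θ < 1) :
    IsLogAffine Measure.count (fun t : ℕ => (t : ℝ)) (geomDensity θ)
      (Real.log θ - Real.log (1 - θ)) (-Real.log (1 - θ)) where
  measurable := measurable_of_countable _
  nonneg := (isDensity_geomLaw h0 h1).nonneg
  lintegral_le := (isDensity_geomLaw h0 h1).lintegral_ofReal.le
  pos k hk := by
    rw [geomDensity, if_neg hk.ne']
    exact mul_pos (pow_pos (by linarith) _) h0
  log_eq k hk := by
    have h2 : 0 < 1 - θ := by linarith
    rw [geomDensity, if_neg hk.ne', Real.log_mul (pow_pos h2 _).ne' h0.ne', Real.log_pow,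
      Nat.cast_sub hk]
    push_cast
    ring

/-- The entropy of the geometric law in nats. -/
theorem geomEntropy_mul_log (θ : ℝ) : geomEntropy θ * Real.log 2 =
    (Real.negMulLog θ + Real.negMulLog (1 - θ)) / θ := by
  have hlog2 : Real.log 2 ≠ 0 := (Real.log_pos one_lt_two).ne'
  simp only [geomEntropy, Real.negMulLog, Real.logb]
  field_simp
  ring

theorem isInputFamily_geomLaw {μ : ℝ} (hμ : μ ≤ 1) :
    IsInputFamily Measure.count (fun t : ℕ => (t : ℝ)) μ geomLaw geomDensity
      (fun θ => Real.log θ - Real.log (1 - θ)) (fun θ => -Real.log (1 - θ))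
      (fun θ => geomEntropy θ * Real.log 2) where
  prob θ _ _ := isProbabilityMeasure_geomLaw θ
  nonneg θ _ _ := ae_of_all _ fun _ => Nat.zero_le _
  mean θ h0 h1 := lintegral_geomLaw h0 (h1.trans_le hμ)
  logAffine θ h0 h1 := isLogAffine_geomDensity h0 (h1.trans_le hμ)
  pos θ h0 h1 := neg_pos.2 (Real.log_neg (by linarith) (by linarith))
  entropy_eq θ h0 h1 := by
    rw [geomEntropy_mul_log]
    simp only [Real.negMulLog]
    field_simp
    ring
  continuousOn := by
    simp only [geomEntropy_mul_log]
    refine ContinuousOn.div ?_ continuousOn_id fun θ hθ => hθ.1.ne'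
    exact (Real.continuous_negMulLog.add (Real.continuous_negMulLog.comp
      (continuous_const.sub continuous_id))).continuousOn
  tendsto lam h0 h1 := by
    have hlog : Tendsto (fun θ : ℝ => -Real.log θ) (𝓝[<] lam) (𝓝 (-Real.log lam)) :=
      ((Real.continuousAt_log h0.ne').tendsto.mono_left nhdsWithin_le_nhds).neg
    rcases (h1.trans hμ).eq_or_lt with rfl | hlt
    · have e1 : geomEntropy 1 * Real.log 2 = -Real.log 1 := by
        rw [geomEntropy_mul_log]; simp
      rw [e1]
      refine hlog.congr fun θ => ?_
      ring
    · have hlog' : Tendsto (fun θ : ℝ => Real.log (1 - θ)) (𝓝[<] lam) (𝓝 (Real.log (1 - lam))) := by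
        have h2 : Tendsto (fun θ : ℝ => 1 - θ) (𝓝 lam) (𝓝 (1 - lam)) := tendsto_id.const_sub 1
        exact (h2.log (by linarith)).mono_left nhdsWithin_le_nhds
      have h3 := (hlog'.neg.div_const lam).add (hlog.add hlog')
      have e1 : geomEntropy lam * Real.log 2 =
          -Real.log (1 - lam) / lam + (-Real.log lam + Real.log (1 - lam)) := by
        rw [geomEntropy_mul_log]
        simp only [Real.negMulLog]
        field_simp
        ring
      rw [e1]
      refine h3.congr fun θ => ?_
      ring

/-- In discrete time an idle period lasts for one unit of time at least. -/
theorem hasExcess_natCast (α : Measure ℕ) : HasExcess α (fun t : ℕ => (t : ℝ)) 1 := by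
  intro b w _
  rw [ENNReal.ofReal_one, one_mul, ← lintegral_indicator_one (MeasurableSet.of_discrete)]
  refine lintegral_mono fun x => ?_
  by_cases h : w < b + x
  · rw [Set.indicator_of_mem (show x ∈ {x | w < b + x} from h), Pi.one_apply,
      ← ENNReal.ofReal_one]
    refine ENNReal.ofReal_le_ofReal ?_
    have : (w : ℝ) + 1 ≤ b + x := by exact_mod_cast h
    linarith
  · rw [Set.indicator_of_notMem (show x ∉ {x | w < b + x} from h)]
    exact zero_le

/-- The capacity formula in discrete time.  Here `μ ≤ 1`, as services last for one unit of time at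
least. -/
theorem capacity_eq_nat (ν : Measure ℕ) [IsProbabilityMeasure ν] (h0 : ν {0} = 0) {μ : ℝ}
    (hμ : 0 < μ) (hmean : ∫⁻ s, (s : ℝ≥0∞) ∂ν = ENNReal.ofReal (1 / μ)) (Q : Discipline ℕ)
    (hlim : ∀ lam : ℝ, 0 < lam → lam < μ → (geomEntropy lam : EReal) ≤
      liminf (fun n : ℕ => shannonEntropy (Q.interdepartureLaw ν (geomLaw lam) n) / (n : EReal))
        atTop)
    {lam : ℝ} (hlam : 0 < lam) (hcase : lam < μ ∨ (lam = μ ∧ Q = fifo ℕ)) :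
    Q.feedbackCapacity ν (fun t : ℕ => (t : ℝ)) lam = Q.capacity ν (fun t : ℕ => (t : ℝ)) lam ∧
      Q.capacity ν (fun t : ℕ => (t : ℝ)) lam =
        (lam : EReal) * ((geomEntropy lam : EReal) - shannonEntropy ν) := by
  have hlog2 : Real.log 2 ≠ 0 := (Real.log_pos one_lt_two).ne'
  have hpos : ∀ᵐ x ∂ν, 0 < x := by
    have : {x : ℕ | ¬ 0 < x} = {0} := by ext; simp
    rw [ae_iff, this, h0]
  have hmean' : ∫⁻ x : ℕ, ENNReal.ofReal (x : ℝ) ∂ν = ENNReal.ofReal (1 / μ) := by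
    simpa only [ENNReal.ofReal_natCast] using hmean
  have hμ1 : μ ≤ 1 := by
    have h1 : (1 : ℝ≥0∞) ≤ ENNReal.ofReal (1 / μ) := by
      calc (1 : ℝ≥0∞) = ∫⁻ _, 1 ∂ν := by simp
        _ ≤ ∫⁻ x : ℕ, (x : ℝ≥0∞) ∂ν := lintegral_mono_ae (by
            filter_upwards [hpos] with x hx
            exact_mod_cast hx)
        _ = _ := hmean
    rw [ENNReal.one_le_ofReal, le_div_iff₀ hμ] at h1
    linarith
  have hprob : ∀ θ n, IsProbabilityMeasure (Q.interdepartureLaw ν (geomLaw θ) n) := fun θ n =>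
    isProbabilityMeasure_interdepartureLaw Q n
  have key := capacity_eq isReference_count isClock_natCast isDensity_count hpos hμ hmean'
    (isInputFamily_geomLaw hμ1) zero_le_one (fun θ _ _ => hasExcess_natCast _) Q
    (ρ := fun θ n y => (Q.interdepartureLaw ν (geomLaw θ) n).real {y})
    (fun θ _ _ n => by
      have := hprob θ n
      rw [pi_count]
      exact isDensity_count)
    (fun θ h1 h2 => by
      have h3 := hlim θ h1 h2
      rw [mul_div_cancel_right₀ _ hlog2]
      refine h3.trans (le_of_eq ?_)
      congr 1
      funext n
      have := hprob θ n
      rw [shannonEntropy_eq])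
    hlam hcase
  rw [mul_div_cancel_right₀ _ hlog2, ← shannonEntropy_eq] at key
  exact key

/-! ### Continuous time -/

theorem isClock_id : IsClock fun t : ℝ => t where
  zero := rfl
  add _ _ := rfl
  strictMono := strictMono_id
  measurable := measurable_id

theorem isDensity_expMeasure {θ : ℝ} (h0 : 0 < θ) :
    IsDensity volume (exponentialPDFReal θ) (expMeasure θ) where
  measurable := measurable_exponentialPDFReal θ
  nonneg := exponentialPDFReal_nonneg h0
  eq := rfl

theorem exponentialPDFReal_of_nonneg (θ : ℝ) {x : ℝ} (hx : 0 ≤ x) :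
    exponentialPDFReal θ x = θ * Real.exp (-(θ * x)) := by
  rw [exponentialPDFReal, gammaPDFReal, if_pos hx]
  simp

theorem isLogAffine_exponentialPDFReal {θ : ℝ} (h0 : 0 < θ) :
    IsLogAffine volume (fun t : ℝ => t) (exponentialPDFReal θ) (Real.log θ) θ where
  measurable := measurable_exponentialPDFReal θ
  nonneg := exponentialPDFReal_nonneg h0
  lintegral_le := (lintegral_exponentialPDF_eq_one h0).le
  pos _ hx := exponentialPDFReal_pos h0 hx
  log_eq x hx := by
    rw [exponentialPDFReal_of_nonneg θ hx.le, Real.log_mul h0.ne' (Real.exp_pos _).ne',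
      Real.log_exp]
    ring

theorem ae_nonneg_expMeasure (θ : ℝ) : ∀ᵐ x ∂(expMeasure θ), 0 ≤ x := by
  have : {x : ℝ | ¬ 0 ≤ x} = Set.Iio 0 := by ext; simp
  rw [ae_iff, this, expMeasure, gammaMeasure, withDensity_apply _ measurableSet_Iio]
  exact lintegral_gammaPDF_of_nonpos le_rfl

theorem expMeasure_Ioi {θ : ℝ} (h0 : 0 < θ) {u : ℝ} (hu : 0 ≤ u) :
    expMeasure θ (Set.Ioi u) = ENNReal.ofReal (Real.exp (-(θ * u))) := by
  have := isProbabilityMeasure_expMeasure h0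
  have h1 : (expMeasure θ).real (Set.Iic u) = 1 - Real.exp (-(θ * u)) := by
    rw [← cdf_eq_real, cdf_expMeasure_eq h0, if_pos hu]
  rw [← ofReal_measureReal, ← Set.compl_Iic, probReal_compl_eq_one_sub measurableSet_Iic, h1,
    sub_sub_cancel]

/-- The mean excess of an exponential law over a level. -/
theorem lintegral_excess_expMeasure {θ : ℝ} (h0 : 0 < θ) {w : ℝ} (hw : 0 ≤ w) :
    ∫⁻ x, ENNReal.ofReal (x - w) ∂(expMeasure θ) =
      ENNReal.ofReal (Real.exp (-(θ * w))) * ENNReal.ofReal (1 / θ) := by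
  have h1 : ∀ x : ℝ, ENNReal.ofReal (x - w) = ENNReal.ofReal (max 0 (x - w)) := fun x => by
    rw [ENNReal.ofReal_max, ENNReal.ofReal_zero, max_eq_right zero_le]
  simp only [h1]
  have hm : Measurable fun x : ℝ => max 0 (x - w) :=
    measurable_const.max (measurable_id.sub_const w)
  rw [lintegral_eq_lintegral_meas_lt (f := fun x => max 0 (x - w)) _
    (ae_of_all _ fun x => le_max_left _ _) hm.aemeasurable]
  have h2 : ∀ t ∈ Set.Ioi (0 : ℝ), expMeasure θ {x : ℝ | t < max 0 (x - w)} =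
      ENNReal.ofReal (Real.exp (-(θ * w))) * ENNReal.ofReal (Real.exp (-θ * t)) := by
    intro t ht
    have ht0 : (0 : ℝ) < t := ht
    have h3 : {x : ℝ | t < max 0 (x - w)} = Set.Ioi (w + t) := by
      ext x
      simp only [Set.mem_ofPred_eq, lt_max_iff, Set.mem_Ioi]
      constructor
      · rintro (h | h)
        · exact absurd h (not_lt.2 ht0.le)
        · linarith
      · exact fun h => Or.inr (by linarith)
    rw [h3, expMeasure_Ioi h0 (by linarith), ← ENNReal.ofReal_mul (Real.exp_pos _).le,
      ← Real.exp_add]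
    congr 2
    ring
  rw [setLIntegral_congr_fun measurableSet_Ioi h2, lintegral_const_mul _
    (by fun_prop)]
  congr 1
  rw [← ofReal_integral_eq_lintegral_ofReal (exp_neg_integrableOn_Ioi 0 h0)
    (ae_of_all _ fun x => (Real.exp_pos _).le), integral_exp_mul_Ioi (neg_lt_zero.2 h0)]
  simp

theorem lintegral_expMeasure {θ : ℝ} (h0 : 0 < θ) :
    ∫⁻ x, ENNReal.ofReal x ∂(expMeasure θ) = ENNReal.ofReal (1 / θ) := by
  simpa using lintegral_excess_expMeasure h0 le_rfl

theorem isInputFamily_expMeasure (μ : ℝ) :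
    IsInputFamily volume (fun t : ℝ => t) μ expMeasure exponentialPDFReal Real.log id
      (fun θ => 1 - Real.log θ) where
  prob _ h0 _ := isProbabilityMeasure_expMeasure h0
  nonneg θ _ _ := ae_nonneg_expMeasure θ
  mean _ h0 _ := lintegral_expMeasure h0
  logAffine _ h0 _ := isLogAffine_exponentialPDFReal h0
  pos _ h0 _ := h0
  entropy_eq θ h0 _ := by
    rw [id, mul_one_div_cancel h0.ne']
  continuousOn := continuousOn_const.sub (Real.continuousOn_log.mono fun θ hθ => hθ.1.ne')
  tendsto lam h0 _ := by
    have h1 : Tendsto (fun θ : ℝ => id θ / lam - Real.log θ) (𝓝 lam)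
        (𝓝 (lam / lam - Real.log lam)) :=
      (tendsto_id.div_const lam).sub (Real.continuousAt_log h0.ne').tendsto
    rw [div_self h0.ne'] at h1
    exact h1.mono_left nhdsWithin_le_nhds

/-- By the lack of memory, the mean excess of an exponential law of rate `θ` is `1 / θ`. -/
theorem hasExcess_expMeasure {θ κ : ℝ} (h0 : 0 < θ) (hκ : θ ≤ κ) :
    HasExcess (expMeasure θ) (fun t : ℝ => t) κ := by
  intro b w hbw
  have h1 : {x : ℝ | w < b + x} = Set.Ioi (w - b) := by
    ext x
    simp [sub_lt_iff_lt_add']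
  have h2 : ∀ x : ℝ, b + x - w = x - (w - b) := fun x => by ring
  simp only [h2]
  rw [h1, expMeasure_Ioi h0 (sub_nonneg.2 hbw), lintegral_excess_expMeasure h0 (sub_nonneg.2 hbw),
    ← ENNReal.ofReal_mul (Real.exp_pos _).le, ← ENNReal.ofReal_mul (h0.le.trans hκ)]
  refine ENNReal.ofReal_le_ofReal ?_
  have h3 : 1 ≤ κ * (1 / θ) := by rwa [mul_one_div, le_div_iff₀ h0, one_mul]
  calc Real.exp (-(θ * (w - b))) = 1 * Real.exp (-(θ * (w - b))) := (one_mul _).symm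
    _ ≤ κ * (1 / θ) * Real.exp (-(θ * (w - b))) :=
        mul_le_mul_of_nonneg_right h3 (Real.exp_pos _).le
    _ = _ := by ring

theorem diffEntropy_expMeasure {θ : ℝ} (h0 : 0 < θ) :
    diffEntropy (expMeasure θ) = (((1 - Real.log θ) / Real.log 2 : ℝ) : EReal) := by
  have := isProbabilityMeasure_expMeasure h0
  have hd := isDensity_expMeasure h0
  have hac := hd.absolutelyContinuous
  have h1 : ∀ᵐ x ∂(expMeasure θ), Real.log θ - θ * x =
      Real.log ((expMeasure θ).rnDeriv volume x).toReal := by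
    have h2 : (expMeasure θ).rnDeriv volume =ᵐ[expMeasure θ] exponentialPDF θ := by
      refine hac.ae_le ?_
      exact Measure.rnDeriv_withDensity _ (measurable_exponentialPDFReal θ).ennreal_ofReal
    filter_upwards [h2, hd.ae_pos, ae_nonneg_expMeasure θ] with x hx hx2 hx3
    rw [hx, exponentialPDF, ENNReal.toReal_ofReal hx2.le, exponentialPDFReal_of_nonneg θ hx3,
      Real.log_mul h0.ne' (Real.exp_pos _).ne', Real.log_exp]
    ring
  obtain ⟨hi, hm⟩ := integrable_clock isClock_id (ae_nonneg_expMeasure θ) (lintegral_expMeasure h0)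
    (by positivity)
  have hi2 : Integrable (fun x => Real.log θ - θ * x) (expMeasure θ) :=
    (integrable_const _).sub (hi.const_mul θ)
  rw [diffEntropy_eq hac, densityEntropy_eq_integral (hi2.congr h1), ← integral_congr_ae h1,
    integral_sub (integrable_const _) (hi.const_mul θ), integral_const_mul, hm]
  congr 2
  simp [h0.ne']

/-- The capacity formula in continuous time. -/
theorem capacity_eq_real (ν : Measure ℝ) [IsProbabilityMeasure ν] (hneg : ν (Set.Iio 0) = 0)
    (hac : ν ≪ (volume : Measure ℝ)) {μ : ℝ} (hμ : 0 < μ)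
    (hmean : ∫⁻ s, ENNReal.ofReal s ∂ν = ENNReal.ofReal (1 / μ)) (Q : Discipline ℝ)
    (hlim : ∀ lam : ℝ, 0 < lam → lam < μ → diffEntropy (expMeasure lam) ≤
      liminf (fun n : ℕ => diffEntropy (Q.interdepartureLaw ν (expMeasure lam) n) / (n : EReal))
        atTop)
    {lam : ℝ} (hlam : 0 < lam) (hcase : lam < μ ∨ (lam = μ ∧ Q = fifo ℝ)) :
    Q.feedbackCapacity ν (fun t : ℝ => t) lam = Q.capacity ν (fun t : ℝ => t) lam ∧
      Q.capacity ν (fun t : ℝ => t) lam =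
        (lam : EReal) * (diffEntropy (expMeasure lam) - diffEntropy ν) := by
  have hpos : ∀ᵐ x ∂ν, 0 < x := by
    have h1 : {x : ℝ | ¬ 0 < x} = Set.Iio 0 ∪ {0} := by
      ext x
      simp only [Set.mem_ofPred_eq, not_lt, Set.mem_union, Set.mem_Iio, Set.mem_singleton_iff]
      exact le_iff_lt_or_eq
    rw [ae_iff, h1, measure_union_null_iff]
    exact ⟨hneg, hac Real.volume_singleton⟩
  have hdens : ∀ θ, 0 < θ → ∀ n, Q.interdepartureLaw ν (expMeasure θ) n ≪
      (volume : Measure (Fin n → ℝ)) ∧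
      IsProbabilityMeasure (Q.interdepartureLaw ν (expMeasure θ) n) := by
    intro θ h0 n
    have := isProbabilityMeasure_expMeasure h0
    exact ⟨absolutelyContinuous_interdepartureLaw isReference_volume hac
      (ae_nonneg_expMeasure θ) hpos Q n, isProbabilityMeasure_interdepartureLaw Q n⟩
  have key := capacity_eq isReference_volume isClock_id (isDensity_rnDeriv hac) hpos hμ hmean
    (isInputFamily_expMeasure μ) hμ.le (fun θ h0 h1 => hasExcess_expMeasure h0 h1.le) Q
    (ρ := fun θ n y => ((Q.interdepartureLaw ν (expMeasure θ) n).rnDeriv volume y).toReal)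
    (fun θ h0 _ n => by
      obtain ⟨h2, h3⟩ := hdens θ h0 n
      exact isDensity_rnDeriv h2)
    (fun θ h0 h1 => by
      have h2 := hlim θ h0 h1
      rw [diffEntropy_expMeasure h0] at h2
      refine h2.trans (le_of_eq ?_)
      congr 1
      funext n
      obtain ⟨h2, h3⟩ := hdens θ h0 n
      rw [diffEntropy_eq h2])
    hlam hcase
  rw [← diffEntropy_eq hac, ← diffEntropy_expMeasure hlam] at key
  exact key

end TimingChannel

/-- The first conjunct is the discrete-time model (service times in `{1, 2, …}`), the second one the
continuous-time model (nonnegative service times with a density). -/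
theorem theorem3p5 :
    (∀ (ν : Measure ℕ) (_ : IsProbabilityMeasure ν) (_ : ν {0} = 0)
      (μ : ℝ) (_ : 0 < μ) (_ : ∫⁻ s, (s : ℝ≥0∞) ∂ν = ENNReal.ofReal (1 / μ))
      (Q : TimingChannel.Discipline ℕ)
      (_ : ∀ lam : ℝ, 0 < lam → lam < μ →
        (TimingChannel.geomEntropy lam : EReal) ≤
          liminf (fun n : ℕ => TimingChannel.shannonEntropy
            (Q.interdepartureLaw ν (TimingChannel.geomLaw lam) n) / (n : EReal)) atTop)
      (lam : ℝ) (_ : 0 < lam) (_ : lam < μ ∨ (lam = μ ∧ Q = TimingChannel.fifo ℕ)),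
      Q.feedbackCapacity ν (fun t : ℕ => (t : ℝ)) lam = Q.capacity ν (fun t : ℕ => (t : ℝ)) lam ∧
      Q.capacity ν (fun t : ℕ => (t : ℝ)) lam =
        (lam : EReal) *
          ((TimingChannel.geomEntropy lam : EReal) - TimingChannel.shannonEntropy ν)) ∧
    (∀ (ν : Measure ℝ) (_ : IsProbabilityMeasure ν) (_ : ν (Set.Iio 0) = 0)
      (_ : ν ≪ (volume : Measure ℝ))
      (μ : ℝ) (_ : 0 < μ) (_ : ∫⁻ s, ENNReal.ofReal s ∂ν = ENNReal.ofReal (1 / μ))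
      (Q : TimingChannel.Discipline ℝ)
      (_ : ∀ lam : ℝ, 0 < lam → lam < μ →
        TimingChannel.diffEntropy (expMeasure lam) ≤
          liminf (fun n : ℕ => TimingChannel.diffEntropy
            (Q.interdepartureLaw ν (expMeasure lam) n) / (n : EReal)) atTop)
      (lam : ℝ) (_ : 0 < lam) (_ : lam < μ ∨ (lam = μ ∧ Q = TimingChannel.fifo ℝ)),
      Q.feedbackCapacity ν (fun t : ℝ => t) lam = Q.capacity ν (fun t : ℝ => t) lam ∧
      Q.capacity ν (fun t : ℝ => t) lam =
        (lam : EReal) *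
          (TimingChannel.diffEntropy (expMeasure lam) - TimingChannel.diffEntropy ν)) := by
  refine ⟨?_, ?_⟩
  · intro ν hν h0 μ hμ hmean Q hlim lam hlam hcase
    exact TimingChannel.capacity_eq_nat ν h0 hμ hmean Q hlim hlam hcase
  · intro ν hν hneg hac μ hμ hmean Q hlim lam hlam hcase
    exact TimingChannel.capacity_eq_real ν hneg hac hμ hmean Q hlim hlam hcase
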